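/- **Setting.** Let $\xi,\zeta$ be random variables and $f(\theta,\phi;\xi)$, $g(\theta,\phi;\zeta)$ real functions of $(\theta,\phi)\in\mathbb R^d\times\mathbb R^q$ (Euclidean norms throughout, operator norm for matrices), measurable in the sample, $C^1$ respectively $C^2$ in $(\theta,\phi)$, with finite expectations $f(\theta,\phi)=\mathbb E_\xi f(\theta,\phi;\xi)$ of class $C^1$ and $g(\theta,\phi)=\mathbb E_\zeta g(\theta,\phi;\zeta)$ of class $C^2$. Assume: * for every $\theta$, $\phi\mapsto g(\theta,\phi)$ is $\mu_g$-strongly convex, $\mu_g>0$; * $f,\nabla f,\nabla g,\nabla^2 g$ are Lipschitz on $\mathbb R^{d+q}$ with constants $\ell_{f,0},\ell_{f,1},\ell_{g,1},\ell_{g,2}$; * the estimators $\nabla f(\cdot;\xi),\nabla g(\cdot;\zeta),\nabla^2g(\cdot;\zeta)$ of $\nabla f,\nabla g,\nabla^2g$ have variances bounded uniformly in $(\theta,\phi)$. Let $\phi^*(\theta)=\operatorname{argmin}_\phi g(\theta,\phi)$ and $V(\theta)=\mathbb E_\xi f(\theta,\phi^*(\theta);\xi)$, and assume that $V$ is bounded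 below. **Algorithm.** Given integers $T,N\ge1$, $\rho_1,\rho_2\in[0,1)$, $\delta>0$, $c_\gamma,c_{\tilde\gamma}>0$ and initial points $\theta_0,\phi_0$, let $\gamma_n=c_\gamma n^{-1/2}$ and $\tilde\gamma_n=c_{\tilde\gamma}n^{-1/2}/T$, and start from $m_{-1}=0$, $V_{-1}=0$, $\hat V_{-1}=0$. For $k=0,1,\dots$: set $\phi_{k,0}=\phi_k$; for $0\le t<T$ set $\phi_{k,t+1}=\phi_{k,t}-\tilde\gamma_{k+1}\nabla_\phi g(\theta_k,\phi_{k,t};\zeta_{k,t})$; set $\phi_{k+1}=\phi_{k,T}$; compute $$H_k=\nabla_\theta f(\theta_k,\phi_{k+1};\xi_k)-\nabla^2_{\theta\phi}g(\theta_k,\phi_{k+1};\zeta_k^{(0)})\,\widehat G_k\,\nabla_\phi f(\theta_k,\phi_{k+1};\xi_k),$$ $$\widehat G_k=\frac{N}{\ell_{g,1}}\prod_{i=1}^{N'_k}\Big(I-\frac1{\ell_{g,1}}\nabla^2_\phi g(\theta_k,\phi_{k+1};\zeta_k^{(i)})\Big),$$ with $N'_k$ uniform on $\{0,\dots,N-1\}$;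 then $m_k=\rho_1m_{k-1}+(1-\rho_1)H_k$, $V_k=\rho_2V_{k-1}+(1-\rho_2)H_kH_k^\top$, $\hat V_k=\max(\hat V_{k-1},\mathrm{Diag}(V_k))$ entrywise, $A_k=(\delta I_d+\hat V_k)^{-1/2}$ and $\theta_{k+1}=\theta_k-\gamma_{k+1}A_km_k$. All $\xi_k$, $\zeta_{k,t}$, $\zeta_k^{(i)}$, $N'_k$ are independent, the $\xi_k$ distributed as $\xi$ and the $\zeta$'s as $\zeta$. Assume that the stochastic updates are bounded: there is $M$ with $\|H_k\|\le M$ almost surely for all $k$. **Theorem.** The minimiser $\phi^*(\theta)$ exists for every $\theta$ and $V$ is differentiable. Put $$\tilde b=\frac{\ell_{g,1}\ell_{f,0}}{\mu_g}\Big(1-\frac{\mu_g}{\ell_{g,1}}\Big)^N .$$ For $n\ge1$ let $R$ be uniform on $\{0,\dots,n\}$, independent of the iterates. Then: 1. For all $c_\gamma,c_{\tilde\gamma}>0$ there is a constant $C$, not depending on $n$, such that for all $n\ge1$ $$\mathbb E\big[\|\nabla V(\theta_R)\|^2\big]\le C\Big(\frac{\log n}{\sqrt n}+b_n\Big),\qquad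 b_n=\frac{\sum_{k=0}^n\gamma_{k+1}\tilde b^2}{\sqrt n}+\frac1{\sqrt n}.$$ 2. The coefficient of the Neumann bias can be taken independent of $N$ except through $M$: there is $K$ that does not depend on $N,T,M,c_\gamma,c_{\tilde\gamma},n$, and there is $\kappa$ that does not depend on $c_\gamma,c_{\tilde\gamma},n$, such that if $c_{\tilde\gamma}\ge\kappa c_\gamma$ then, for some $C$ not depending on $n$ and all $n\ge1$, $$\mathbb E\big[\|\nabla V(\theta_R)\|^2\big]\le C\,\frac{\log n+1}{\sqrt n}+\frac{K(1+M^2)}{c_\gamma}\cdot\frac{\sum_{k=0}^n\gamma_{k+1}\tilde b^2}{\sqrt n}.$$ -/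

import Mathlib

open MeasureTheory ProbabilityTheory
open scoped NNReal ENNReal

noncomputable section

namespace Bilevel

/-- The joint variable `(θ, φ)`, with `θ ∈ ℝᵈ` and `φ ∈ ℝ^q`; the `WithLp 2` product carries the
Euclidean norm of `ℝ^(d+q)`. -/
abbrev Joint (d q : ℕ) : Type :=
  WithLp 2 (EuclideanSpace ℝ (Fin d) × EuclideanSpace ℝ (Fin q))

/-- The point `(θ, φ)` of the joint space. -/
def pt {d q : ℕ} (θ : EuclideanSpace ℝ (Fin d)) (φ : EuclideanSpace ℝ (Fin q)) : Joint d q :=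
  WithLp.toLp 2 (θ, φ)

/-- The embedding `φ ↦ (0, φ)` of the lower-level space into the joint space. -/
def inrL (d q : ℕ) : EuclideanSpace ℝ (Fin q) →L[ℝ] Joint d q :=
  (WithLp.prodContinuousLinearEquiv 2 ℝ (EuclideanSpace ℝ (Fin d))
      (EuclideanSpace ℝ (Fin q))).symm.toContinuousLinearMap.comp
    (ContinuousLinearMap.inr ℝ (EuclideanSpace ℝ (Fin d)) (EuclideanSpace ℝ (Fin q)))

section derivatives

variable {d q : ℕ}

/-- `∇_θ u (θ, φ)`. -/
def gradTheta (u : Joint d q → ℝ) (x : Joint d q) : EuclideanSpace ℝ (Fin d) :=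
  (gradient u x).fst

/-- `∇_φ u (θ, φ)`. -/
def gradPhi (u : Joint d q → ℝ) (x : Joint d q) : EuclideanSpace ℝ (Fin q) :=
  (gradient u x).snd

/-- The full Hessian `∇² u (θ, φ)`, as an operator on the joint space. -/
def hess (u : Joint d q → ℝ) (x : Joint d q) : Joint d q →L[ℝ] Joint d q :=
  fderiv ℝ (gradient u) x

/-- The block `∇²_φ u (θ, φ) : ℝ^q → ℝ^q` of the Hessian. -/
def hessPhi (u : Joint d q → ℝ) (x : Joint d q) :
    EuclideanSpace ℝ (Fin q) →L[ℝ] EuclideanSpace ℝ (Fin q) :=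
  (WithLp.sndL 2 ℝ (EuclideanSpace ℝ (Fin d)) (EuclideanSpace ℝ (Fin q))).comp
    ((hess u x).comp (inrL d q))

/-- The mixed block `∇²_{θφ} u (θ, φ) : ℝ^q → ℝᵈ` of the Hessian. -/
def hessThetaPhi (u : Joint d q → ℝ) (x : Joint d q) :
    EuclideanSpace ℝ (Fin q) →L[ℝ] EuclideanSpace ℝ (Fin d) :=
  (WithLp.fstL 2 ℝ (EuclideanSpace ℝ (Fin d)) (EuclideanSpace ℝ (Fin q))).comp
    ((hess u x).comp (inrL d q))

end derivatives

/-- The data of a stochastic bilevel problem: the upper-level function `f(θ, φ; ξ)`, the lower-level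
function `g(θ, φ; ζ)`, and the laws of `ξ` and `ζ`. -/
structure Problem (d q : ℕ) (Ξ Z : Type*) [MeasurableSpace Ξ] [MeasurableSpace Z] where
  f : Joint d q → Ξ → ℝ
  g : Joint d q → Z → ℝ
  lawXi : Measure Ξ
  lawZeta : Measure Z

namespace Problem

variable {d q : ℕ} {Ξ Z : Type*} [MeasurableSpace Ξ] [MeasurableSpace Z]

/-- `f(θ, φ) = 𝔼_ξ [f(θ, φ; ξ)]`. -/
def meanF (P : Problem d q Ξ Z) (x : Joint d q) : ℝ := ∫ ξ, P.f x ξ ∂P.lawXi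

/-- `g(θ, φ) = 𝔼_ζ [g(θ, φ; ζ)]`. -/
def meanG (P : Problem d q Ξ Z) (x : Joint d q) : ℝ := ∫ ζ, P.g x ζ ∂P.lawZeta

/-- `φ` minimises the lower-level objective `g(θ, ·)`. -/
def IsLowerSol (P : Problem d q Ξ Z) (θ : EuclideanSpace ℝ (Fin d))
    (φ : EuclideanSpace ℝ (Fin q)) : Prop :=
  ∀ φ' : EuclideanSpace ℝ (Fin q), P.meanG (pt θ φ) ≤ P.meanG (pt θ φ')

/-- `φ*(θ)`, a minimiser of the lower-level objective `g(θ, ·)`. -/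
def lowerSol (P : Problem d q Ξ Z) (θ : EuclideanSpace ℝ (Fin d)) : EuclideanSpace ℝ (Fin q) :=
  Classical.epsilon (P.IsLowerSol θ)

/-- The upper-level objective `V(θ) = 𝔼_ξ [f(θ, φ*(θ); ξ)]`. -/
def V (P : Problem d q Ξ Z) (θ : EuclideanSpace ℝ (Fin d)) : ℝ :=
  ∫ ξ, P.f (pt θ (P.lowerSol θ)) ξ ∂P.lawXi

/-- Standing regularity: `ξ` and `ζ` are random variables, all expectations exist, and the functions
have the derivatives that the algorithm and the assumptions refer to. -/
structure Regular (P : Problem d q Ξ Z) : Prop where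
  prob_xi : IsProbabilityMeasure P.lawXi
  prob_zeta : IsProbabilityMeasure P.lawZeta
  measurable_f : ∀ x, Measurable (P.f x)
  measurable_g : ∀ x, Measurable (P.g x)
  integrable_f : ∀ x, Integrable (P.f x) P.lawXi
  integrable_g : ∀ x, Integrable (P.g x) P.lawZeta
  contDiff_f : ∀ ξ, ContDiff ℝ 1 (fun x => P.f x ξ)
  contDiff_g : ∀ ζ, ContDiff ℝ 2 (fun x => P.g x ζ)
  contDiff_meanF : ContDiff ℝ 1 P.meanF
  contDiff_meanG : ContDiff ℝ 2 P.meanG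

/-- The lower-level objective is `μg`-strongly convex in `φ`, for every `θ`. -/
def StronglyConvexLower (P : Problem d q Ξ Z) (μg : ℝ) : Prop :=
  0 < μg ∧ ∀ θ, StrongConvexOn Set.univ μg (fun φ => P.meanG (pt θ φ))

/-- `f`, `∇f`, `∇g`, `∇²g` are Lipschitz with constants `ℓf0`, `ℓf1`, `ℓg1`, `ℓg2`. -/
structure LipschitzReg (P : Problem d q Ξ Z) (ℓf0 ℓf1 ℓg1 ℓg2 : ℝ≥0) : Prop where
  f : LipschitzWith ℓf0 P.meanF
  grad_f : LipschitzWith ℓf1 (gradient P.meanF)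
  grad_g : LipschitzWith ℓg1 (gradient P.meanG)
  hess_g : LipschitzWith ℓg2 (hess P.meanG)

/-- The estimators `∇f(·; ξ)`, `∇g(·; ζ)`, `∇²g(·; ζ)` of `∇f`, `∇g`, `∇²g` have variances bounded
by `σf²`, `σg1²`, `σg2²`, uniformly in `(θ, φ)`. -/
structure BoundedVariance (P : Problem d q Ξ Z) (σf σg1 σg2 : ℝ≥0) : Prop where
  grad_f : ∀ x, ∫⁻ ξ, ‖gradient (fun y => P.f y ξ) x - gradient P.meanF x‖ₑ ^ 2 ∂P.lawXi
    ≤ (σf : ℝ≥0∞) ^ 2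
  grad_g : ∀ x, ∫⁻ ζ, ‖gradient (fun y => P.g y ζ) x - gradient P.meanG x‖ₑ ^ 2 ∂P.lawZeta
    ≤ (σg1 : ℝ≥0∞) ^ 2
  hess_g : ∀ x, ∫⁻ ζ, ‖hess (fun y => P.g y ζ) x - hess P.meanG x‖ₑ ^ 2 ∂P.lawZeta
    ≤ (σg2 : ℝ≥0∞) ^ 2

end Problem

/-- The parameters of the algorithm: lower-level iterations `T`, length `N` and scaling `ℓ` of the
Hessian-inverse estimator, momentum parameters, regularization `δ`, initial points, and the
constants of the two step sizes. -/
structure Params (d q : ℕ) where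
  T : ℕ
  N : ℕ
  ℓ : ℝ
  ρ₁ : ℝ
  ρ₂ : ℝ
  δ : ℝ
  θ₀ : EuclideanSpace ℝ (Fin d)
  φ₀ : EuclideanSpace ℝ (Fin q)
  cUp : ℝ
  cLow : ℝ

/-- Upper-level step size `γ_n = c_γ n^(-1/2)`. -/
def Params.stepUp {d q : ℕ} (p : Params d q) (n : ℕ) : ℝ :=
  p.cUp * (n : ℝ) ^ (-(1 / 2) : ℝ)

/-- Lower-level step size `γ̃_n = c_γ̃ n^(-1/2) / T`. -/
def Params.stepLow {d q : ℕ} (p : Params d q) (n : ℕ) : ℝ :=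
  p.cLow * (n : ℝ) ^ (-(1 / 2) : ℝ) / (p.T : ℝ)

/-- The random draws used in one iteration `k`: the upper-level sample `ξ_k`, the samples
`ζ_k^(0), ζ_k^(1), …` of the Hessian estimators, the samples `ζ_{k,0}, ζ_{k,1}, …` of the inner
loop, and the random length `N'`. -/
structure Draws (Ξ Z : Type*) where
  xi : Ξ
  zeta : ℕ → Z
  inner : ℕ → Z
  len : ℕ

/-- The state at the start of iteration `k`: `θ_k`, `φ_k`, `m_{k-1}`, `V_{k-1}` and the diagonal of
`V̂_{k-1}`. -/
structure State (d q : ℕ) where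
  θ : EuclideanSpace ℝ (Fin d)
  φ : EuclideanSpace ℝ (Fin q)
  m : EuclideanSpace ℝ (Fin d)
  V : Matrix (Fin d) (Fin d) ℝ
  Vhat : Fin d → ℝ

section algorithm

variable {d q : ℕ} {Ξ Z : Type*} [MeasurableSpace Ξ] [MeasurableSpace Z]

/-- The inner loop: `t` steps of SGD on the lower level, started at `φ`, with `θ` frozen. -/
def innerSGD (P : Problem d q Ξ Z) (η : ℝ) (θ : EuclideanSpace ℝ (Fin d)) (ζ : ℕ → Z)
    (φ : EuclideanSpace ℝ (Fin q)) : ℕ → EuclideanSpace ℝ (Fin q)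
  | 0 => φ
  | t + 1 =>
      innerSGD P η θ ζ φ t
        - η • gradPhi (fun x => P.g x (ζ t)) (pt θ (innerSGD P η θ ζ φ t))

/-- The Hessian-inverse estimator
`Ĝ = (N / ℓ) ∏_{i = 1}^{N'} (I - (1 / ℓ) ∇²_φ g(θ, φ; ζ^(i)))`. -/
def hessInvEst (P : Problem d q Ξ Z) (p : Params d q) (D : Draws Ξ Z) (x : Joint d q) :
    EuclideanSpace ℝ (Fin q) →L[ℝ] EuclideanSpace ℝ (Fin q) :=
  ((p.N : ℝ) / p.ℓ) •
    ((List.range D.len).map fun i =>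
      (1 : EuclideanSpace ℝ (Fin q) →L[ℝ] EuclideanSpace ℝ (Fin q))
        - (1 / p.ℓ) • hessPhi (fun y => P.g y (D.zeta (i + 1))) x).prod

/-- The stochastic update
`H = ∇_θ f(θ, φ; ξ) - ∇²_{θφ} g(θ, φ; ζ^(0)) Ĝ ∇_φ f(θ, φ; ξ)`. -/
def update (P : Problem d q Ξ Z) (p : Params d q) (D : Draws Ξ Z) (x : Joint d q) :
    EuclideanSpace ℝ (Fin d) :=
  gradTheta (fun y => P.f y D.xi) x
    - hessThetaPhi (fun y => P.g y (D.zeta 0)) x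
        (hessInvEst P p D x (gradPhi (fun y => P.f y D.xi) x))

/-- The lower-level variable `φ_{k+1} = φ_{k,T}` that iteration `k` computes first. -/
def nextPhi (P : Problem d q Ξ Z) (p : Params d q) (D : Draws Ξ Z) (k : ℕ) (S : State d q) :
    EuclideanSpace ℝ (Fin q) :=
  innerSGD P (p.stepLow (k + 1)) S.θ D.inner S.φ p.T

/-- The stochastic update `H_k`, evaluated at `(θ_k, φ_{k+1})`. -/
def stateUpdate (P : Problem d q Ξ Z) (p : Params d q) (D : Draws Ξ Z) (k : ℕ) (S : State d q) :
    EuclideanSpace ℝ (Fin d) :=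
  update P p D (pt S.θ (nextPhi P p D k S))

/-- `m_k = ρ₁ m_{k-1} + (1 - ρ₁) H_k`. -/
def nextM (p : Params d q) (H : EuclideanSpace ℝ (Fin d)) (S : State d q) :
    EuclideanSpace ℝ (Fin d) :=
  p.ρ₁ • S.m + (1 - p.ρ₁) • H

/-- `V_k = ρ₂ V_{k-1} + (1 - ρ₂) H_k H_kᵀ`. -/
def nextV (p : Params d q) (H : EuclideanSpace ℝ (Fin d)) (S : State d q) :
    Matrix (Fin d) (Fin d) ℝ :=
  p.ρ₂ • S.V + (1 - p.ρ₂) • Matrix.vecMulVec H.ofLp H.ofLp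

/-- The diagonal of `V̂_k = max(V̂_{k-1}, Diag(V_k))`. -/
def nextVhat (p : Params d q) (H : EuclideanSpace ℝ (Fin d)) (S : State d q) : Fin d → ℝ :=
  fun i => max (S.Vhat i) ((nextV p H S).diag i)

/-- `A_k = (δ I_d + V̂_k)^(-1/2)`, a diagonal matrix. -/
def adaptiveMatrix (p : Params d q) (H : EuclideanSpace ℝ (Fin d)) (S : State d q) :
    Matrix (Fin d) (Fin d) ℝ :=
  Matrix.diagonal fun i => (p.δ + nextVhat p H S i) ^ (-(1 / 2) : ℝ)

/-- Iteration `k` of the algorithm; the upper-level move is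
`θ_{k+1} = θ_k - γ_{k+1} A_k m_k`. -/
def step (P : Problem d q Ξ Z) (p : Params d q) (D : Draws Ξ Z) (k : ℕ) (S : State d q) :
    State d q where
  θ := S.θ - p.stepUp (k + 1) •
    WithLp.toLp 2 ((adaptiveMatrix p (stateUpdate P p D k S) S).mulVec
      (nextM p (stateUpdate P p D k S) S).ofLp)
  φ := nextPhi P p D k S
  m := nextM p (stateUpdate P p D k S) S
  V := nextV p (stateUpdate P p D k S) S
  Vhat := nextVhat p (stateUpdate P p D k S) S

/-- The state at the start of iteration `k`, for given draws. -/
def state (P : Problem d q Ξ Z) (p : Params d q) (D : ℕ → Draws Ξ Z) : ℕ → State d q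
  | 0 => ⟨p.θ₀, p.φ₀, 0, 0, 0⟩
  | k + 1 => step P p (D k) k (state P p D k)

/-- The iterate `θ_k` as a random vector. -/
def iterate {Ω : Type*} (P : Problem d q Ξ Z) (p : Params d q) (D : ℕ → Ω → Draws Ξ Z)
    (k : ℕ) (ω : Ω) : EuclideanSpace ℝ (Fin d) :=
  (state P p (fun j => D j ω) k).θ

/-- The stochastic update `H_k` as a random vector. -/
def updateAt {Ω : Type*} (P : Problem d q Ξ Z) (p : Params d q) (D : ℕ → Ω → Draws Ξ Z)
    (k : ℕ) (ω : Ω) : EuclideanSpace ℝ (Fin d) :=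
  stateUpdate P p (D k ω) k (state P p (fun j => D j ω) k)

/-- Names of the individual random draws. -/
inductive DrawIdx where
  | xi (k : ℕ)
  | zeta (k i : ℕ)
  | inner (k t : ℕ)
  | len (k : ℕ)

/-- The σ-algebra generated by one draw. -/
@[reducible] def drawSigma {Ω : Type*} (D : ℕ → Ω → Draws Ξ Z) : DrawIdx → MeasurableSpace Ω
  | .xi k => MeasurableSpace.comap (fun ω => (D k ω).xi) inferInstance
  | .zeta k i => MeasurableSpace.comap (fun ω => (D k ω).zeta i) inferInstance
  | .inner k t => MeasurableSpace.comap (fun ω => (D k ω).inner t) inferInstance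
  | .len k => MeasurableSpace.comap (fun ω => (D k ω).len) inferInstance

/-- All draws are independent, the `ξ`'s and `ζ`'s have their prescribed laws, and each `N'` is
uniform on `{0, …, N - 1}`. -/
structure IsSampling {Ω : Type*} [MeasurableSpace Ω] (Pr : Measure Ω) (P : Problem d q Ξ Z)
    (N : ℕ) (D : ℕ → Ω → Draws Ξ Z) : Prop where
  measurable_xi : ∀ k, Measurable fun ω => (D k ω).xi
  measurable_zeta : ∀ k i, Measurable fun ω => (D k ω).zeta i
  measurable_inner : ∀ k t, Measurable fun ω => (D k ω).inner t
  measurable_len : ∀ k, Measurable fun ω => (D k ω).len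
  law_xi : ∀ k, Pr.map (fun ω => (D k ω).xi) = P.lawXi
  law_zeta : ∀ k i, Pr.map (fun ω => (D k ω).zeta i) = P.lawZeta
  law_inner : ∀ k t, Pr.map (fun ω => (D k ω).inner t) = P.lawZeta
  law_len : ∀ k, ∀ j < N, Pr {ω | (D k ω).len = j} = (N : ℝ≥0∞)⁻¹
  indep : iIndep (drawSigma D) Pr

/-- `R` is uniform on `{0, …, n}` and independent of the sequence of iterates. -/
structure IsUniformIndex {Ω : Type*} [MeasurableSpace Ω] (Pr : Measure Ω)
    (θ : ℕ → Ω → EuclideanSpace ℝ (Fin d)) (n : ℕ) (R : Ω → ℕ) : Prop where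
  measurable : Measurable R
  law : ∀ j ≤ n, Pr {ω | R ω = j} = ((n : ℝ≥0∞) + 1)⁻¹
  indep : IndepFun R (fun ω k => θ k ω) Pr

/-- `𝔼 ‖∇V(θ_R)‖²  ≤ B n` for all `n ≥ 1`, with `R` uniform on `{0, …, n}` (and the expectation
exists). -/
def RandomIterateBound {Ω : Type*} [MeasurableSpace Ω] (Pr : Measure Ω) (P : Problem d q Ξ Z)
    (θ : ℕ → Ω → EuclideanSpace ℝ (Fin d)) (B : ℕ → ℝ) : Prop :=
  ∀ n : ℕ, 1 ≤ n → ∀ R : Ω → ℕ, IsUniformIndex Pr θ n R →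
    Integrable (fun ω => ‖gradient P.V (θ (R ω) ω)‖ ^ 2) Pr ∧
    ∫ ω, ‖gradient P.V (θ (R ω) ω)‖ ^ 2 ∂Pr ≤ B n

/-- `b̃ = ℓg1 ℓf0 μg⁻¹ (1 - μg / ℓg1)^N`, the bias of the truncated Neumann series. -/
def neumannBias (μg ℓf0 ℓg1 : ℝ) (N : ℕ) : ℝ :=
  ℓg1 * ℓf0 * (1 / μg) * (1 - μg / ℓg1) ^ N

/-- `(∑_{k = 0}^n γ_{k+1} b̃²) / √n`. -/
def weightedBias (p : Params d q) (b : ℝ) (n : ℕ) : ℝ :=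
  (∑ k ∈ Finset.range (n + 1), p.stepUp (k + 1) * b ^ 2) / Real.sqrt n

end algorithm

end Bilevel

end

/-! Differentiating `∇_φ g(θ, φ*(θ)) = 0` gives the derivative of `φ*`, so `∇V(θ)` is the
hypergradient `surrogate` at `(θ, φ*(θ))`. The expansions of `φ*` and `V` are proved with explicit
quadratic remainders (`exists_lowerSol_taylor`, `exists_V_taylor`), and `surrogate` is Lipschitz in
both variables (`exists_surrogate_lipschitz`). Given `θ_k` and `φ_{k+1}`, the update `H_k` has as
its mean the same expression with the inverse Hessian replaced by a truncated Neumann series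
(`integral_update`); the error of this replacement is at most `|b̃|` (`norm_truncSurrogate_sub_le`).
Unbiasedness of the sampled derivatives is not a hypothesis: the variance bounds allow
differentiation under the expectation (`integral_fderiv_eq`).

Two features of the algorithm prevent a direct descent argument: the momentum, and the correlation
of `A_k` with `H_k`. Both disappear along `z_k = θ_k - ρ₁/(1-ρ₁) γ_k A_{k-1} m_{k-1}`. By
`auxPoint_step`, `z_{k+1} - z_k = -γ_{k+1} A_{k-1} H_k` up to errors bounded by the decrease of the
trace of `γ A`. These errors telescope (`exists_pathwise_bound`), and `A_{k-1}` is known before the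
draws of iteration `k`, so `H_k` may be replaced by its conditional mean
(`integral_inner_updateAt`).

Let `v_k` be the mean of `‖∇V(z_k)‖²`, and let `u_k`, `e_k` be the mean squared distances of `φ_k`,
`φ_{k+1}` to `φ*(z_k)`. Descent of `V` yields `γ v_k` at the cost of `γ (b̃² + e_k)`
(`exists_descent`). The inner loop contracts `u_k` to `e_k` (`exists_inner_loop_le`), while the
motion of `φ*(z_k)` feeds `γ c (e_k + v_k + b̃²)` back into `u_{k+1}`, with `c = couplingBound`
(`exists_tracking`). The two step sizes decay at the same rate, so this feedback loop closes only if
their ratio is large compared with `c`; this is the role of `κ`. A weighted sum of `V` and `u` is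
then a Lyapunov function (`LogBdd.of_descent_of_tracking`). The remaining errors are summable or of
order `γ²`, hence contribute `log n`, and division by `c_γ √n` gives the second bound.

For arbitrary step constants there is a dichotomy (`exists_randomIterateBound`). If `b̃ ≠ 0`, the
right-hand side stays away from zero while `∇V` is bounded, and there is nothing to prove. If `b̃ =
0`, either `ℓf0 = 0` and `∇V = 0`, or `c = 0` (as when `ℓg1 = μg`): the mixed Hessian block then
vanishes, there is no feedback, and any ratio of step sizes is admissible. -/

namespace Bilevel

/-! ### Sequences with logarithmically bounded partial sums -/

/-- The partial sums of `a` are bounded above by a multiple of `1 + log (n + 1)`. -/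
def LogBdd (a : ℕ → ℝ) : Prop :=
  ∃ C : ℝ, ∀ n : ℕ, ∑ k ∈ Finset.range (n + 1), a k ≤ C * (1 + Real.log (n + 1))

namespace LogBdd

lemma one_le_weight (n : ℕ) : 1 ≤ 1 + Real.log ((n : ℝ) + 1) := by
  have : 0 ≤ Real.log ((n : ℝ) + 1) := Real.log_nonneg (by linarith [n.cast_nonneg (α := ℝ)])
  linarith

lemma of_sum_le {a : ℕ → ℝ} {C : ℝ} (h : ∀ n, ∑ k ∈ Finset.range (n + 1), a k ≤ C) :
    LogBdd a := by
  refine ⟨|C|, fun n => (h n).trans ((le_abs_self C).trans ?_)⟩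
  nlinarith [one_le_weight n, abs_nonneg C]

lemma add {a b : ℕ → ℝ} (ha : LogBdd a) (hb : LogBdd b) : LogBdd fun k => a k + b k := by
  obtain ⟨A, hA⟩ := ha
  obtain ⟨B, hB⟩ := hb
  refine ⟨A + B, fun n => ?_⟩
  rw [Finset.sum_add_distrib, add_mul]
  exact add_le_add (hA n) (hB n)

lemma const_mul {a : ℕ → ℝ} (ha : LogBdd a) {c : ℝ} (hc : 0 ≤ c) : LogBdd fun k => c * a k := by
  obtain ⟨A, hA⟩ := ha
  refine ⟨c * A, fun n => ?_⟩
  rw [← Finset.mul_sum, mul_assoc]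
  exact mul_le_mul_of_nonneg_left (hA n) hc

lemma mono {a b : ℕ → ℝ} (hb : LogBdd b) (h : ∀ k, a k ≤ b k) : LogBdd a := by
  obtain ⟨B, hB⟩ := hb
  exact ⟨B, fun n => (Finset.sum_le_sum fun k _ => h k).trans (hB n)⟩

lemma of_eventually_zero {a : ℕ → ℝ} {k₀ : ℕ} (h : ∀ k, k₀ ≤ k → a k ≤ 0) : LogBdd a := by
  refine of_sum_le (C := ∑ k ∈ Finset.range k₀, |a k|) fun n => ?_
  calc ∑ k ∈ Finset.range (n + 1), a k
      ≤ ∑ k ∈ Finset.range (n + 1), if k < k₀ then |a k| else 0 := by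
        refine Finset.sum_le_sum fun k _ => ?_
        split_ifs with hk
        · exact le_abs_self _
        · exact h k (not_lt.mp hk)
    _ = ∑ k ∈ (Finset.range (n + 1)).filter (· < k₀), |a k| := (Finset.sum_filter _ _).symm
    _ ≤ ∑ k ∈ Finset.range k₀, |a k| := by
        refine Finset.sum_le_sum_of_subset_of_nonneg (fun k hk => ?_) fun _ _ _ => abs_nonneg _
        exact Finset.mem_range.mpr (Finset.mem_filter.mp hk).2

/-- Finitely many indices only change the constant. This admits the contraction of the inner loop,
which is available only once the step size is small. -/
lemma mono_eventually {a b : ℕ → ℝ} (hb : LogBdd b) (h : ∀ᶠ k in Filter.atTop, a k ≤ b k) :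
    LogBdd a := by
  obtain ⟨k₀, hk₀⟩ := Filter.eventually_atTop.mp h
  have : LogBdd fun k => a k - b k := of_eventually_zero fun k hk => sub_nonpos.mpr (hk₀ k hk)
  exact (this.add hb).mono fun k => by simp

/-- The last term enters with a minus sign, so a lower bound on the sequence is enough. -/
lemma telescope {D : ℕ → ℝ} {B : ℝ} (h : ∀ k, B ≤ D k) : LogBdd fun k => D k - D (k + 1) := by
  refine of_sum_le (C := D 0 - B) fun n => ?_
  rw [Finset.sum_range_sub']
  linarith [h (n + 1)]

lemma inv_succ : LogBdd fun k => ((k : ℝ) + 1)⁻¹ := by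
  refine ⟨1, fun n => ?_⟩
  have := harmonic_le_one_add_log (n + 1)
  simp only [harmonic, Rat.cast_sum, Rat.cast_inv, Rat.cast_natCast] at this
  push_cast at this
  simpa using this

end LogBdd

/-! ### First-order Taylor estimate -/

section calculus

variable {E F : Type*} [NormedAddCommGroup E] [NormedSpace ℝ E] [NormedAddCommGroup F]
  [NormedSpace ℝ F]

/-- First-order Taylor estimate for a function whose derivative is Lipschitz. -/
lemma norm_taylor_le {u : E → F} {u' : E → E →L[ℝ] F} {L : ℝ}
    (hu : ∀ x, HasFDerivAt u (u' x) x) (hL : ∀ x y, ‖u' x - u' y‖ ≤ L * ‖x - y‖) (x y : E) :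
    ‖u y - u x - u' x (y - x)‖ ≤ L * ‖y - x‖ ^ 2 := by
  have hL0 : 0 ≤ L * ‖y - x‖ := (norm_nonneg _).trans (hL y x)
  have := (convex_segment x y).norm_image_sub_le_of_norm_hasFDerivWithin_le'
    (f := u) (f' := u') (φ := u' x) (C := L * ‖y - x‖)
    (fun z _ => (hu z).hasFDerivWithinAt) (fun z hz => ?_)
    (left_mem_segment ℝ x y) (right_mem_segment ℝ x y)
  · simpa [sq, mul_assoc] using this
  -- The sign of `L` is not assumed; it follows from `hL` as soon as there are two distinct points.
  · rcases eq_or_ne x y with rfl | hxy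
    · have : z = x := by simpa using hz
      simp [this]
    · have hL' : 0 ≤ L := by
        have : 0 < ‖y - x‖ := norm_pos_iff.mpr (sub_ne_zero.mpr hxy.symm)
        exact nonneg_of_mul_nonneg_left hL0 this
      refine (hL z x).trans (mul_le_mul_of_nonneg_left ?_ hL')
      obtain ⟨s, t, hs, ht, hst, rfl⟩ := hz
      have : s • x + t • y - x = t • (y - x) := by
        rw [← eq_sub_iff_add_eq] at hst
        rw [hst, smul_sub, sub_smul, one_smul]; abel
      rw [this, norm_smul, Real.norm_of_nonneg ht]
      exact mul_le_of_le_one_left (norm_nonneg _) (by linarith)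

end calculus

/-! ### Measurability of derivatives in the sample -/

section measurability

variable {Ω : Type*} {mΩ : MeasurableSpace Ω}

/-- In finite dimension an operator is a finite sum of coordinate functionals tensored with its
values on a basis, so it inherits measurability from its columns. -/
lemma measurable_of_apply {E F : Type*} [NormedAddCommGroup E] [NormedSpace ℝ E]
    [FiniteDimensional ℝ E] [NormedAddCommGroup F] [NormedSpace ℝ F]
    {A : Ω → E →L[ℝ] F} (h : ∀ v, StronglyMeasurable fun ω => A ω v) : StronglyMeasurable A := by
  let b := Module.finBasis ℝ E
  have hA : A = fun ω => ∑ i, ContinuousLinearMap.smulRightL ℝ E F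
      (LinearMap.toContinuousLinearMap (b.coord i)) (A ω (b i)) := by
    funext ω
    ext v
    conv_lhs => rw [← b.sum_repr v, map_sum]
    simp
  rw [hA]
  exact Finset.stronglyMeasurable_fun_sum _ fun i _ =>
    (ContinuousLinearMap.continuous _).comp_stronglyMeasurable (h (b i))

/-- Each directional derivative is a pointwise limit of difference quotients along the steps `1 / (n
+ 1)`, and these involve the random function at two fixed points only. -/
lemma stronglyMeasurable_fderiv_param {E F : Type*} [NormedAddCommGroup E] [NormedSpace ℝ E]
    [FiniteDimensional ℝ E] [NormedAddCommGroup F] [NormedSpace ℝ F]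
    {u : E → Ω → F} (hd : ∀ ω, Differentiable ℝ fun x => u x ω)
    (hm : ∀ x, StronglyMeasurable (u x)) (x : E) :
    StronglyMeasurable fun ω => fderiv ℝ (fun y => u y ω) x := by
  refine measurable_of_apply fun v => ?_
  refine stronglyMeasurable_of_tendsto Filter.atTop
    (f := fun n : ℕ => fun ω => ((n : ℝ) + 1) • (u (x + ((n : ℝ) + 1)⁻¹ • v) ω - u x ω))
    (fun n => ((hm _).sub (hm _)).const_smul _) ?_
  rw [tendsto_pi_nhds]
  intro ω
  have := (hd ω x).hasFDerivAt.lim v (c := fun n : ℕ => (n : ℝ) + 1) (l := Filter.atTop) ?_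
  · exact this
  · exact (Filter.tendsto_atTop_add_const_right _ _ tendsto_natCast_atTop_atTop).congr
      fun n => (Real.norm_of_nonneg (by positivity)).symm

lemma measurable_comp_nat {α : Type*} {mα : MeasurableSpace α} {u : ℕ → Ω → α} {n : Ω → ℕ}
    (hu : ∀ j, Measurable (u j)) (hn : Measurable n) : Measurable fun ω => u (n ω) ω := by
  have : Measurable fun p : ℕ × Ω => u p.1 p.2 := measurable_from_prod_countable_right hu
  exact this.comp (hn.prodMk measurable_id)

end measurability

/-! ### Differentiation under the expectation from variance bounds -/

section integration

variable {Ω : Type*} [mΩ : MeasurableSpace Ω] {μ : Measure Ω}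

lemma memLp_two_of_lintegral_lt_top {E : Type*} [NormedAddCommGroup E] {u : Ω → E}
    (hu : AEStronglyMeasurable u μ) (h : ∫⁻ ω, ‖u ω‖ₑ ^ 2 ∂μ < ∞) : MemLp u 2 μ := by
  refine ⟨hu, ?_⟩
  have := eLpNorm_nnreal_pow_eq_lintegral (f := u) (μ := μ) (p := 2) (by norm_num)
  have h2 : eLpNorm u 2 μ ^ 2 < ∞ := by
    have : eLpNorm u 2 μ ^ 2 = ∫⁻ ω, ‖u ω‖ₑ ^ 2 ∂μ := by simpa using this
    rwa [this]
  by_contra hc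
  rw [not_lt, top_le_iff] at hc
  simp [hc] at h2

variable [IsProbabilityMeasure μ]

lemma lintegral_enorm_sq_le {E : Type*} [NormedAddCommGroup E] {u : Ω → E}
    (hu : AEStronglyMeasurable u μ) : (∫⁻ ω, ‖u ω‖ₑ ∂μ) ^ 2 ≤ ∫⁻ ω, ‖u ω‖ₑ ^ 2 ∂μ := by
  have h := eLpNorm_le_eLpNorm_of_exponent_le (p := 1) (q := 2) (by norm_num) hu
  rw [eLpNorm_one_eq_lintegral_enorm] at h
  refine (pow_le_pow_left' h 2).trans (le_of_eq ?_)
  have := eLpNorm_nnreal_pow_eq_lintegral (f := u) (μ := μ) (p := 2) (by norm_num)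
  simpa using this

/-- Vitali's theorem for sequences that are bounded in `L²`. -/
lemma tendsto_integral_of_sq_bounded {G : Type*} [NormedAddCommGroup G] [NormedSpace ℝ G]
    {X : ℕ → Ω → G} {Y : Ω → G} {B : ℝ≥0∞} (hB : B < ∞)
    (hX : ∀ n, AEStronglyMeasurable (X n) μ) (hXB : ∀ n, ∫⁻ ω, ‖X n ω‖ₑ ^ 2 ∂μ ≤ B)
    (hY : Integrable Y μ)
    (hlim : ∀ ω, Filter.Tendsto (fun n => X n ω) Filter.atTop (nhds (Y ω))) :
    Filter.Tendsto (fun n => ∫ ω, X n ω ∂μ) Filter.atTop (nhds (∫ ω, Y ω ∂μ)) := by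
  have hXi : ∀ n, Integrable (X n) μ := fun n =>
    (memLp_two_of_lintegral_lt_top (hX n) ((hXB n).trans_lt hB)).integrable (by norm_num)
  have hUI : UnifIntegrable X 1 μ := by
    refine unifIntegrable_of le_rfl ENNReal.one_ne_top hX fun ε hε => ?_
    set b := B.toReal
    have hb : 0 ≤ b := ENNReal.toReal_nonneg
    have hC : 0 < b / ε + 1 := by positivity
    -- Where `‖X‖ ≥ c`, one has `c ‖X‖ ≤ ‖X‖²`, so the tail is at most `B / c`; the added `1` keeps
    -- the threshold positive when `B = 0`.
    refine ⟨(b / ε + 1).toNNReal, fun n => ?_⟩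
    have hC0 : ((b / ε + 1).toNNReal : ℝ≥0∞) ≠ 0 := by simpa using hC
    rw [eLpNorm_one_eq_lintegral_enorm]
    have hle : ((b / ε + 1).toNNReal : ℝ≥0∞) *
        ∫⁻ ω, ‖Set.indicator {x | (b / ε + 1).toNNReal ≤ ‖X n x‖₊} (X n) ω‖ₑ ∂μ ≤ B := by
      rw [← lintegral_const_mul' _ _ ENNReal.coe_ne_top]
      refine (lintegral_mono fun ω => ?_).trans (hXB n)
      by_cases h : ω ∈ {x | (b / ε + 1).toNNReal ≤ ‖X n x‖₊}
      · rw [Set.indicator_of_mem h, sq]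
        gcongr
        exact ENNReal.coe_le_coe.mpr h
      · rw [Set.indicator_of_notMem h]; simp
    have hBC : B ≤ (b / ε + 1).toNNReal * ENNReal.ofReal ε := by
      rw [← ENNReal.ofReal_toReal hB.ne, ← ENNReal.ofReal_coe_nnreal,
        ← ENNReal.ofReal_mul (by positivity)]
      refine ENNReal.ofReal_le_ofReal ?_
      rw [Real.coe_toNNReal _ hC.le, add_mul, div_mul_cancel₀ _ hε.ne']
      linarith
    exact (ENNReal.mul_le_mul_iff_right hC0 ENNReal.coe_ne_top).mp (hle.trans hBC)
  have := tendsto_Lp_finite_of_tendsto_ae le_rfl ENNReal.one_ne_top hX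
    (memLp_one_iff_integrable.mpr hY) hUI (Filter.Eventually.of_forall hlim)
  exact tendsto_integral_of_L1' Y hY.aestronglyMeasurable (Filter.Eventually.of_forall hXi) this

variable {E : Type*} [NormedAddCommGroup E] [NormedSpace ℝ E] [FiniteDimensional ℝ E]
  [MeasurableSpace E] [BorelSpace E]
  {G : Type*} [NormedAddCommGroup G] [NormedSpace ℝ G] [CompleteSpace G]

/-- An increment is the average of the derivative along the segment, so Jensen and Tonelli transfer
the `L²` bound. It makes difference quotients bounded in `L²` uniformly in the step, which is the
input for Vitali's theorem. -/
lemma lintegral_sq_sub_le {u : E → Ω → G} (hc : ∀ ω, ContDiff ℝ 1 fun x => u x ω)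
    (hm : ∀ x, StronglyMeasurable (u x)) {B : ℝ≥0∞}
    (hB : ∀ y, ∫⁻ ω, ‖fderiv ℝ (fun x => u x ω) y‖ₑ ^ 2 ∂μ ≤ B) (x v : E) :
    ∫⁻ ω, ‖u (x + v) ω - u x ω‖ₑ ^ 2 ∂μ ≤ B * ‖v‖ₑ ^ 2 := by
  have hjm : StronglyMeasurable (Function.uncurry fun (y : E) (ω : Ω) =>
      fderiv ℝ (fun x => u x ω) y) :=
    stronglyMeasurable_uncurry_of_continuous_of_stronglyMeasurable
      (fun ω => (hc ω).continuous_fderiv one_ne_zero)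
      (fun y => stronglyMeasurable_fderiv_param (fun ω => (hc ω).differentiable one_ne_zero) hm y)
  let ν : Measure ℝ := volume.restrict (Set.Ioc 0 1)
  have hν : IsProbabilityMeasure ν := ⟨by simp [ν]⟩
  have hpt : ∀ ω, ‖u (x + v) ω - u x ω‖ₑ ^ 2
      ≤ ∫⁻ s, ‖fderiv ℝ (fun x => u x ω) (x + s • v)‖ₑ ^ 2 * ‖v‖ₑ ^ 2 ∂ν := fun ω => by
    have hcont : Continuous fun s : ℝ => fderiv ℝ (fun x => u x ω) (x + s • v) v :=
      (((hc ω).continuous_fderiv one_ne_zero).comp (by fun_prop)).clm_apply continuous_const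
    have hder : ∀ s ∈ Set.uIcc (0 : ℝ) 1, HasDerivAt (fun s : ℝ => u (x + s • v) ω)
        (fderiv ℝ (fun x => u x ω) (x + s • v) v) s := fun s _ => by
      have h1 : HasDerivAt (fun s : ℝ => x + s • v) v s := by
        simpa using ((hasDerivAt_id s).smul_const v).const_add x
      exact (((hc ω).differentiable one_ne_zero (x + s • v)).hasFDerivAt).comp_hasDerivAt s h1
    have hint := intervalIntegral.integral_eq_sub_of_hasDerivAt hder
      (hcont.intervalIntegrable _ _)
    simp only [one_smul, zero_smul, add_zero] at hint
    rw [← hint, intervalIntegral.integral_of_le zero_le_one]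
    calc ‖∫ s in Set.Ioc (0 : ℝ) 1, fderiv ℝ (fun x => u x ω) (x + s • v) v‖ₑ ^ 2
        ≤ (∫⁻ s, ‖fderiv ℝ (fun x => u x ω) (x + s • v) v‖ₑ ∂ν) ^ 2 :=
          pow_le_pow_left' (enorm_integral_le_lintegral_enorm _) 2
      _ ≤ ∫⁻ s, ‖fderiv ℝ (fun x => u x ω) (x + s • v) v‖ₑ ^ 2 ∂ν :=
          lintegral_enorm_sq_le hcont.aestronglyMeasurable
      _ ≤ _ := by
          refine lintegral_mono fun s => ?_
          rw [← mul_pow]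
          exact pow_le_pow_left' (ContinuousLinearMap.le_opENorm _ _) 2
  have hmeas : Measurable fun p : Ω × ℝ =>
      ‖fderiv ℝ (fun x => u x p.1) (x + p.2 • v)‖ₑ ^ 2 * ‖v‖ₑ ^ 2 := by
    have : Measurable fun p : Ω × ℝ => ((x + p.2 • v, p.1) : E × Ω) := by fun_prop
    exact (((hjm.comp_measurable this).enorm).pow_const 2).mul_const _
  calc _ ≤ ∫⁻ ω, ∫⁻ s, ‖fderiv ℝ (fun x => u x ω) (x + s • v)‖ₑ ^ 2 * ‖v‖ₑ ^ 2 ∂ν ∂μ :=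
        lintegral_mono hpt
    _ = ∫⁻ s, ∫⁻ ω, ‖fderiv ℝ (fun x => u x ω) (x + s • v)‖ₑ ^ 2 * ‖v‖ₑ ^ 2 ∂μ ∂ν :=
        lintegral_lintegral_swap hmeas.aemeasurable
    _ ≤ ∫⁻ s, B * ‖v‖ₑ ^ 2 ∂ν := by
        refine lintegral_mono fun s => ?_
        dsimp only
        rw [lintegral_mul_const' _ _ (by finiteness)]
        gcongr
        exact hB _
    _ = B * ‖v‖ₑ ^ 2 := by simp

/-- If a centred random `C¹` function has a derivative bounded in `L²`, uniformly in the point, then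
its derivative is centred. -/
lemma integral_fderiv_eq_zero {u : E → Ω → G} (hc : ∀ ω, ContDiff ℝ 1 fun x => u x ω)
    (hm : ∀ x, StronglyMeasurable (u x)) (h0 : ∀ x, ∫ ω, u x ω ∂μ = 0)
    (hi : ∀ x, Integrable (u x) μ) {B : ℝ≥0∞} (hBt : B < ∞)
    (hB : ∀ y, ∫⁻ ω, ‖fderiv ℝ (fun x => u x ω) y‖ₑ ^ 2 ∂μ ≤ B) (x : E) :
    Integrable (fun ω => fderiv ℝ (fun y => u y ω) x) μ ∧
      ∫ ω, fderiv ℝ (fun y => u y ω) x ∂μ = 0 := by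
  have hd : ∀ ω, Differentiable ℝ fun x => u x ω := fun ω => (hc ω).differentiable one_ne_zero
  have hint : Integrable (fun ω => fderiv ℝ (fun y => u y ω) x) μ :=
    (memLp_two_of_lintegral_lt_top
      (stronglyMeasurable_fderiv_param hd hm x).aestronglyMeasurable
      ((hB x).trans_lt hBt)).integrable (by norm_num)
  refine ⟨hint, ?_⟩
  ext v
  rw [ContinuousLinearMap.integral_apply hint, zero_apply]
  -- Every difference quotient has mean zero and the family is bounded in `L²`, so the mean of the
  -- limit is zero as well.
  have hlim := tendsto_integral_of_sq_bounded (μ := μ) (B := B * ‖v‖ₑ ^ 2)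
    (X := fun (n : ℕ) ω => ((n : ℝ) + 1) • (u (x + ((n : ℝ) + 1)⁻¹ • v) ω - u x ω))
    (Y := fun ω => fderiv ℝ (fun y => u y ω) x v) (by finiteness)
    (fun n => (((hm _).sub (hm _)).const_smul _).aestronglyMeasurable) (fun n => ?_)
    ((ContinuousLinearMap.apply ℝ G v).integrable_comp hint) (fun ω => ?_)
  · refine tendsto_nhds_unique hlim ?_
    have : ∀ n : ℕ, ∫ ω, ((n : ℝ) + 1) • (u (x + ((n : ℝ) + 1)⁻¹ • v) ω - u x ω) ∂μ = 0 :=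
      fun n => by rw [integral_smul, integral_sub (hi _) (hi _), h0, h0, sub_zero, smul_zero]
    simp [this]
  · have h1 := lintegral_sq_sub_le (μ := μ) hc hm hB x (((n : ℝ) + 1)⁻¹ • v)
    calc _ = ‖(n : ℝ) + 1‖ₑ ^ 2 * ∫⁻ ω, ‖u (x + ((n : ℝ) + 1)⁻¹ • v) ω - u x ω‖ₑ ^ 2 ∂μ := by
          rw [← lintegral_const_mul' _ _ (by finiteness)]
          refine lintegral_congr fun ω => ?_
          rw [enorm_smul, mul_pow]
      _ ≤ ‖(n : ℝ) + 1‖ₑ ^ 2 * (B * ‖((n : ℝ) + 1)⁻¹ • v‖ₑ ^ 2) := by gcongr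
      _ = B * ‖v‖ₑ ^ 2 := by
          rw [enorm_smul, mul_pow, mul_left_comm, ← mul_assoc (‖(n : ℝ) + 1‖ₑ ^ 2), ← mul_pow,
            ← enorm_mul, mul_inv_cancel₀ (by positivity)]
          simp
  · refine (hd ω x).hasFDerivAt.lim v (c := fun n : ℕ => (n : ℝ) + 1) (l := Filter.atTop) ?_
    exact (Filter.tendsto_atTop_add_const_right _ _ tendsto_natCast_atTop_atTop).congr
      fun n => (Real.norm_of_nonneg (by positivity)).symm

/-- Unbiasedness of the derivative estimator. -/
lemma integral_fderiv_eq {u : E → Ω → G} {w : E → G} (hc : ∀ ω, ContDiff ℝ 1 fun x => u x ω)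
    (hw : ContDiff ℝ 1 w) (hm : ∀ x, StronglyMeasurable (u x)) (h0 : ∀ x, ∫ ω, u x ω ∂μ = w x)
    (hi : ∀ x, Integrable (u x) μ) {B : ℝ≥0∞} (hBt : B < ∞)
    (hB : ∀ y, ∫⁻ ω, ‖fderiv ℝ (fun x => u x ω) y - fderiv ℝ w y‖ₑ ^ 2 ∂μ ≤ B) (x : E) :
    Integrable (fun ω => fderiv ℝ (fun y => u y ω) x) μ ∧
      ∫ ω, fderiv ℝ (fun y => u y ω) x ∂μ = fderiv ℝ w x := by
  have hd : ∀ ω, Differentiable ℝ fun x => u x ω := fun ω => (hc ω).differentiable one_ne_zero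
  have hwd : Differentiable ℝ w := hw.differentiable one_ne_zero
  have heq : ∀ ω y, fderiv ℝ (fun x => u x ω - w x) y
      = fderiv ℝ (fun x => u x ω) y - fderiv ℝ w y := fun ω y => fderiv_fun_sub (hd ω y) (hwd y)
  -- Subtracting the mean function gives a centred field whose derivative is exactly the noise
  -- controlled by the variance bound.
  have key := integral_fderiv_eq_zero (μ := μ) (u := fun x ω => u x ω - w x)
    (fun ω => (hc ω).sub hw) (fun x => (hm x).sub stronglyMeasurable_const)
    (fun x => by rw [integral_sub (hi x) (integrable_const _), h0]; simp)
    (fun x => (hi x).sub (integrable_const _)) hBt (by simpa only [heq] using hB) x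
  simp only [heq] at key
  obtain ⟨h1, h2⟩ := key
  have hint : Integrable (fun ω => fderiv ℝ (fun y => u y ω) x) μ := by
    refine (h1.add (integrable_const (fderiv ℝ w x))).congr
      (Filter.Eventually.of_forall fun ω => ?_)
    simp
  refine ⟨hint, ?_⟩
  rw [integral_sub hint (integrable_const _)] at h2
  simpa [sub_eq_zero] using h2

end integration

/-! ### Expectations over independent variables -/

section independence

variable {Ω : Type*} {m₁ m₂ : MeasurableSpace Ω} [mΩ : MeasurableSpace Ω] {μ : Measure Ω}

lemma indepFun_of_measurable {α β : Type*} [MeasurableSpace α] [MeasurableSpace β]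
    (h : Indep m₁ m₂ μ) {X : Ω → α} {Y : Ω → β} (hX : Measurable[m₁] X) (hY : Measurable[m₂] Y) :
    IndepFun X Y μ :=
  (IndepFun_iff_Indep X Y μ).mpr
    (indep_of_indep_of_le_left (indep_of_indep_of_le_right h hY.comap_le) hX.comap_le)

/-- A general bilinear pairing serves operator products, operators applied to vectors, and scalars
times vectors alike. -/
lemma integral_bilin_of_indep {E F G : Type*}
    [NormedAddCommGroup E] [NormedSpace ℝ E] [CompleteSpace E] [MeasurableSpace E] [BorelSpace E]
    [NormedAddCommGroup F] [NormedSpace ℝ F] [CompleteSpace F] [MeasurableSpace F] [BorelSpace F]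
    [NormedAddCommGroup G] [NormedSpace ℝ G] [CompleteSpace G]
    (h : Indep m₁ m₂ μ) {X : Ω → E} {Y : Ω → F} (hX : Measurable[m₁] X) (hY : Measurable[m₂] Y)
    (hXi : Integrable X μ) (hYi : Integrable Y μ) (B : E →L[ℝ] F →L[ℝ] G) :
    Integrable (fun ω => B (X ω) (Y ω)) μ ∧
      ∫ ω, B (X ω) (Y ω) ∂μ = B (∫ ω, X ω ∂μ) (∫ ω, Y ω ∂μ) :=
  ⟨(indepFun_of_measurable h hX hY).integrable_bilin hXi hYi B,
    (indepFun_of_measurable h hX hY).integral_bilin hXi hYi B⟩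

variable [IsProbabilityMeasure μ]

/-- Freezing lemma: an expectation over two independent variables is an iterated expectation. -/
lemma integral_freeze {α β E : Type*} [MeasurableSpace α] [MeasurableSpace β]
    [NormedAddCommGroup E] [NormedSpace ℝ E] (h : Indep m₁ m₂ μ) (h₁ : m₁ ≤ mΩ) (h₂ : m₂ ≤ mΩ)
    {X : Ω → α} {Y : Ω → β} (hX : Measurable[m₁] X) (hY : Measurable[m₂] Y)
    {F : α → β → E} (hF : StronglyMeasurable (Function.uncurry F))
    (hint : Integrable (fun ω => F (X ω) (Y ω)) μ) :
    ∫ ω, F (X ω) (Y ω) ∂μ = ∫ ω', ∫ ω, F (X ω') (Y ω) ∂μ ∂μ := by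
  have hX' : Measurable X := hX.mono h₁ le_rfl
  have hY' : Measurable Y := hY.mono h₂ le_rfl
  have hmap := (indepFun_iff_map_prod_eq_prod_map_map hX'.aemeasurable hY'.aemeasurable).mp
    (indepFun_of_measurable h hX hY)
  have hXp : IsProbabilityMeasure (μ.map X) := Measure.isProbabilityMeasure_map hX'.aemeasurable
  have hYp : IsProbabilityMeasure (μ.map Y) := Measure.isProbabilityMeasure_map hY'.aemeasurable
  have hint' : Integrable (Function.uncurry F) ((μ.map X).prod (μ.map Y)) := by
    rw [← hmap]
    exact (integrable_map_measure hF.aestronglyMeasurable (hX'.prodMk hY').aemeasurable).mpr hint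
  calc ∫ ω, F (X ω) (Y ω) ∂μ = ∫ p, Function.uncurry F p ∂(μ.map fun ω => (X ω, Y ω)) :=
        (integral_map (hX'.prodMk hY').aemeasurable hF.aestronglyMeasurable).symm
    _ = ∫ x, ∫ y, F x y ∂(μ.map Y) ∂(μ.map X) := by
        rw [hmap, integral_prod _ hint']; rfl
    _ = ∫ ω', ∫ y, F (X ω') y ∂(μ.map Y) ∂μ :=
        integral_map hX'.aemeasurable hF.integral_prod_right.aestronglyMeasurable
    _ = _ := by
        refine integral_congr_ae (Filter.Eventually.of_forall fun ω' => ?_)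
        exact integral_map hY'.aemeasurable
          (hF.comp_measurable measurable_prodMk_left).aestronglyMeasurable

lemma lintegral_freeze {α β : Type*} [MeasurableSpace α] [MeasurableSpace β]
    (h : Indep m₁ m₂ μ) (h₁ : m₁ ≤ mΩ) (h₂ : m₂ ≤ mΩ)
    {X : Ω → α} {Y : Ω → β} (hX : Measurable[m₁] X) (hY : Measurable[m₂] Y)
    {F : α → β → ℝ≥0∞} (hF : Measurable (Function.uncurry F)) :
    ∫⁻ ω, F (X ω) (Y ω) ∂μ = ∫⁻ ω', ∫⁻ ω, F (X ω') (Y ω) ∂μ ∂μ := by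
  have hX' : Measurable X := hX.mono h₁ le_rfl
  have hY' : Measurable Y := hY.mono h₂ le_rfl
  have hmap := (indepFun_iff_map_prod_eq_prod_map_map hX'.aemeasurable hY'.aemeasurable).mp
    (indepFun_of_measurable h hX hY)
  have hYp : IsProbabilityMeasure (μ.map Y) := Measure.isProbabilityMeasure_map hY'.aemeasurable
  calc ∫⁻ ω, F (X ω) (Y ω) ∂μ = ∫⁻ p, Function.uncurry F p ∂(μ.map fun ω => (X ω, Y ω)) :=
        (lintegral_map hF (hX'.prodMk hY')).symm
    _ = ∫⁻ x, ∫⁻ y, F x y ∂(μ.map Y) ∂(μ.map X) := by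
        rw [hmap, lintegral_prod _ hF.aemeasurable]; rfl
    _ = ∫⁻ ω', ∫⁻ y, F (X ω') y ∂(μ.map Y) ∂μ := lintegral_map hF.lintegral_prod_right' hX'
    _ = _ := lintegral_congr fun ω' => lintegral_map (hF.comp measurable_prodMk_left) hY'

end independence

end Bilevel

namespace Bilevel

/-! ### Geometry of the joint space -/

section joint

variable {d q : ℕ}

lemma inner_joint (x y : Joint d q) :
    inner ℝ x y = inner ℝ x.fst y.fst + inner ℝ x.snd y.snd := WithLp.prod_inner_apply x y

lemma norm_sq_joint (x : Joint d q) : ‖x‖ ^ 2 = ‖x.fst‖ ^ 2 + ‖x.snd‖ ^ 2 :=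
  WithLp.prod_norm_sq_eq_of_L2 x

lemma norm_fst_le (x : Joint d q) : ‖x.fst‖ ≤ ‖x‖ :=
  le_of_sq_le_sq (by rw [norm_sq_joint x]; nlinarith [sq_nonneg ‖x.snd‖]) (norm_nonneg _)

lemma norm_snd_le (x : Joint d q) : ‖x.snd‖ ≤ ‖x‖ :=
  le_of_sq_le_sq (by rw [norm_sq_joint x]; nlinarith [sq_nonneg ‖x.fst‖]) (norm_nonneg _)

lemma norm_joint_le (x : Joint d q) : ‖x‖ ≤ ‖x.fst‖ + ‖x.snd‖ :=
  le_of_sq_le_sq (by rw [norm_sq_joint x]; nlinarith [norm_nonneg x.fst, norm_nonneg x.snd])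
    (by positivity)

@[simp] lemma inrL_fst (v : EuclideanSpace ℝ (Fin q)) : (inrL d q v).fst = 0 := rfl

@[simp] lemma inrL_snd (v : EuclideanSpace ℝ (Fin q)) : (inrL d q v).snd = v := rfl

lemma norm_inrL (v : EuclideanSpace ℝ (Fin q)) : ‖inrL d q v‖ = ‖v‖ := by
  have h := norm_sq_joint (inrL d q v)
  simp only [inrL_fst, inrL_snd, norm_zero] at h
  exact (sq_eq_sq₀ (norm_nonneg _) (norm_nonneg _)).mp (by linarith)

lemma inner_inrL (x : Joint d q) (v : EuclideanSpace ℝ (Fin q)) :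
    inner ℝ x (inrL d q v) = inner ℝ x.snd v := by
  rw [inner_joint]; simp

lemma norm_pt_sub_le (θ θ' : EuclideanSpace ℝ (Fin d)) (φ φ' : EuclideanSpace ℝ (Fin q)) :
    ‖pt θ φ - pt θ' φ'‖ ≤ ‖θ - θ'‖ + ‖φ - φ'‖ := norm_joint_le _

lemma pt_add_inrL (θ : EuclideanSpace ℝ (Fin d)) (φ v : EuclideanSpace ℝ (Fin q)) :
    pt θ φ + inrL d q v = pt θ (φ + v) := by
  simp [pt, inrL, ← WithLp.toLp_add]

lemma continuous_pt : Continuous fun p : EuclideanSpace ℝ (Fin d) × EuclideanSpace ℝ (Fin q) =>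
    pt p.1 p.2 := by unfold pt; fun_prop

end joint

/-! ### Gradients and symmetry of the Hessian -/

section gradients

variable {E : Type*} [NormedAddCommGroup E] [InnerProductSpace ℝ E] [CompleteSpace E] {u : E → ℝ}

lemma inner_gradient (x v : E) : inner ℝ (gradient u x) v = fderiv ℝ u x v := by
  simp [gradient]

lemma norm_gradient_sub (w : E → ℝ) (x y : E) :
    ‖gradient u x - gradient w y‖ = ‖fderiv ℝ u x - fderiv ℝ w y‖ := by
  rw [gradient, gradient, ← map_sub, LinearIsometryEquiv.norm_map]

lemma contDiff_gradient {n m : WithTop ℕ∞} (hu : ContDiff ℝ n u) (hm : m + 1 ≤ n) :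
    ContDiff ℝ m (gradient u) :=
  (InnerProductSpace.toDual ℝ E).symm.toContinuousLinearEquiv.contDiff.comp (hu.fderiv_right hm)

lemma norm_gradient_le {L : ℝ≥0} (hL : LipschitzWith L u) (x : E) : ‖gradient u x‖ ≤ L := by
  rw [gradient, LinearIsometryEquiv.norm_map]
  exact norm_fderiv_le_of_lipschitz ℝ hL

/-- The Riesz isometry identifies the derivative of the gradient with the second derivative, whose
symmetry holds for `C²` functions. -/
lemma fderiv_gradient_symm (hu : ContDiff ℝ 2 u) (x v w : E) :
    inner ℝ (fderiv ℝ (gradient u) x v) w = inner ℝ v (fderiv ℝ (gradient u) x w) := by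
  have hd : DifferentiableAt ℝ (fderiv ℝ u) x :=
    ((hu.fderiv_right (m := 1) (by norm_num)).differentiable one_ne_zero) x
  have hg : DifferentiableAt ℝ (gradient u) x :=
    ((contDiff_gradient hu (m := 1) (by norm_num)).differentiable one_ne_zero) x
  have h : ∀ a b, inner ℝ (fderiv ℝ (gradient u) x a) b = fderiv ℝ (fderiv ℝ u) x a b := by
    intro a b
    have h1 : HasFDerivAt (fun y => inner ℝ b (gradient u y))
        ((innerSL ℝ b).comp (fderiv ℝ (gradient u) x)) x :=
      (innerSL ℝ b).hasFDerivAt.comp x hg.hasFDerivAt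
    have h2 : HasFDerivAt (fun y => fderiv ℝ u y b)
        ((ContinuousLinearMap.apply ℝ ℝ b).comp (fderiv ℝ (fderiv ℝ u) x)) x :=
      (ContinuousLinearMap.apply ℝ ℝ b).hasFDerivAt.comp x hd.hasFDerivAt
    have h3 : (fun y => inner ℝ b (gradient u y)) = fun y => fderiv ℝ u y b := by
      funext y
      rw [real_inner_comm, inner_gradient]
    rw [h3] at h1
    rw [real_inner_comm]
    exact congrArg (fun A => A a) (h1.unique h2)
  rw [h, real_inner_comm, h]
  exact (hu.contDiffAt.isSymmSndFDerivAt (by simp)) v w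

end gradients

/-- A symmetric operator is bounded by any bound for its quadratic form. -/
lemma norm_le_of_symm_of_form_le {E : Type*} [NormedAddCommGroup E] [InnerProductSpace ℝ E]
    {S : E →L[ℝ] E} (hS : ∀ v w, inner ℝ (S v) w = inner ℝ v (S w)) {c : ℝ} (hc : 0 ≤ c)
    (hb : ∀ v, |inner ℝ (S v) v| ≤ c * ‖v‖ ^ 2) : ‖S‖ ≤ c := by
  refine S.opNorm_le_bound hc fun v => ?_
  -- Polarization: the bounds on the form at `v + w` and `v - w` combine through the parallelogram
  -- law.
  have hpol : ∀ w, 4 * inner ℝ (S v) w ≤ 2 * c * (‖v‖ ^ 2 + ‖w‖ ^ 2) := fun w => by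
    have h1 := (abs_le.mp (hb (v + w))).2
    have h2 := (abs_le.mp (hb (v - w))).1
    have h3 := parallelogram_law_with_norm ℝ v w
    have h4 : inner ℝ (S (v + w)) (v + w) - inner ℝ (S (v - w)) (v - w)
        = 4 * inner ℝ (S v) w := by
      simp only [map_add, map_sub, inner_add_left, inner_add_right, inner_sub_left, inner_sub_right]
      rw [hS w v, real_inner_comm (S v) w]
      ring
    nlinarith
  rcases eq_or_ne (S v) 0 with h0 | h0
  · rw [h0, norm_zero]; positivity
  · have hn : 0 < ‖S v‖ := norm_pos_iff.mpr h0
    have hv : 0 < ‖v‖ := norm_pos_iff.mpr fun h => h0 (by rw [h, map_zero])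
    -- The test vector is parallel to `S v` and rescaled to the length of `v`, which makes the
    -- polarized inequality sharp.
    have h := hpol ((‖v‖ / ‖S v‖) • S v)
    rw [real_inner_smul_right, real_inner_self_eq_norm_sq, norm_smul, norm_div, norm_norm,
      norm_norm, div_mul_cancel₀ _ hn.ne'] at h
    have h' : ‖v‖ / ‖S v‖ * ‖S v‖ ^ 2 = ‖v‖ * ‖S v‖ := by field_simp
    rw [h'] at h
    have : ‖v‖ * ‖S v‖ ≤ ‖v‖ * (c * ‖v‖) := by nlinarith
    exact le_of_mul_le_mul_left this hv

/-! ### Strong convexity and the truncated Neumann series -/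

section generic

variable {E : Type*} [NormedAddCommGroup E] [InnerProductSpace ℝ E]

/-- First-order characterization of strong convexity. -/
lemma _root_.StrongConvexOn.le_of_hasGradientAt [CompleteSpace E] {u : E → ℝ} {m : ℝ}
    (hu : StrongConvexOn Set.univ m u) {a G : E} (hG : HasGradientAt u G a) (b : E) :
    u a + inner ℝ G (b - a) + m / 2 * ‖b - a‖ ^ 2 ≤ u b := by
  -- On the line from `a` to `b` the function minus its quadratic part is convex, so its slope over
  -- `[0, 1]` is at least its derivative at `0`.
  have hl := (strongConvexOn_iff_convex.mp hu).comp_affineMap (AffineMap.lineMap a b : ℝ →ᵃ[ℝ] E)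
  simp only [Set.preimage_univ] at hl
  have hline : ∀ t : ℝ, (AffineMap.lineMap a b : ℝ →ᵃ[ℝ] E) t = a + t • (b - a) := fun t => by
    simp [AffineMap.lineMap_apply, add_comm]
  have hd1 : HasDerivAt (fun t : ℝ => a + t • (b - a)) (b - a) 0 := by
    simpa using ((hasDerivAt_id (0 : ℝ)).smul_const (b - a)).const_add a
  have hd3 : HasDerivAt (fun t : ℝ => u (a + t • (b - a))) (inner ℝ G (b - a)) 0 := by
    have hG' : HasFDerivAt u (InnerProductSpace.toDual ℝ E G) (a + (0 : ℝ) • (b - a)) := by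
      simpa using hG.hasFDerivAt
    simpa [Function.comp_def] using hG'.comp_hasDerivAt (0 : ℝ) hd1
  have hd4 : HasDerivAt ((fun φ => u φ - m / 2 * ‖φ‖ ^ 2) ∘ (AffineMap.lineMap a b : ℝ →ᵃ[ℝ] E))
      (inner ℝ G (b - a) - m / 2 * (2 * inner ℝ a (b - a))) 0 := by
    have h5 := hd3.sub ((hd1.norm_sq).const_mul (m / 2))
    simp only [zero_smul, add_zero] at h5
    refine h5.congr_of_eventuallyEq (Filter.Eventually.of_forall fun t => ?_)
    simp [hline]
  have hs := hl.le_slope_of_hasDerivAt (Set.mem_univ 0) (Set.mem_univ 1) zero_lt_one hd4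
  rw [slope_def_field] at hs
  simp only [Function.comp_apply, AffineMap.lineMap_apply_zero, AffineMap.lineMap_apply_one,
    sub_zero, div_one] at hs
  have h6 : ‖b‖ ^ 2 = ‖a‖ ^ 2 + 2 * inner ℝ a (b - a) + ‖b - a‖ ^ 2 := by
    rw [← norm_add_sq_real, add_sub_cancel]
  rw [h6] at hs
  linarith

/-- The derivative of a strongly monotone map is coercive. -/
lemma le_inner_fderiv_of_strongly_monotone {A : E → E} {A' : E →L[ℝ] E} {m : ℝ} {x : E}
    (hA : HasFDerivAt A A' x) (hm : ∀ y, m * ‖y - x‖ ^ 2 ≤ inner ℝ (A y - A x) (y - x)) (v : E) :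
    m * ‖v‖ ^ 2 ≤ inner ℝ (A' v) v := by
  have hlim := Filter.Tendsto.inner (𝕜 := ℝ)
    (hA.lim v (c := fun n : ℕ => (n : ℝ) + 1) (l := Filter.atTop)
      ((Filter.tendsto_atTop_add_const_right _ _ tendsto_natCast_atTop_atTop).congr
        fun n => (Real.norm_of_nonneg (by positivity)).symm)) (tendsto_const_nhds (x := v))
  refine ge_of_tendsto hlim (Filter.Eventually.of_forall fun n => ?_)
  have hn : (0 : ℝ) < (n : ℝ) + 1 := by positivity
  have h1 := mul_le_mul_of_nonneg_left (hm (x + ((n : ℝ) + 1)⁻¹ • v)) (sq_nonneg ((n : ℝ) + 1))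
  rw [add_sub_cancel_left, norm_smul, inner_smul_right, Real.norm_of_nonneg (by positivity),
    mul_pow] at h1
  rw [inner_smul_left, conj_trivial]
  calc m * ‖v‖ ^ 2 = ((n : ℝ) + 1) ^ 2 * (m * ((((n : ℝ) + 1)⁻¹) ^ 2 * ‖v‖ ^ 2)) := by field_simp
    _ ≤ _ := h1
    _ = _ := by field_simp

lemma norm_pow_apply_le {S : E →L[ℝ] E} {c : ℝ} (hS : ‖S‖ ≤ c) (n : ℕ) (v : E) :
    ‖(S ^ n) v‖ ≤ c ^ n * ‖v‖ := by
  have hc : 0 ≤ c := (norm_nonneg _).trans hS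
  induction n with
  | zero => simp
  | succ n ih =>
    rw [pow_succ', mul_apply_eq_comp, pow_succ', mul_assoc]
    exact (S.le_of_opNorm_le hS _).trans (mul_le_mul_of_nonneg_left ih hc)

/-- With `C = ℓ (1 - S)` the geometric sum telescopes to `1 - S ^ N`. The remainder is exact and
needs no smallness of `S`; the norm of `S` matters only when the remainder is estimated. -/
lemma inverse_sub_neumann {C : E →L[ℝ] E} (hC : IsUnit C) {ℓ : ℝ} (hℓ : ℓ ≠ 0) (N : ℕ) :
    Ring.inverse C - (1 / ℓ) • ∑ j ∈ Finset.range N, (1 - (1 / ℓ) • C) ^ j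
      = Ring.inverse C * (1 - (1 / ℓ) • C) ^ N := by
  set S := 1 - (1 / ℓ) • C with hS
  have hCS : C = ℓ • (1 - S) := by
    rw [hS, sub_sub_cancel, smul_smul, mul_one_div_cancel hℓ, one_smul]
  have hgeo : C * ((1 / ℓ) • ∑ j ∈ Finset.range N, S ^ j) = 1 - S ^ N := by
    rw [hCS, smul_mul_smul_comm, mul_one_div_cancel hℓ, one_smul, mul_neg_geom_sum]
  calc _ = Ring.inverse C - Ring.inverse C * (C * ((1 / ℓ) • ∑ j ∈ Finset.range N, S ^ j)) := by
        rw [← mul_assoc, Ring.inverse_mul_cancel _ hC, one_mul]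
    _ = _ := by rw [hgeo, mul_sub, mul_one, sub_sub_cancel]

end generic

/-! ### The lower-level solution map and the hypergradient -/

/-- The assumptions on the problem, collected. -/
structure Standing {d q : ℕ} {Ξ Z : Type*} [MeasurableSpace Ξ] [MeasurableSpace Z]
    (P : Problem d q Ξ Z) (μ : ℝ) (ℓf0 ℓf1 ℓg1 ℓg2 σf σg1 σg2 : ℝ≥0) : Prop where
  reg : P.Regular
  conv : P.StronglyConvexLower μ
  lip : P.LipschitzReg ℓf0 ℓf1 ℓg1 ℓg2
  var : P.BoundedVariance σf σg1 σg2

/-- The operator `∇²_{θφ} g (∇²_φ g)⁻¹`. -/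
noncomputable def coupling {d q : ℕ} {Ξ Z : Type*} [MeasurableSpace Ξ] [MeasurableSpace Z]
    (P : Problem d q Ξ Z) (x : Joint d q) :
    EuclideanSpace ℝ (Fin q) →L[ℝ] EuclideanSpace ℝ (Fin d) :=
  (hessThetaPhi P.meanG x).comp (Ring.inverse (hessPhi P.meanG x))

/-- The gradient surrogate `∇_θ f - ∇²_{θφ} g (∇²_φ g)⁻¹ ∇_φ f`. -/
noncomputable def surrogate {d q : ℕ} {Ξ Z : Type*} [MeasurableSpace Ξ] [MeasurableSpace Z]
    (P : Problem d q Ξ Z) (x : Joint d q) : EuclideanSpace ℝ (Fin d) :=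
  gradTheta P.meanF x - coupling P x (gradPhi P.meanF x)

/-- The gradient surrogate with the truncated Neumann series of length `N`. -/
noncomputable def truncSurrogate {d q : ℕ} {Ξ Z : Type*} [MeasurableSpace Ξ] [MeasurableSpace Z]
    (P : Problem d q Ξ Z) (ℓ : ℝ) (N : ℕ) (x : Joint d q) : EuclideanSpace ℝ (Fin d) :=
  gradTheta P.meanF x - hessThetaPhi P.meanG x
    (((1 / ℓ) • ∑ j ∈ Finset.range N, (1 - (1 / ℓ) • hessPhi P.meanG x) ^ j)
      (gradPhi P.meanF x))

namespace Standing

variable {d q : ℕ} {Ξ Z : Type*} [MeasurableSpace Ξ] [MeasurableSpace Z]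
  {P : Problem d q Ξ Z} {μ : ℝ} {ℓf0 ℓf1 ℓg1 ℓg2 σf σg1 σg2 : ℝ≥0}

lemma mu_pos (h : Standing P μ ℓf0 ℓf1 ℓg1 ℓg2 σf σg1 σg2) : 0 < μ := h.conv.1

lemma differentiable_g (h : Standing P μ ℓf0 ℓf1 ℓg1 ℓg2 σf σg1 σg2) :
    Differentiable ℝ P.meanG := h.reg.contDiff_meanG.differentiable two_ne_zero

lemma contDiff_gradient_g (h : Standing P μ ℓf0 ℓf1 ℓg1 ℓg2 σf σg1 σg2) :
    ContDiff ℝ 1 (gradient P.meanG) :=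
  contDiff_gradient h.reg.contDiff_meanG (by norm_num)

lemma hasFDerivAt_gradient_g (h : Standing P μ ℓf0 ℓf1 ℓg1 ℓg2 σf σg1 σg2) (x : Joint d q) :
    HasFDerivAt (gradient P.meanG) (hess P.meanG x) x :=
  (h.contDiff_gradient_g.differentiable one_ne_zero x).hasFDerivAt

lemma norm_gradPhi_g_sub_le (h : Standing P μ ℓf0 ℓf1 ℓg1 ℓg2 σf σg1 σg2) (x y : Joint d q) :
    ‖gradPhi P.meanG x - gradPhi P.meanG y‖ ≤ ℓg1 * ‖x - y‖ :=
  (norm_snd_le (gradient P.meanG x - gradient P.meanG y)).trans (h.lip.grad_g.norm_sub_le x y)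

lemma norm_gradTheta_f_sub_le (h : Standing P μ ℓf0 ℓf1 ℓg1 ℓg2 σf σg1 σg2) (x y : Joint d q) :
    ‖gradTheta P.meanF x - gradTheta P.meanF y‖ ≤ ℓf1 * ‖x - y‖ :=
  (norm_fst_le (gradient P.meanF x - gradient P.meanF y)).trans (h.lip.grad_f.norm_sub_le x y)

lemma norm_gradPhi_f_sub_le (h : Standing P μ ℓf0 ℓf1 ℓg1 ℓg2 σf σg1 σg2) (x y : Joint d q) :
    ‖gradPhi P.meanF x - gradPhi P.meanF y‖ ≤ ℓf1 * ‖x - y‖ :=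
  (norm_snd_le (gradient P.meanF x - gradient P.meanF y)).trans (h.lip.grad_f.norm_sub_le x y)

lemma norm_gradTheta_f_le (h : Standing P μ ℓf0 ℓf1 ℓg1 ℓg2 σf σg1 σg2) (x : Joint d q) :
    ‖gradTheta P.meanF x‖ ≤ ℓf0 := (norm_fst_le _).trans (norm_gradient_le h.lip.f x)

lemma norm_gradPhi_f_le (h : Standing P μ ℓf0 ℓf1 ℓg1 ℓg2 σf σg1 σg2) (x : Joint d q) :
    ‖gradPhi P.meanF x‖ ≤ ℓf0 := (norm_snd_le _).trans (norm_gradient_le h.lip.f x)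

lemma norm_hess_le (h : Standing P μ ℓf0 ℓf1 ℓg1 ℓg2 σf σg1 σg2) (x : Joint d q) :
    ‖hess P.meanG x‖ ≤ ℓg1 := norm_fderiv_le_of_lipschitz ℝ h.lip.grad_g

lemma hasFDerivAt_pt (θ : EuclideanSpace ℝ (Fin d)) (φ : EuclideanSpace ℝ (Fin q)) :
    HasFDerivAt (fun v => pt θ v) (inrL d q) φ := by
  have h1 := ((inrL d q).hasFDerivAt (x := φ)).const_add (pt θ 0)
  have h2 : (fun v => pt θ 0 + inrL d q v) = fun v => pt θ v := by
    funext v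
    rw [pt_add_inrL, zero_add]
  rwa [h2] at h1

lemma hasGradientAt_lower (h : Standing P μ ℓf0 ℓf1 ℓg1 ℓg2 σf σg1 σg2)
    (θ : EuclideanSpace ℝ (Fin d)) (φ : EuclideanSpace ℝ (Fin q)) :
    HasGradientAt (fun v => P.meanG (pt θ v)) (gradPhi P.meanG (pt θ φ)) φ := by
  have h1 : HasFDerivAt (fun v => P.meanG (pt θ v))
      ((fderiv ℝ P.meanG (pt θ φ)).comp (inrL d q)) φ :=
    (h.differentiable_g (pt θ φ)).hasFDerivAt.comp φ (hasFDerivAt_pt θ φ)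
  refine h1.congr_fderiv ?_
  ext v
  rw [ContinuousLinearMap.comp_apply, ← inner_gradient, inner_inrL]
  rfl

lemma hasFDerivAt_gradPhi (h : Standing P μ ℓf0 ℓf1 ℓg1 ℓg2 σf σg1 σg2)
    (θ : EuclideanSpace ℝ (Fin d)) (φ : EuclideanSpace ℝ (Fin q)) :
    HasFDerivAt (fun v => gradPhi P.meanG (pt θ v)) (hessPhi P.meanG (pt θ φ)) φ :=
  (WithLp.sndL 2 ℝ (EuclideanSpace ℝ (Fin d)) (EuclideanSpace ℝ (Fin q))).hasFDerivAt.comp φ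
    ((h.hasFDerivAt_gradient_g (pt θ φ)).comp φ (hasFDerivAt_pt θ φ))

lemma strongly_convex_le (h : Standing P μ ℓf0 ℓf1 ℓg1 ℓg2 σf σg1 σg2)
    (θ : EuclideanSpace ℝ (Fin d)) (a b : EuclideanSpace ℝ (Fin q)) :
    P.meanG (pt θ a) + inner ℝ (gradPhi P.meanG (pt θ a)) (b - a) + μ / 2 * ‖b - a‖ ^ 2
      ≤ P.meanG (pt θ b) :=
  (h.conv.2 θ).le_of_hasGradientAt (h.hasGradientAt_lower θ a) b

lemma strongly_monotone (h : Standing P μ ℓf0 ℓf1 ℓg1 ℓg2 σf σg1 σg2)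
    (θ : EuclideanSpace ℝ (Fin d)) (a b : EuclideanSpace ℝ (Fin q)) :
    μ * ‖b - a‖ ^ 2
      ≤ inner ℝ (gradPhi P.meanG (pt θ b) - gradPhi P.meanG (pt θ a)) (b - a) := by
  have h1 := h.strongly_convex_le θ a b
  have h2 := h.strongly_convex_le θ b a
  rw [← neg_sub b a, inner_neg_right, norm_neg] at h2
  rw [inner_sub_left]
  linarith

/-- Strong convexity at the base point `0` gives quadratic growth, so the continuous function `g(θ,
·)` tends to infinity and attains its minimum in finite dimension. -/
lemma exists_lowerSol (h : Standing P μ ℓf0 ℓf1 ℓg1 ℓg2 σf σg1 σg2)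
    (θ : EuclideanSpace ℝ (Fin d)) : ∃ φ, P.IsLowerSol θ φ := by
  have hcont : Continuous fun φ => P.meanG (pt θ φ) :=
    continuous_iff_continuousAt.mpr fun φ =>
      (h.hasGradientAt_lower θ φ).hasFDerivAt.continuousAt
  refine hcont.exists_forall_le ?_
  set G := gradPhi P.meanG (pt θ 0)
  have hlow : ∀ φ, P.meanG (pt θ 0) + ‖φ‖ * (μ / 2 * ‖φ‖ - ‖G‖) ≤ P.meanG (pt θ φ) := fun φ => by
    have h1 := h.strongly_convex_le θ 0 φ
    rw [sub_zero] at h1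
    have h2 := neg_le_of_abs_le (abs_real_inner_le_norm G φ)
    nlinarith
  refine Filter.tendsto_atTop_mono hlow ?_
  refine Filter.tendsto_atTop_add_const_left _ _ ?_
  have hn := tendsto_norm_cocompact_atTop (E := EuclideanSpace ℝ (Fin q))
  exact hn.atTop_mul_atTop₀ (Filter.tendsto_atTop_add_const_right _ _
    (hn.const_mul_atTop (half_pos h.mu_pos)))

lemma isLowerSol_lowerSol (h : Standing P μ ℓf0 ℓf1 ℓg1 ℓg2 σf σg1 σg2)
    (θ : EuclideanSpace ℝ (Fin d)) : P.IsLowerSol θ (P.lowerSol θ) :=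
  Classical.epsilon_spec (h.exists_lowerSol θ)

lemma gradPhi_lowerSol (h : Standing P μ ℓf0 ℓf1 ℓg1 ℓg2 σf σg1 σg2)
    (θ : EuclideanSpace ℝ (Fin d)) : gradPhi P.meanG (pt θ (P.lowerSol θ)) = 0 := by
  have hmin : IsLocalMin (fun v => P.meanG (pt θ v)) (P.lowerSol θ) :=
    Filter.Eventually.of_forall fun v => h.isLowerSol_lowerSol θ v
  have h0 := hmin.hasFDerivAt_eq_zero (h.hasGradientAt_lower θ _).hasFDerivAt
  simpa using h0

lemma hessPhi_symm (h : Standing P μ ℓf0 ℓf1 ℓg1 ℓg2 σf σg1 σg2) (x : Joint d q)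
    (v w : EuclideanSpace ℝ (Fin q)) :
    inner ℝ (hessPhi P.meanG x v) w = inner ℝ v (hessPhi P.meanG x w) := by
  have h1 := fderiv_gradient_symm h.reg.contDiff_meanG x (inrL d q v) (inrL d q w)
  rw [inner_inrL, real_inner_comm _ (inrL d q v), inner_inrL, real_inner_comm v] at h1
  exact h1

/-- The `φ`-block of the Hessian applied to a joint vector, by symmetry. -/
lemma inner_snd_hess (h : Standing P μ ℓf0 ℓf1 ℓg1 ℓg2 σf σg1 σg2) (x v : Joint d q)
    (w : EuclideanSpace ℝ (Fin q)) :
    inner ℝ (hess P.meanG x v).snd w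
      = inner ℝ v.fst (hessThetaPhi P.meanG x w) + inner ℝ v.snd (hessPhi P.meanG x w) := by
  have := fderiv_gradient_symm h.reg.contDiff_meanG x v (inrL d q w)
  rw [inner_inrL, inner_joint] at this
  exact this

lemma le_inner_hessPhi (h : Standing P μ ℓf0 ℓf1 ℓg1 ℓg2 σf σg1 σg2) (x : Joint d q)
    (v : EuclideanSpace ℝ (Fin q)) : μ * ‖v‖ ^ 2 ≤ inner ℝ (hessPhi P.meanG x v) v := by
  exact le_inner_fderiv_of_strongly_monotone (h.hasFDerivAt_gradPhi x.fst x.snd)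
    (fun y => h.strongly_monotone x.fst x.snd y) v

/-- The two blocks are the components of one column of the Hessian, so it is their squares that add
up. Since the `φ`-block already uses at least `μ ‖v‖`, only `ℓg1² - μ²` remains for the mixed block.
-/
lemma norm_blocks_le (h : Standing P μ ℓf0 ℓf1 ℓg1 ℓg2 σf σg1 σg2) (x : Joint d q)
    (v : EuclideanSpace ℝ (Fin q)) :
    ‖hessThetaPhi P.meanG x v‖ ^ 2 + ‖hessPhi P.meanG x v‖ ^ 2 ≤ ℓg1 ^ 2 * ‖v‖ ^ 2 := by
  have h1 := norm_sq_joint (hess P.meanG x (inrL d q v))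
  have h2 : ‖hess P.meanG x (inrL d q v)‖ ≤ ℓg1 * ‖v‖ := by
    refine (ContinuousLinearMap.le_of_opNorm_le _ (h.norm_hess_le x) _).trans ?_
    rw [norm_inrL]
  have h3 := pow_le_pow_left₀ (norm_nonneg _) h2 2
  rw [mul_pow, h1] at h3
  exact h3

lemma le_norm_hessPhi (h : Standing P μ ℓf0 ℓf1 ℓg1 ℓg2 σf σg1 σg2) (x : Joint d q)
    (v : EuclideanSpace ℝ (Fin q)) : μ * ‖v‖ ≤ ‖hessPhi P.meanG x v‖ := by
  rcases (norm_nonneg v).eq_or_lt with h0 | h0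
  · rw [← h0, mul_zero]; exact norm_nonneg _
  · have h1 := (h.le_inner_hessPhi x v).trans (real_inner_le_norm _ _)
    have h2 : μ * ‖v‖ * ‖v‖ ≤ ‖hessPhi P.meanG x v‖ * ‖v‖ := by nlinarith
    exact le_of_mul_le_mul_right h2 h0

lemma norm_hessPhi_apply_le (h : Standing P μ ℓf0 ℓf1 ℓg1 ℓg2 σf σg1 σg2) (x : Joint d q)
    (v : EuclideanSpace ℝ (Fin q)) : ‖hessPhi P.meanG x v‖ ≤ ℓg1 * ‖v‖ := by
  refine le_of_sq_le_sq ?_ (by positivity)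
  have := h.norm_blocks_le x v
  nlinarith [sq_nonneg ‖hessThetaPhi P.meanG x v‖]

lemma norm_hessThetaPhi_apply_le (h : Standing P μ ℓf0 ℓf1 ℓg1 ℓg2 σf σg1 σg2) (x : Joint d q)
    (v : EuclideanSpace ℝ (Fin q)) : ‖hessThetaPhi P.meanG x v‖ ≤ ℓg1 * ‖v‖ := by
  refine le_of_sq_le_sq ?_ (by positivity)
  have := h.norm_blocks_le x v
  nlinarith [sq_nonneg ‖hessPhi P.meanG x v‖]

/-- The mixed block of the Hessian is controlled by the gap between `ℓ` and `μ`. -/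
lemma norm_hessThetaPhi_le_sqrt (h : Standing P μ ℓf0 ℓf1 ℓg1 ℓg2 σf σg1 σg2) (x : Joint d q)
    (v : EuclideanSpace ℝ (Fin q)) :
    ‖hessThetaPhi P.meanG x v‖ ≤ Real.sqrt (ℓg1 ^ 2 - μ ^ 2) * ‖v‖ := by
  rcases eq_or_ne v 0 with rfl | hv
  · simp
  have h1 := h.norm_blocks_le x v
  have h2 := pow_le_pow_left₀ (mul_nonneg h.mu_pos.le (norm_nonneg v)) (h.le_norm_hessPhi x v) 2
  have hv' : 0 < ‖v‖ ^ 2 := by positivity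
  have h3 : ‖hessThetaPhi P.meanG x v‖ ^ 2 ≤ ((ℓg1 : ℝ) ^ 2 - μ ^ 2) * ‖v‖ ^ 2 := by
    rw [mul_pow] at h2; linarith
  have h4 : 0 ≤ (ℓg1 : ℝ) ^ 2 - μ ^ 2 :=
    nonneg_of_mul_nonneg_left ((sq_nonneg _).trans h3) hv'
  refine le_of_sq_le_sq ?_ (by positivity)
  rw [mul_pow, Real.sq_sqrt h4]
  exact h3

lemma isUnit_hessPhi (h : Standing P μ ℓf0 ℓf1 ℓg1 ℓg2 σf σg1 σg2) (x : Joint d q) :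
    IsUnit (hessPhi P.meanG x) := by
  have hinj : Function.Injective (hessPhi P.meanG x) := by
    refine (injective_iff_map_eq_zero _).mpr fun v hv => ?_
    have := h.le_norm_hessPhi x v
    rw [hv, norm_zero] at this
    exact norm_le_zero_iff.mp (nonpos_of_mul_nonpos_right this h.mu_pos)
  rw [ContinuousLinearMap.isUnit_iff_bijective]
  exact ⟨hinj, (LinearMap.injective_iff_surjective
    (f := (hessPhi P.meanG x : EuclideanSpace ℝ (Fin q) →ₗ[ℝ] EuclideanSpace ℝ (Fin q)))).mp hinj⟩

lemma hessPhi_inverse_apply (h : Standing P μ ℓf0 ℓf1 ℓg1 ℓg2 σf σg1 σg2) (x : Joint d q)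
    (v : EuclideanSpace ℝ (Fin q)) :
    hessPhi P.meanG x (Ring.inverse (hessPhi P.meanG x) v) = v :=
  congrArg (fun A => A v) (Ring.mul_inverse_cancel _ (h.isUnit_hessPhi x))

lemma norm_inverse_apply_le (h : Standing P μ ℓf0 ℓf1 ℓg1 ℓg2 σf σg1 σg2) (x : Joint d q)
    (v : EuclideanSpace ℝ (Fin q)) : ‖Ring.inverse (hessPhi P.meanG x) v‖ ≤ 1 / μ * ‖v‖ := by
  have h1 := h.le_norm_hessPhi x (Ring.inverse (hessPhi P.meanG x) v)
  rw [h.hessPhi_inverse_apply] at h1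
  rw [one_div, inv_mul_eq_div, le_div_iff₀ h.mu_pos]
  linarith

/-- In contrast to `norm_coupling_apply_le'`, this constant vanishes when `ℓg1 = μ`, which the case
of zero Neumann bias depends on. The cruder form suffices for Lipschitz and size estimates of the
surrogate. -/
lemma norm_coupling_apply_le (h : Standing P μ ℓf0 ℓf1 ℓg1 ℓg2 σf σg1 σg2) (x : Joint d q)
    (v : EuclideanSpace ℝ (Fin q)) :
    ‖coupling P x v‖ ≤ Real.sqrt (ℓg1 ^ 2 - μ ^ 2) * (1 / μ) * ‖v‖ := by
  refine (h.norm_hessThetaPhi_le_sqrt x _).trans ?_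
  rw [mul_assoc]
  exact mul_le_mul_of_nonneg_left (h.norm_inverse_apply_le x v) (Real.sqrt_nonneg _)

lemma norm_coupling_apply_le' (h : Standing P μ ℓf0 ℓf1 ℓg1 ℓg2 σf σg1 σg2) (x : Joint d q)
    (v : EuclideanSpace ℝ (Fin q)) : ‖coupling P x v‖ ≤ ℓg1 * (1 / μ) * ‖v‖ := by
  refine (h.norm_hessThetaPhi_apply_le x _).trans ?_
  rw [mul_assoc]
  exact mul_le_mul_of_nonneg_left (h.norm_inverse_apply_le x v) ℓg1.coe_nonneg

lemma norm_hess_sub_apply_le (h : Standing P μ ℓf0 ℓf1 ℓg1 ℓg2 σf σg1 σg2) (x y : Joint d q)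
    (v : EuclideanSpace ℝ (Fin q)) :
    ‖(hess P.meanG x - hess P.meanG y) (inrL d q v)‖ ≤ ℓg2 * ‖x - y‖ * ‖v‖ := by
  refine (ContinuousLinearMap.le_of_opNorm_le _ (h.lip.hess_g.norm_sub_le x y) _).trans ?_
  rw [norm_inrL]

lemma norm_hessPhi_sub_apply_le (h : Standing P μ ℓf0 ℓf1 ℓg1 ℓg2 σf σg1 σg2) (x y : Joint d q)
    (v : EuclideanSpace ℝ (Fin q)) :
    ‖hessPhi P.meanG x v - hessPhi P.meanG y v‖ ≤ ℓg2 * ‖x - y‖ * ‖v‖ :=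
  (norm_snd_le ((hess P.meanG x - hess P.meanG y) (inrL d q v))).trans
    (h.norm_hess_sub_apply_le x y v)

lemma norm_hessThetaPhi_sub_apply_le (h : Standing P μ ℓf0 ℓf1 ℓg1 ℓg2 σf σg1 σg2)
    (x y : Joint d q) (v : EuclideanSpace ℝ (Fin q)) :
    ‖hessThetaPhi P.meanG x v - hessThetaPhi P.meanG y v‖ ≤ ℓg2 * ‖x - y‖ * ‖v‖ :=
  (norm_fst_le ((hess P.meanG x - hess P.meanG y) (inrL d q v))).trans
    (h.norm_hess_sub_apply_le x y v)

/-- This is the resolvent identity `X⁻¹ - Y⁻¹ = X⁻¹ (Y - X) Y⁻¹`, with both inverses bounded by `1 /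
μ`. -/
lemma norm_inverse_sub_apply_le (h : Standing P μ ℓf0 ℓf1 ℓg1 ℓg2 σf σg1 σg2) (x y : Joint d q)
    (v : EuclideanSpace ℝ (Fin q)) :
    ‖Ring.inverse (hessPhi P.meanG x) v - Ring.inverse (hessPhi P.meanG y) v‖
      ≤ 1 / μ * (ℓg2 * ‖x - y‖ * (1 / μ * ‖v‖)) := by
  set w := Ring.inverse (hessPhi P.meanG y) v with hw
  have hv : hessPhi P.meanG y w = v := h.hessPhi_inverse_apply y v
  have hw' : Ring.inverse (hessPhi P.meanG x) (hessPhi P.meanG x w) = w :=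
    congrArg (fun A => A w) (Ring.inverse_mul_cancel _ (h.isUnit_hessPhi x))
  have : Ring.inverse (hessPhi P.meanG x) v - w
      = Ring.inverse (hessPhi P.meanG x) (hessPhi P.meanG y w - hessPhi P.meanG x w) := by
    rw [map_sub, hw', hv]
  rw [this]
  refine (h.norm_inverse_apply_le x _).trans (mul_le_mul_of_nonneg_left ?_
    (one_div_nonneg.mpr h.mu_pos.le))
  rw [norm_sub_rev]
  refine (h.norm_hessPhi_sub_apply_le x y w).trans ?_
  exact mul_le_mul_of_nonneg_left (h.norm_inverse_apply_le y v) (by positivity)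

lemma norm_coupling_sub_apply_le (h : Standing P μ ℓf0 ℓf1 ℓg1 ℓg2 σf σg1 σg2) (x y : Joint d q)
    (v : EuclideanSpace ℝ (Fin q)) :
    ‖coupling P x v - coupling P y v‖
      ≤ (ℓg2 * (1 / μ) + ℓg1 * (1 / μ * (ℓg2 * (1 / μ)))) * ‖x - y‖ * ‖v‖ := by
  have hdec : coupling P x v - coupling P y v
      = (hessThetaPhi P.meanG x (Ring.inverse (hessPhi P.meanG x) v)
          - hessThetaPhi P.meanG y (Ring.inverse (hessPhi P.meanG x) v))
        + hessThetaPhi P.meanG y (Ring.inverse (hessPhi P.meanG x) v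
            - Ring.inverse (hessPhi P.meanG y) v) := by
    simp [coupling]
  rw [hdec]
  refine (norm_add_le _ _).trans ?_
  have h1 := (h.norm_hessThetaPhi_sub_apply_le x y
    (Ring.inverse (hessPhi P.meanG x) v)).trans
    (mul_le_mul_of_nonneg_left (h.norm_inverse_apply_le x v) (by positivity))
  have h2 := (h.norm_hessThetaPhi_apply_le y _).trans
    (mul_le_mul_of_nonneg_left (h.norm_inverse_sub_apply_le x y v) ℓg1.coe_nonneg)
  refine (add_le_add h1 h2).trans (le_of_eq ?_)
  ring

/-- The product of coupling and `∇_φ f` is Lipschitz because both factors are bounded and Lipschitz;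
boundedness of `∇_φ f` is where `ℓf0` enters. The constant involves the problem alone, so it can be
fixed before any parameter of the algorithm. -/
lemma exists_surrogate_lipschitz (h : Standing P μ ℓf0 ℓf1 ℓg1 ℓg2 σf σg1 σg2) :
    ∃ L : ℝ, 0 ≤ L ∧ ∀ x y, ‖surrogate P x - surrogate P y‖ ≤ L * ‖x - y‖ := by
  have hμ := h.mu_pos
  refine ⟨ℓf1 + ((ℓg2 * (1 / μ) + ℓg1 * (1 / μ * (ℓg2 * (1 / μ)))) * ℓf0
    + ℓg1 * (1 / μ) * ℓf1), by positivity, fun x y => ?_⟩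
  have hdec : surrogate P x - surrogate P y
      = (gradTheta P.meanF x - gradTheta P.meanF y)
        - ((coupling P x (gradPhi P.meanF x) - coupling P y (gradPhi P.meanF x))
          + coupling P y (gradPhi P.meanF x - gradPhi P.meanF y)) := by
    simp only [surrogate, map_sub]; abel
  rw [hdec]
  refine (norm_sub_le _ _).trans ?_
  have h1 := h.norm_gradTheta_f_sub_le x y
  have h2 := (h.norm_coupling_sub_apply_le x y (gradPhi P.meanF x)).trans
    (mul_le_mul_of_nonneg_left (h.norm_gradPhi_f_le x) (by positivity))
  have h3 := (h.norm_coupling_apply_le' y (gradPhi P.meanF x - gradPhi P.meanF y)).trans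
    (mul_le_mul_of_nonneg_left (h.norm_gradPhi_f_sub_le x y) (by positivity))
  refine (add_le_add h1 ((norm_add_le _ _).trans (add_le_add h2 h3))).trans (le_of_eq ?_)
  ring

lemma norm_surrogate_le (h : Standing P μ ℓf0 ℓf1 ℓg1 ℓg2 σf σg1 σg2) (x : Joint d q) :
    ‖surrogate P x‖ ≤ ℓf0 + ℓg1 * (1 / μ) * ℓf0 := by
  have hμ := h.mu_pos
  refine (norm_sub_le _ _).trans (add_le_add (h.norm_gradTheta_f_le x) ?_)
  exact (h.norm_coupling_apply_le' x _).trans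
    (mul_le_mul_of_nonneg_left (h.norm_gradPhi_f_le x) (by positivity))

/-- The gradient `∇_φ g(θ', φ*(θ))` is at most `ℓg1 ‖θ' - θ‖`, since it vanishes when `θ'` is
replaced by `θ`, and strong monotonicity bounds it below by `μ` times the distance of the two
solutions. -/
lemma norm_lowerSol_sub_le (h : Standing P μ ℓf0 ℓf1 ℓg1 ℓg2 σf σg1 σg2)
    (θ θ' : EuclideanSpace ℝ (Fin d)) :
    ‖P.lowerSol θ' - P.lowerSol θ‖ ≤ ℓg1 * (1 / μ) * ‖θ' - θ‖ := by
  have hμ := h.mu_pos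
  set a := P.lowerSol θ
  set b := P.lowerSol θ'
  have h1 := h.strongly_monotone θ' a b
  rw [h.gradPhi_lowerSol θ', ← h.gradPhi_lowerSol θ] at h1
  have h2 := h.norm_gradPhi_g_sub_le (pt θ a) (pt θ' a)
  have h3 : ‖pt θ a - pt θ' a‖ ≤ ‖θ' - θ‖ := by
    refine (norm_pt_sub_le _ _ _ _).trans ?_
    rw [sub_self, norm_zero, add_zero, norm_sub_rev]
  have h4 := h1.trans (real_inner_le_norm _ _)
  have h5 := h2.trans (mul_le_mul_of_nonneg_left h3 ℓg1.coe_nonneg)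
  rcases (norm_nonneg (b - a)).eq_or_lt with h0 | h0
  · rw [← h0]; positivity
  · have h6 : μ * ‖b - a‖ * ‖b - a‖ ≤ ℓg1 * ‖θ' - θ‖ * ‖b - a‖ := by
      nlinarith [mul_le_mul_of_nonneg_right h5 h0.le]
    have h7 := le_of_mul_le_mul_right h6 h0
    have h8 : ‖b - a‖ ≤ ℓg1 * ‖θ' - θ‖ / μ := by rw [le_div_iff₀ hμ]; linarith
    calc _ ≤ _ := h8
      _ = _ := by ring

lemma continuous_lowerSol (h : Standing P μ ℓf0 ℓf1 ℓg1 ℓg2 σf σg1 σg2) :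
    Continuous P.lowerSol := by
  have hμ := h.mu_pos
  have : LipschitzWith (Real.toNNReal (ℓg1 * (1 / μ))) P.lowerSol :=
    LipschitzWith.of_dist_le_mul fun x y => by
      rw [dist_eq_norm, dist_eq_norm, Real.coe_toNNReal _ (by positivity)]
      exact h.norm_lowerSol_sub_le y x
  exact this.continuous

lemma norm_pt_lowerSol_sub_le (h : Standing P μ ℓf0 ℓf1 ℓg1 ℓg2 σf σg1 σg2)
    (θ θ' : EuclideanSpace ℝ (Fin d)) :
    ‖pt θ' (P.lowerSol θ') - pt θ (P.lowerSol θ)‖ ≤ (1 + ℓg1 * (1 / μ)) * ‖θ' - θ‖ := by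
  refine (norm_pt_sub_le _ _ _ _).trans ?_
  linarith [h.norm_lowerSol_sub_le θ θ']

/-- The solution map of the lower level is differentiable, with a quadratic remainder. -/
lemma exists_lowerSol_taylor (h : Standing P μ ℓf0 ℓf1 ℓg1 ℓg2 σf σg1 σg2) :
    ∃ C : ℝ, 0 ≤ C ∧ ∀ θ θ' : EuclideanSpace ℝ (Fin d), ∀ u : EuclideanSpace ℝ (Fin q),
      |inner ℝ u (P.lowerSol θ' - P.lowerSol θ)
        + inner ℝ (coupling P (pt θ (P.lowerSol θ)) u) (θ' - θ)| ≤ C * ‖u‖ * ‖θ' - θ‖ ^ 2 := by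
  have hμ := h.mu_pos
  refine ⟨ℓg2 * (1 + ℓg1 * (1 / μ)) ^ 2 * (1 / μ), by positivity, fun θ θ' u => ?_⟩
  set x := pt θ (P.lowerSol θ) with hx
  set y := pt θ' (P.lowerSol θ') with hy
  set w := Ring.inverse (hessPhi P.meanG x) u with hw
  -- `∇g` is expanded between the two solution points; its `φ`-component vanishes at both, so the
  -- `φ`-component of the remainder equals the linear term up to sign.
  set R := gradient P.meanG y - gradient P.meanG x - hess P.meanG x (y - x) with hR
  have hRn : ‖R‖ ≤ ℓg2 * ‖y - x‖ ^ 2 := norm_taylor_le h.hasFDerivAt_gradient_g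
    (fun a b => h.lip.hess_g.norm_sub_le a b) x y
  have hsnd : R.snd = -(hess P.meanG x (y - x)).snd := by
    have h1 : (gradient P.meanG y).snd = 0 := h.gradPhi_lowerSol θ'
    have h2 : (gradient P.meanG x).snd = 0 := h.gradPhi_lowerSol θ
    rw [hR, WithLp.sub_snd, WithLp.sub_snd, h1, h2, sub_zero, zero_sub]
  -- Testing with `w = (∇²_φ g)⁻¹ u` and moving the Hessian across by symmetry produces `coupling`
  -- in the direction `θ` and `u` itself in the direction `φ`.
  have hkey : inner ℝ u (P.lowerSol θ' - P.lowerSol θ) + inner ℝ (coupling P x u) (θ' - θ)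
      = - inner ℝ R.snd w := by
    rw [hsnd, inner_neg_left, neg_neg, h.inner_snd_hess, h.hessPhi_inverse_apply]
    have e1 : (y - x).fst = θ' - θ := rfl
    have e2 : (y - x).snd = P.lowerSol θ' - P.lowerSol θ := rfl
    rw [e1, e2, real_inner_comm u, real_inner_comm (θ' - θ) (coupling P x u), add_comm]
    rfl
  rw [hkey, abs_neg]
  refine (abs_real_inner_le_norm _ _).trans ?_
  have h1 : ‖R.snd‖ ≤ ℓg2 * ((1 + ℓg1 * (1 / μ)) * ‖θ' - θ‖) ^ 2 :=
    (norm_snd_le R).trans (hRn.trans (mul_le_mul_of_nonneg_left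
      (pow_le_pow_left₀ (norm_nonneg _) (h.norm_pt_lowerSol_sub_le θ θ') 2) ℓg2.coe_nonneg))
  refine (mul_le_mul h1 (h.norm_inverse_apply_le x u) (norm_nonneg _) (by positivity)).trans
    (le_of_eq ?_)
  ring

lemma V_eq (θ : EuclideanSpace ℝ (Fin d)) : P.V θ = P.meanF (pt θ (P.lowerSol θ)) := rfl

/-- `f` is expanded to first order along `(θ, φ*(θ))`, and the displacement of `φ*` is linearized by
testing `exists_lowerSol_taylor` with `u = ∇_φ f`. The uniform quadratic remainder yields both the
differentiability of `V` and its descent inequality. -/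
lemma exists_V_taylor (h : Standing P μ ℓf0 ℓf1 ℓg1 ℓg2 σf σg1 σg2) :
    ∃ C : ℝ, 0 ≤ C ∧ ∀ θ θ' : EuclideanSpace ℝ (Fin d),
      |P.V θ' - P.V θ - inner ℝ (surrogate P (pt θ (P.lowerSol θ))) (θ' - θ)|
        ≤ C * ‖θ' - θ‖ ^ 2 := by
  have hμ := h.mu_pos
  obtain ⟨C, hC, hT⟩ := h.exists_lowerSol_taylor
  refine ⟨ℓf1 * (1 + ℓg1 * (1 / μ)) ^ 2 + C * ℓf0, by positivity, fun θ θ' => ?_⟩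
  set x := pt θ (P.lowerSol θ) with hx
  set y := pt θ' (P.lowerSol θ') with hy
  have h1 := norm_taylor_le (u := P.meanF) (L := ℓf1)
    (fun z => (h.reg.contDiff_meanF.differentiable one_ne_zero z).hasFDerivAt)
    (fun a b => by rw [← norm_gradient_sub]; exact h.lip.grad_f.norm_sub_le a b) x y
  have h1' := h1.trans (mul_le_mul_of_nonneg_left
      (pow_le_pow_left₀ (norm_nonneg _) (h.norm_pt_lowerSol_sub_le θ θ') 2) ℓf1.coe_nonneg)
  have h2 := (hT θ θ' (gradPhi P.meanF x)).trans
    (mul_le_mul_of_nonneg_right (mul_le_mul_of_nonneg_left (h.norm_gradPhi_f_le x) hC)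
      (sq_nonneg _))
  have hin : fderiv ℝ P.meanF x (y - x) = inner ℝ (gradTheta P.meanF x) (θ' - θ)
      + inner ℝ (gradPhi P.meanF x) (P.lowerSol θ' - P.lowerSol θ) := by
    rw [← inner_gradient, inner_joint]; rfl
  have hdec : P.V θ' - P.V θ - inner ℝ (surrogate P x) (θ' - θ)
      = (P.meanF y - P.meanF x - fderiv ℝ P.meanF x (y - x))
        + (inner ℝ (gradPhi P.meanF x) (P.lowerSol θ' - P.lowerSol θ)
          + inner ℝ (coupling P x (gradPhi P.meanF x)) (θ' - θ)) := by
    rw [hin, V_eq, V_eq, surrogate, inner_sub_left]; ring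
  rw [hdec]
  refine (abs_add_le _ _).trans ((add_le_add h1' h2).trans (le_of_eq ?_))
  ring

lemma hasGradientAt_V (h : Standing P μ ℓf0 ℓf1 ℓg1 ℓg2 σf σg1 σg2)
    (θ : EuclideanSpace ℝ (Fin d)) :
    HasGradientAt P.V (surrogate P (pt θ (P.lowerSol θ))) θ := by
  obtain ⟨C, hC, hT⟩ := h.exists_V_taylor
  rw [hasGradientAt_iff_isLittleO]
  refine Asymptotics.IsBigO.trans_isLittleO (g := fun θ' => ‖θ' - θ‖ ^ 2) ?_ ?_
  · exact Asymptotics.IsBigO.of_bound C (Filter.Eventually.of_forall fun θ' => by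
      simpa using hT θ θ')
  · exact Asymptotics.isLittleO_pow_sub_sub θ one_lt_two

lemma differentiable_V (h : Standing P μ ℓf0 ℓf1 ℓg1 ℓg2 σf σg1 σg2) :
    Differentiable ℝ P.V := fun θ => (h.hasGradientAt_V θ).differentiableAt

lemma gradient_V (h : Standing P μ ℓf0 ℓf1 ℓg1 ℓg2 σf σg1 σg2) (θ : EuclideanSpace ℝ (Fin d)) :
    gradient P.V θ = surrogate P (pt θ (P.lowerSol θ)) := (h.hasGradientAt_V θ).gradient

/-- The bias of the truncated Neumann series. -/
lemma norm_truncSurrogate_sub_le (h : Standing P μ ℓf0 ℓf1 ℓg1 ℓg2 σf σg1 σg2) (N : ℕ)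
    (x : Joint d q) :
    ‖truncSurrogate P ℓg1 N x - surrogate P x‖ ≤ |neumannBias μ ℓf0 ℓg1 N| := by
  have hμ := h.mu_pos
  set C := hessPhi P.meanG x with hC
  set S := 1 - (1 / (ℓg1 : ℝ)) • C with hS
  set v := gradPhi P.meanF x with hv
  have hdiff : truncSurrogate P ℓg1 N x - surrogate P x = hessThetaPhi P.meanG x
      (Ring.inverse C v - ((1 / (ℓg1 : ℝ)) • ∑ j ∈ Finset.range N, S ^ j) v) := by
    simp only [truncSurrogate, surrogate, coupling, ContinuousLinearMap.comp_apply, map_sub]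
    abel
  -- The inequality `μ ≤ ℓg1` requires a nonzero vector in the lower-level space. If `∇_φ f`
  -- vanishes the two surrogates agree, and the absolute value in the bound makes it valid whatever
  -- the sign of `1 - μ / ℓg1`.
  rcases eq_or_ne v 0 with hv0 | hv0
  · rw [hdiff, hv0]; simp
  have hvn : 0 < ‖v‖ := norm_pos_iff.mpr hv0
  have hμℓ : μ ≤ ℓg1 := by
    have h1 := (h.le_norm_hessPhi x v).trans (h.norm_hessPhi_apply_le x v)
    exact le_of_mul_le_mul_right h1 hvn
  have hℓ : (0 : ℝ) < ℓg1 := hμ.trans_le hμℓ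
  have hc : 0 ≤ 1 - μ / (ℓg1 : ℝ) := by
    rw [sub_nonneg, div_le_one hℓ]; exact hμℓ
  -- `S` is symmetric and its form lies between `0` and `(1 - μ / ℓg1) ‖w‖²`, because the form of
  -- the Hessian block lies between `μ ‖w‖²` and `ℓg1 ‖w‖²`.
  have hSn : ‖S‖ ≤ 1 - μ / ℓg1 := by
    have hSa : ∀ w, S w = w - (1 / (ℓg1 : ℝ)) • C w := fun w => by simp [hS]
    refine norm_le_of_symm_of_form_le (fun a b => ?_) hc fun w => ?_
    · rw [hSa, hSa, inner_sub_left, inner_sub_right, inner_smul_left, inner_smul_right,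
        h.hessPhi_symm x a b, conj_trivial]
    · have h1 := h.le_inner_hessPhi x w
      have h2 : inner ℝ (C w) w ≤ ℓg1 * ‖w‖ ^ 2 := by
        refine (real_inner_le_norm _ _).trans ?_
        nlinarith [mul_le_mul_of_nonneg_right (h.norm_hessPhi_apply_le x w) (norm_nonneg w)]
      have h3 : inner ℝ (S w) w = ‖w‖ ^ 2 - inner ℝ (C w) w / ℓg1 := by
        rw [hSa, inner_sub_left, inner_smul_left, real_inner_self_eq_norm_sq]
        simp; ring
      have h4 : inner ℝ (C w) w / ℓg1 ≤ ‖w‖ ^ 2 := by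
        rw [div_le_iff₀ hℓ]; linarith
      have h5 : μ / ℓg1 * ‖w‖ ^ 2 ≤ inner ℝ (C w) w / ℓg1 := by
        rw [div_mul_eq_mul_div]; exact div_le_div_of_nonneg_right h1 hℓ.le
      rw [h3, abs_of_nonneg (by linarith)]
      linarith
  rw [hdiff, ← sub_apply, inverse_sub_neumann (h.isUnit_hessPhi x) hℓ.ne', mul_apply_eq_comp]
  have hSN : ‖(S ^ N) v‖ ≤ (1 - μ / ℓg1) ^ N * ℓf0 :=
    (norm_pow_apply_le hSn N v).trans
      (mul_le_mul_of_nonneg_left (h.norm_gradPhi_f_le x) (by positivity))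
  refine (h.norm_hessThetaPhi_apply_le x _).trans ?_
  refine (mul_le_mul_of_nonneg_left ((h.norm_inverse_apply_le x _).trans
    (mul_le_mul_of_nonneg_left hSN (one_div_nonneg.mpr hμ.le))) hℓ.le).trans ?_
  refine le_trans (le_of_eq ?_) (le_abs_self _)
  rw [neumannBias]; ring

end Standing

end Bilevel

namespace Bilevel

/-! ### Means and second moments of the estimators -/

/-- Second moment of a noisy gradient step. -/
lemma lintegral_sq_noisy_step_le {Ω E : Type*} [MeasurableSpace Ω] {ν : Measure Ω}
    [IsProbabilityMeasure ν] [NormedAddCommGroup E] [InnerProductSpace ℝ E] [CompleteSpace E]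
    {X : Ω → E} {m : E} {σ : ℝ≥0} (hX : Integrable X ν) (hm : ∫ ω, X ω ∂ν = m)
    (hσ : ∫⁻ ω, ‖X ω - m‖ₑ ^ 2 ∂ν ≤ (σ : ℝ≥0∞) ^ 2) (w : E) (η : ℝ) :
    ∫⁻ ω, ‖w - η • X ω‖ₑ ^ 2 ∂ν ≤ ENNReal.ofReal (‖w - η • m‖ ^ 2 + η ^ 2 * σ ^ 2) := by
  have hL : MemLp (fun ω => X ω - m) 2 ν := memLp_two_of_lintegral_lt_top
    (hX.sub (integrable_const m)).aestronglyMeasurable (hσ.trans_lt (by finiteness))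
  have hsq : Integrable (fun ω => ‖X ω - m‖ ^ 2) ν := hL.integrable_norm_pow two_ne_zero
  have hin : Integrable (fun ω => inner ℝ (w - η • m) (X ω - m)) ν :=
    (hX.sub (integrable_const m)).const_inner (w - η • m)
  have hin0 : ∫ ω, inner ℝ (w - η • m) (X ω - m) ∂ν = 0 := by
    have h1 : Integrable (fun ω => X ω - m) ν := hX.sub (integrable_const m)
    rw [integral_inner h1, integral_sub hX (integrable_const m), hm]
    simp
  have hvar : ∫ ω, ‖X ω - m‖ ^ 2 ∂ν ≤ σ ^ 2 := by
    rw [integral_eq_lintegral_of_nonneg_ae (Filter.Eventually.of_forall fun ω => by positivity)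
      hsq.aestronglyMeasurable]
    refine ENNReal.toReal_le_of_le_ofReal (by positivity) ?_
    simp only [ENNReal.ofReal_pow (norm_nonneg _), ofReal_norm]
    rw [ENNReal.ofReal_pow σ.coe_nonneg, ENNReal.ofReal_coe_nnreal]
    exact hσ
  -- Expansion around the mean step: the cross term is centred and only the variance, scaled by
  -- `η²`, survives.
  have hexp : ∀ ω, ‖w - η • X ω‖ ^ 2 = ‖w - η • m‖ ^ 2
      - 2 * η * inner ℝ (w - η • m) (X ω - m) + η ^ 2 * ‖X ω - m‖ ^ 2 := fun ω => by
    have : w - η • X ω = (w - η • m) - η • (X ω - m) := by rw [smul_sub]; abel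
    rw [this, norm_sub_sq_real, inner_smul_right, norm_smul, mul_pow, Real.norm_eq_abs, sq_abs]
    ring
  have hi1 : Integrable (fun ω => ‖w - η • m‖ ^ 2
      - 2 * η * inner ℝ (w - η • m) (X ω - m)) ν := (integrable_const _).sub (hin.const_mul _)
  have hi2 : Integrable (fun ω => η ^ 2 * ‖X ω - m‖ ^ 2) ν := hsq.const_mul _
  have hi : Integrable (fun ω => ‖w - η • X ω‖ ^ 2) ν := by
    simp only [hexp]; exact hi1.add hi2
  calc ∫⁻ ω, ‖w - η • X ω‖ₑ ^ 2 ∂ν = ∫⁻ ω, ENNReal.ofReal (‖w - η • X ω‖ ^ 2) ∂ν := by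
        simp only [ENNReal.ofReal_pow (norm_nonneg _), ofReal_norm]
    _ = ENNReal.ofReal (∫ ω, ‖w - η • X ω‖ ^ 2 ∂ν) :=
        (ofReal_integral_eq_lintegral_ofReal hi
          (Filter.Eventually.of_forall fun ω => by positivity)).symm
    _ ≤ _ := by
        refine ENNReal.ofReal_le_ofReal ?_
        simp only [hexp]
        rw [integral_add hi1 hi2, integral_sub (integrable_const _) (hin.const_mul _),
          integral_const_mul, integral_const_mul, hin0]
        simp only [integral_const, probReal_univ, one_smul, mul_zero, sub_zero]
        gcongr

lemma integral_clm_comp {Ω E G : Type*} [MeasurableSpace Ω] {ν : Measure Ω}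
    [NormedAddCommGroup E] [NormedSpace ℝ E] [CompleteSpace E] [NormedAddCommGroup G]
    [NormedSpace ℝ G] [CompleteSpace G] (T : E →L[ℝ] G) {u : Ω → E} {m : E}
    (hu : Integrable u ν ∧ ∫ ω, u ω ∂ν = m) :
    Integrable (fun ω => T (u ω)) ν ∧ ∫ ω, T (u ω) ∂ν = T m :=
  ⟨T.integrable_comp hu.1, (T.integral_comp_comm hu.1).trans (congrArg T hu.2)⟩

/-- The Riesz map is a linear isometry, so it carries the variance hypothesis to the derivative and
the resulting mean back to the gradient. -/
lemma integral_gradient_eq {Ω E : Type*} [MeasurableSpace Ω] {ν : Measure Ω}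
    [IsProbabilityMeasure ν] [NormedAddCommGroup E] [InnerProductSpace ℝ E]
    [FiniteDimensional ℝ E] [CompleteSpace E] [MeasurableSpace E] [BorelSpace E]
    {u : E → Ω → ℝ} {w : E → ℝ} (hc : ∀ ω, ContDiff ℝ 1 fun x => u x ω) (hw : ContDiff ℝ 1 w)
    (hm : ∀ x, Measurable (u x)) (h0 : ∀ x, ∫ ω, u x ω ∂ν = w x) (hi : ∀ x, Integrable (u x) ν)
    {B : ℝ≥0∞} (hBt : B < ∞)
    (hB : ∀ y, ∫⁻ ω, ‖gradient (fun x => u x ω) y - gradient w y‖ₑ ^ 2 ∂ν ≤ B) (x : E) :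
    Integrable (fun ω => gradient (fun y => u y ω) x) ν ∧
      ∫ ω, gradient (fun y => u y ω) x ∂ν = gradient w x := by
  have key := integral_fderiv_eq (μ := ν) hc hw (fun x => (hm x).stronglyMeasurable) h0 hi hBt
    (fun y => by
      refine le_trans (le_of_eq (lintegral_congr fun ω => ?_)) (hB y)
      rw [← ofReal_norm, ← ofReal_norm, norm_gradient_sub]) x
  let T : StrongDual ℝ E ≃ₗᵢ[ℝ] E := (InnerProductSpace.toDual ℝ E).symm
  exact integral_clm_comp T.toContinuousLinearEquiv.toContinuousLinearMap key

lemma integral_const_sub_smul {Ω G : Type*} [MeasurableSpace Ω] {ν : Measure Ω}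
    [IsProbabilityMeasure ν] [NormedAddCommGroup G] [NormedSpace ℝ G] [CompleteSpace G]
    (a : G) (c : ℝ) {u : Ω → G} {m : G} (hu : Integrable u ν ∧ ∫ ω, u ω ∂ν = m) :
    Integrable (fun ω => a - c • u ω) ν ∧ ∫ ω, (a - c • u ω) ∂ν = a - c • m := by
  have h1 : Integrable (fun ω => c • u ω) ν := hu.1.smul c
  refine ⟨(integrable_const a).sub h1, ?_⟩
  rw [integral_sub (integrable_const a) h1, integral_smul, hu.2]
  simp

lemma integral_sub_smul_sum {Ω G ι : Type*} [MeasurableSpace Ω] {ν : Measure Ω}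
    [NormedAddCommGroup G] [NormedSpace ℝ G] [CompleteSpace G] (c : ℝ) (s : Finset ι)
    {v : Ω → G} {b : G} {u : ι → Ω → G} {m : ι → G} (hv : Integrable v ν ∧ ∫ ω, v ω ∂ν = b)
    (hu : ∀ i ∈ s, Integrable (u i) ν ∧ ∫ ω, u i ω ∂ν = m i) :
    Integrable (fun ω => v ω - c • ∑ i ∈ s, u i ω) ν ∧
      ∫ ω, (v ω - c • ∑ i ∈ s, u i ω) ∂ν = b - c • ∑ i ∈ s, m i := by
  have h1 : Integrable (fun ω => c • ∑ i ∈ s, u i ω) ν :=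
    (integrable_finsetSum s fun i hi => (hu i hi).1).smul c
  refine ⟨hv.1.sub h1, ?_⟩
  rw [integral_sub hv.1 h1, integral_smul, integral_finsetSum _ fun i hi => (hu i hi).1,
    Finset.sum_congr rfl fun i hi => (hu i hi).2, hv.2]

section products

variable {Ω : Type*} {m₁ m₂ : MeasurableSpace Ω} [mΩ : MeasurableSpace Ω] {ν : Measure Ω}
  {E F : Type*} [NormedAddCommGroup E] [NormedSpace ℝ E] [FiniteDimensional ℝ E]
  [NormedAddCommGroup F] [NormedSpace ℝ F] [CompleteSpace F]

lemma integral_clm_mul_of_indep (h : Indep m₁ m₂ ν) {X Y : Ω → E →L[ℝ] E} {a b : E →L[ℝ] E}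
    (hX : Measurable[m₁] X) (hY : Measurable[m₂] Y) (hXi : Integrable X ν ∧ ∫ ω, X ω ∂ν = a)
    (hYi : Integrable Y ν ∧ ∫ ω, Y ω ∂ν = b) :
    Integrable (fun ω => X ω * Y ω) ν ∧ ∫ ω, X ω * Y ω ∂ν = a * b := by
  have : CompleteSpace E := FiniteDimensional.complete ℝ E
  have key := integral_bilin_of_indep h hX hY hXi.1 hYi.1 (ContinuousLinearMap.mul ℝ (E →L[ℝ] E))
  rwa [hXi.2, hYi.2] at key

variable [MeasurableSpace E] [BorelSpace E]

lemma integral_clm_apply_of_indep (h : Indep m₁ m₂ ν) {X : Ω → E →L[ℝ] F} {Y : Ω → E}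
    {a : E →L[ℝ] F} {b : E}
    (hX : Measurable[m₁] X) (hY : Measurable[m₂] Y) (hXi : Integrable X ν ∧ ∫ ω, X ω ∂ν = a)
    (hYi : Integrable Y ν ∧ ∫ ω, Y ω ∂ν = b) :
    Integrable (fun ω => X ω (Y ω)) ν ∧ ∫ ω, X ω (Y ω) ∂ν = a b := by
  have : CompleteSpace E := FiniteDimensional.complete ℝ E
  have key := integral_bilin_of_indep h hX hY hXi.1 hYi.1 (ContinuousLinearMap.id ℝ (E →L[ℝ] F))
  rwa [hXi.2, hYi.2] at key

lemma integral_smul_of_indep [MeasurableSpace F] [BorelSpace F] (h : Indep m₁ m₂ ν)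
    {X : Ω → ℝ} {Y : Ω → F} {a : ℝ} {b : F}
    (hX : Measurable[m₁] X) (hY : Measurable[m₂] Y) (hXi : Integrable X ν ∧ ∫ ω, X ω ∂ν = a)
    (hYi : Integrable Y ν ∧ ∫ ω, Y ω ∂ν = b) :
    Integrable (fun ω => X ω • Y ω) ν ∧ ∫ ω, X ω • Y ω ∂ν = a • b := by
  have key := integral_bilin_of_indep h hX hY hXi.1 hYi.1 (ContinuousLinearMap.lsmul ℝ ℝ)
  rwa [hXi.2, hYi.2] at key

end products

lemma completeSpace_clm (E : Type*) [NormedAddCommGroup E] [NormedSpace ℝ E] [CompleteSpace E] :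
    CompleteSpace (E →L[ℝ] E) := inferInstance

namespace Problem.Regular

variable {d q : ℕ} {Ξ Z : Type*} [MeasurableSpace Ξ] [MeasurableSpace Z] {P : Problem d q Ξ Z}

lemma stronglyMeasurable_gradient_f (h : P.Regular) (x : Joint d q) :
    StronglyMeasurable fun ξ => gradient (fun y => P.f y ξ) x :=
  (InnerProductSpace.toDual ℝ (Joint d q)).symm.continuous.comp_stronglyMeasurable
    (stronglyMeasurable_fderiv_param (fun ξ => (h.contDiff_f ξ).differentiable one_ne_zero)
      (fun y => (h.measurable_f y).stronglyMeasurable) x)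

lemma stronglyMeasurable_gradient_g (h : P.Regular) (x : Joint d q) :
    StronglyMeasurable fun ζ => gradient (fun y => P.g y ζ) x :=
  (InnerProductSpace.toDual ℝ (Joint d q)).symm.continuous.comp_stronglyMeasurable
    (stronglyMeasurable_fderiv_param (fun ζ => (h.contDiff_g ζ).differentiable two_ne_zero)
      (fun y => (h.measurable_g y).stronglyMeasurable) x)

lemma contDiff_gradient_g (h : P.Regular) (ζ : Z) :
    ContDiff ℝ 1 (gradient fun y => P.g y ζ) := contDiff_gradient (h.contDiff_g ζ) (by norm_num)

lemma stronglyMeasurable_hess_g (h : P.Regular) (x : Joint d q) :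
    StronglyMeasurable fun ζ => hess (fun y => P.g y ζ) x :=
  stronglyMeasurable_fderiv_param (u := fun x ζ => gradient (fun y => P.g y ζ) x)
    (fun ζ => (h.contDiff_gradient_g ζ).differentiable one_ne_zero)
    h.stronglyMeasurable_gradient_g x

lemma measurable_uncurry_gradient_f (h : P.Regular) :
    Measurable (Function.uncurry fun (x : Joint d q) ξ => gradient (fun y => P.f y ξ) x) :=
  (stronglyMeasurable_uncurry_of_continuous_of_stronglyMeasurable
    (fun ξ => (contDiff_gradient (m := 0) (h.contDiff_f ξ) (by norm_num)).continuous)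
    h.stronglyMeasurable_gradient_f).measurable

lemma measurable_uncurry_gradient_g (h : P.Regular) :
    Measurable (Function.uncurry fun (x : Joint d q) ζ => gradient (fun y => P.g y ζ) x) :=
  (stronglyMeasurable_uncurry_of_continuous_of_stronglyMeasurable
    (fun ζ => (h.contDiff_gradient_g ζ).continuous) h.stronglyMeasurable_gradient_g).measurable

lemma measurable_uncurry_hess_g (h : P.Regular) :
    Measurable (Function.uncurry fun (x : Joint d q) ζ => hess (fun y => P.g y ζ) x) :=
  (stronglyMeasurable_uncurry_of_continuous_of_stronglyMeasurable
    (fun ζ => (h.contDiff_gradient_g ζ).continuous_fderiv one_ne_zero)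
    h.stronglyMeasurable_hess_g).measurable

variable {α : Type*} {mα : MeasurableSpace α}

lemma measurable_gradTheta_f (h : P.Regular) {X : α → Joint d q} {ξ : α → Ξ}
    (hX : Measurable X) (hξ : Measurable ξ) :
    Measurable fun a => gradTheta (fun y => P.f y (ξ a)) (X a) :=
  (WithLp.fstL 2 ℝ (EuclideanSpace ℝ (Fin d)) (EuclideanSpace ℝ (Fin q))).continuous.measurable.comp
    (h.measurable_uncurry_gradient_f.comp (hX.prodMk hξ))

lemma measurable_gradPhi_f (h : P.Regular) {X : α → Joint d q} {ξ : α → Ξ}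
    (hX : Measurable X) (hξ : Measurable ξ) :
    Measurable fun a => gradPhi (fun y => P.f y (ξ a)) (X a) :=
  (WithLp.sndL 2 ℝ (EuclideanSpace ℝ (Fin d)) (EuclideanSpace ℝ (Fin q))).continuous.measurable.comp
    (h.measurable_uncurry_gradient_f.comp (hX.prodMk hξ))

lemma measurable_gradPhi_g (h : P.Regular) {X : α → Joint d q} {ζ : α → Z}
    (hX : Measurable X) (hζ : Measurable ζ) :
    Measurable fun a => gradPhi (fun y => P.g y (ζ a)) (X a) :=
  (WithLp.sndL 2 ℝ (EuclideanSpace ℝ (Fin d)) (EuclideanSpace ℝ (Fin q))).continuous.measurable.comp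
    (h.measurable_uncurry_gradient_g.comp (hX.prodMk hζ))

end Problem.Regular

section blocks

variable {d q : ℕ}

/-- The `φφ`-block of an operator on the joint space. -/
noncomputable def phiBlock (d q : ℕ) : (Joint d q →L[ℝ] Joint d q) →L[ℝ]
    (EuclideanSpace ℝ (Fin q) →L[ℝ] EuclideanSpace ℝ (Fin q)) :=
  ((ContinuousLinearMap.compL ℝ (EuclideanSpace ℝ (Fin q)) (Joint d q) (EuclideanSpace ℝ (Fin q)))
    (WithLp.sndL 2 ℝ (EuclideanSpace ℝ (Fin d)) (EuclideanSpace ℝ (Fin q)))).comp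
  ((ContinuousLinearMap.compL ℝ (EuclideanSpace ℝ (Fin q)) (Joint d q) (Joint d q)).flip
    (inrL d q))

/-- The `θφ`-block of an operator on the joint space. -/
noncomputable def mixedBlock (d q : ℕ) : (Joint d q →L[ℝ] Joint d q) →L[ℝ]
    (EuclideanSpace ℝ (Fin q) →L[ℝ] EuclideanSpace ℝ (Fin d)) :=
  ((ContinuousLinearMap.compL ℝ (EuclideanSpace ℝ (Fin q)) (Joint d q) (EuclideanSpace ℝ (Fin d)))
    (WithLp.fstL 2 ℝ (EuclideanSpace ℝ (Fin d)) (EuclideanSpace ℝ (Fin q)))).comp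
  ((ContinuousLinearMap.compL ℝ (EuclideanSpace ℝ (Fin q)) (Joint d q) (Joint d q)).flip
    (inrL d q))

end blocks

section updates

variable {d q : ℕ} {Ξ Z : Type*} [MeasurableSpace Ξ] [MeasurableSpace Z] {P : Problem d q Ξ Z}
  {α : Type*} {mα : MeasurableSpace α}

lemma Problem.Regular.measurable_hessPhi_g (h : P.Regular) {X : α → Joint d q} {ζ : α → Z}
    (hX : Measurable X) (hζ : Measurable ζ) :
    Measurable fun a => hessPhi (fun y => P.g y (ζ a)) (X a) :=
  (phiBlock d q).continuous.measurable.comp (h.measurable_uncurry_hess_g.comp (hX.prodMk hζ))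

lemma Problem.Regular.measurable_hessThetaPhi_g (h : P.Regular) {X : α → Joint d q} {ζ : α → Z}
    (hX : Measurable X) (hζ : Measurable ζ) :
    Measurable fun a => hessThetaPhi (fun y => P.g y (ζ a)) (X a) :=
  (mixedBlock d q).continuous.measurable.comp (h.measurable_uncurry_hess_g.comp (hX.prodMk hζ))

/-- The product of the first `n` factors of the Hessian-inverse estimator. -/
noncomputable def neumannProd (P : Problem d q Ξ Z) (ℓ : ℝ) (ζ : ℕ → Z) (x : Joint d q) (n : ℕ) :
    EuclideanSpace ℝ (Fin q) →L[ℝ] EuclideanSpace ℝ (Fin q) :=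
  ((List.range n).map fun i => (1 : EuclideanSpace ℝ (Fin q) →L[ℝ] EuclideanSpace ℝ (Fin q))
    - (1 / ℓ) • hessPhi (fun y => P.g y (ζ (i + 1))) x).prod

lemma neumannProd_succ (ℓ : ℝ) (ζ : ℕ → Z) (x : Joint d q) (n : ℕ) :
    neumannProd P ℓ ζ x (n + 1) = neumannProd P ℓ ζ x n
      * (1 - (1 / ℓ) • hessPhi (fun y => P.g y (ζ (n + 1))) x) := by
  simp [neumannProd, List.range_succ]

lemma Problem.Regular.measurable_neumannProd (h : P.Regular) (ℓ : ℝ) {X : α → Joint d q}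
    {ζ : α → ℕ → Z} (hX : Measurable X) (n : ℕ)
    (hζ : ∀ i < n, Measurable fun a => ζ a (i + 1)) :
    Measurable fun a => neumannProd P ℓ (ζ a) (X a) n := by
  induction n with
  | zero => simp [neumannProd]
  | succ n ih =>
    simp only [neumannProd_succ]
    have h1 := (h.measurable_hessPhi_g hX (hζ n (Nat.lt_succ_self n))).const_smul (1 / ℓ)
    exact (ih fun i hi => hζ i (hi.trans (Nat.lt_succ_self n))).mul (measurable_const.sub h1)

lemma measurable_clm_apply {E F : Type*} [NormedAddCommGroup E] [NormedSpace ℝ E]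
    [FiniteDimensional ℝ E] [MeasurableSpace E] [BorelSpace E]
    [NormedAddCommGroup F] [NormedSpace ℝ F] [FiniteDimensional ℝ F] [MeasurableSpace F]
    [BorelSpace F] {A : α → E →L[ℝ] F} {v : α → E} (hA : Measurable A) (hv : Measurable v) :
    Measurable fun a => A a (v a) := by
  have : ProperSpace E := FiniteDimensional.proper ℝ E
  have : ProperSpace F := FiniteDimensional.proper ℝ F
  have hc : Continuous fun p : (E →L[ℝ] F) × E => p.1 p.2 := by fun_prop
  exact hc.measurable.comp (hA.prodMk hv)

lemma update_eq (p : Params d q) (D : Draws Ξ Z) (x : Joint d q) :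
    update P p D x = gradTheta (fun y => P.f y D.xi) x
      - ((p.N : ℝ) / p.ℓ) • hessThetaPhi (fun y => P.g y (D.zeta 0)) x
        (neumannProd P p.ℓ D.zeta x D.len (gradPhi (fun y => P.f y D.xi) x)) := by
  rw [update, hessInvEst, ← map_smul]; rfl

lemma Problem.Regular.measurable_update (h : P.Regular) (p : Params d q) {X : α → Joint d q}
    {D : α → Draws Ξ Z} (hX : Measurable X) (hξ : Measurable fun a => (D a).xi)
    (hζ : ∀ i, Measurable fun a => (D a).zeta i) (hn : Measurable fun a => (D a).len) :
    Measurable fun a => update P p (D a) (X a) := by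
  simp only [update_eq]
  suffices key : Measurable fun a => hessThetaPhi (fun y => P.g y ((D a).zeta 0)) (X a)
      (neumannProd P p.ℓ (D a).zeta (X a) (D a).len (gradPhi (fun y => P.f y (D a).xi) (X a)))
    from (h.measurable_gradTheta_f hX hξ).sub (key.const_smul ((p.N : ℝ) / p.ℓ))
  refine measurable_clm_apply (h.measurable_hessThetaPhi_g hX (hζ 0)) ?_
  refine measurable_clm_apply ?_ (h.measurable_gradPhi_f hX hξ)
  exact measurable_comp_nat (u := fun n a => neumannProd P p.ℓ (D a).zeta (X a) n)
    (fun n => h.measurable_neumannProd p.ℓ hX n fun i _ => hζ (i + 1)) hn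

end updates

namespace Standing

variable {d q : ℕ} {Ξ Z : Type*} [MeasurableSpace Ξ] [MeasurableSpace Z]
  {P : Problem d q Ξ Z} {μ : ℝ} {ℓf0 ℓf1 ℓg1 ℓg2 σf σg1 σg2 : ℝ≥0}

lemma integral_gradient_f (h : Standing P μ ℓf0 ℓf1 ℓg1 ℓg2 σf σg1 σg2) (x : Joint d q) :
    Integrable (fun ξ => gradient (fun y => P.f y ξ) x) P.lawXi ∧
      ∫ ξ, gradient (fun y => P.f y ξ) x ∂P.lawXi = gradient P.meanF x := by
  have := h.reg.prob_xi
  exact integral_gradient_eq h.reg.contDiff_f h.reg.contDiff_meanF h.reg.measurable_f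
    (fun _ => rfl) h.reg.integrable_f (by finiteness) h.var.grad_f x

lemma integral_gradient_g (h : Standing P μ ℓf0 ℓf1 ℓg1 ℓg2 σf σg1 σg2) (x : Joint d q) :
    Integrable (fun ζ => gradient (fun y => P.g y ζ) x) P.lawZeta ∧
      ∫ ζ, gradient (fun y => P.g y ζ) x ∂P.lawZeta = gradient P.meanG x := by
  have := h.reg.prob_zeta
  exact integral_gradient_eq (fun ζ => (h.reg.contDiff_g ζ).of_le (by norm_num))
    (h.reg.contDiff_meanG.of_le (by norm_num)) h.reg.measurable_g
    (fun _ => rfl) h.reg.integrable_g (by finiteness) h.var.grad_g x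

/-- The same principle is applied a second time, to the random field `∇g(·; ζ)`, whose mean has just
been identified at every point. -/
lemma integral_hess_g (h : Standing P μ ℓf0 ℓf1 ℓg1 ℓg2 σf σg1 σg2) (x : Joint d q) :
    Integrable (fun ζ => hess (fun y => P.g y ζ) x) P.lawZeta ∧
      ∫ ζ, hess (fun y => P.g y ζ) x ∂P.lawZeta = hess P.meanG x := by
  have := h.reg.prob_zeta
  exact integral_fderiv_eq (μ := P.lawZeta) (u := fun x ζ => gradient (fun y => P.g y ζ) x)
    (w := gradient P.meanG) (B := (σg2 : ℝ≥0∞) ^ 2) h.reg.contDiff_gradient_g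
    h.contDiff_gradient_g h.reg.stronglyMeasurable_gradient_g
    (fun x => (h.integral_gradient_g x).2) (fun x => (h.integral_gradient_g x).1)
    (by finiteness) h.var.hess_g x

lemma integral_gradTheta_f (h : Standing P μ ℓf0 ℓf1 ℓg1 ℓg2 σf σg1 σg2) (x : Joint d q) :
    Integrable (fun ξ => gradTheta (fun y => P.f y ξ) x) P.lawXi ∧
      ∫ ξ, gradTheta (fun y => P.f y ξ) x ∂P.lawXi = gradTheta P.meanF x :=
  integral_clm_comp (WithLp.fstL 2 ℝ (EuclideanSpace ℝ (Fin d)) (EuclideanSpace ℝ (Fin q)))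
    (h.integral_gradient_f x)

lemma integral_gradPhi_f (h : Standing P μ ℓf0 ℓf1 ℓg1 ℓg2 σf σg1 σg2) (x : Joint d q) :
    Integrable (fun ξ => gradPhi (fun y => P.f y ξ) x) P.lawXi ∧
      ∫ ξ, gradPhi (fun y => P.f y ξ) x ∂P.lawXi = gradPhi P.meanF x :=
  integral_clm_comp (WithLp.sndL 2 ℝ (EuclideanSpace ℝ (Fin d)) (EuclideanSpace ℝ (Fin q)))
    (h.integral_gradient_f x)

lemma integral_gradPhi_g (h : Standing P μ ℓf0 ℓf1 ℓg1 ℓg2 σf σg1 σg2) (x : Joint d q) :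
    Integrable (fun ζ => gradPhi (fun y => P.g y ζ) x) P.lawZeta ∧
      ∫ ζ, gradPhi (fun y => P.g y ζ) x ∂P.lawZeta = gradPhi P.meanG x :=
  integral_clm_comp (WithLp.sndL 2 ℝ (EuclideanSpace ℝ (Fin d)) (EuclideanSpace ℝ (Fin q)))
    (h.integral_gradient_g x)

lemma integral_hessPhi_g (h : Standing P μ ℓf0 ℓf1 ℓg1 ℓg2 σf σg1 σg2) (x : Joint d q) :
    Integrable (fun ζ => hessPhi (fun y => P.g y ζ) x) P.lawZeta ∧
      ∫ ζ, hessPhi (fun y => P.g y ζ) x ∂P.lawZeta = hessPhi P.meanG x :=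
  have := completeSpace_clm (Joint d q)
  integral_clm_comp (phiBlock d q) (h.integral_hess_g x)

lemma integral_hessThetaPhi_g (h : Standing P μ ℓf0 ℓf1 ℓg1 ℓg2 σf σg1 σg2) (x : Joint d q) :
    Integrable (fun ζ => hessThetaPhi (fun y => P.g y ζ) x) P.lawZeta ∧
      ∫ ζ, hessThetaPhi (fun y => P.g y ζ) x ∂P.lawZeta = hessThetaPhi P.meanG x :=
  have := completeSpace_clm (Joint d q)
  integral_clm_comp (mixedBlock d q) (h.integral_hess_g x)

lemma lintegral_sq_step_le (h : Standing P μ ℓf0 ℓf1 ℓg1 ℓg2 σf σg1 σg2) (x : Joint d q)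
    (w : EuclideanSpace ℝ (Fin q)) (η : ℝ) :
    ∫⁻ ζ, ‖w - η • gradPhi (fun y => P.g y ζ) x‖ₑ ^ 2 ∂P.lawZeta
      ≤ ENNReal.ofReal (‖w - η • gradPhi P.meanG x‖ ^ 2 + η ^ 2 * σg1 ^ 2) := by
  have := h.reg.prob_zeta
  refine lintegral_sq_noisy_step_le (h.integral_gradPhi_g x).1 (h.integral_gradPhi_g x).2 ?_ w η
  refine (lintegral_mono fun ζ => pow_le_pow_left' ?_ 2).trans (h.var.grad_g x)
  rw [← ofReal_norm, ← ofReal_norm]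
  exact ENNReal.ofReal_le_ofReal
    (norm_snd_le (gradient (fun y => P.g y ζ) x - gradient P.meanG x))

/-- Contraction of a lower-level gradient step at `θ` towards the solution for a nearby `z`. -/
lemma norm_sq_gradient_step_le (h : Standing P μ ℓf0 ℓf1 ℓg1 ℓg2 σf σg1 σg2)
    (θ z : EuclideanSpace ℝ (Fin d)) (φ : EuclideanSpace ℝ (Fin q)) {η : ℝ} (hη : 0 ≤ η) :
    ‖φ - P.lowerSol z - η • gradPhi P.meanG (pt θ φ)‖ ^ 2
      ≤ (1 - η * μ + 2 * η ^ 2 * ℓg1 ^ 2) * ‖φ - P.lowerSol z‖ ^ 2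
        + (η * ℓg1 ^ 2 / μ + 2 * η ^ 2 * ℓg1 ^ 2) * ‖θ - z‖ ^ 2 := by
  have hμ := h.mu_pos
  set u := φ - P.lowerSol z
  set G := gradPhi P.meanG (pt θ φ)
  have h0 := h.gradPhi_lowerSol z
  have hmono := h.strongly_monotone z (P.lowerSol z) φ
  rw [h0, sub_zero] at hmono
  have hdiff : ‖G - gradPhi P.meanG (pt z φ)‖ ≤ ℓg1 * ‖θ - z‖ := by
    refine (h.norm_gradPhi_g_sub_le _ _).trans (mul_le_mul_of_nonneg_left ?_ ℓg1.coe_nonneg)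
    simpa using norm_pt_sub_le θ z φ φ
  have hbd : ‖gradPhi P.meanG (pt z φ)‖ ≤ ℓg1 * ‖u‖ := by
    have := h.norm_gradPhi_g_sub_le (pt z φ) (pt z (P.lowerSol z))
    rw [h0, sub_zero] at this
    refine this.trans (mul_le_mul_of_nonneg_left ?_ ℓg1.coe_nonneg)
    simpa using norm_pt_sub_le z z φ (P.lowerSol z)
  have hGn : ‖G‖ ≤ ℓg1 * ‖θ - z‖ + ℓg1 * ‖u‖ := by
    have := norm_add_le (G - gradPhi P.meanG (pt z φ)) (gradPhi P.meanG (pt z φ))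
    rw [sub_add_cancel] at this
    linarith
  have hG2 : ‖G‖ ^ 2 ≤ 2 * ℓg1 ^ 2 * (‖u‖ ^ 2 + ‖θ - z‖ ^ 2) := by
    have := pow_le_pow_left₀ (norm_nonneg _) hGn 2
    nlinarith [sq_nonneg ((ℓg1 : ℝ) * ‖θ - z‖ - ℓg1 * ‖u‖)]
  have hinner : μ * ‖u‖ ^ 2 - ℓg1 * ‖θ - z‖ * ‖u‖ ≤ inner ℝ u G := by
    have h1 : inner ℝ u G = inner ℝ (gradPhi P.meanG (pt z φ)) u
        + inner ℝ (G - gradPhi P.meanG (pt z φ)) u := by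
      rw [← inner_add_left, add_sub_cancel, real_inner_comm]
    have h2 := neg_le_of_abs_le (abs_real_inner_le_norm (G - gradPhi P.meanG (pt z φ)) u)
    have h3 := mul_le_mul_of_nonneg_right hdiff (norm_nonneg u)
    rw [h1]; linarith
  -- The mismatch between `θ` and `z` uses up half of the contraction `2 η μ`, which is why the
  -- factor in the statement contains `1 - η μ`.
  have hyoung : 2 * (ℓg1 * ‖θ - z‖ * ‖u‖) ≤ μ * ‖u‖ ^ 2 + ℓg1 ^ 2 / μ * ‖θ - z‖ ^ 2 := by
    have h1 : ℓg1 ^ 2 / μ * ‖θ - z‖ ^ 2 = μ * ((ℓg1 : ℝ) * ‖θ - z‖ / μ) ^ 2 := by field_simp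
    have h2 : ℓg1 * ‖θ - z‖ * ‖u‖ = μ * (((ℓg1 : ℝ) * ‖θ - z‖ / μ) * ‖u‖) := by field_simp
    rw [h1, h2]
    nlinarith [mul_nonneg hμ.le (sq_nonneg ((ℓg1 : ℝ) * ‖θ - z‖ / μ - ‖u‖))]
  rw [norm_sub_sq_real, inner_smul_right, norm_smul, mul_pow, Real.norm_eq_abs, sq_abs]
  have e1 := mul_le_mul_of_nonneg_left hG2 (sq_nonneg η)
  have e2 := mul_le_mul_of_nonneg_left hinner hη
  have e3 := mul_le_mul_of_nonneg_left hyoung hη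
  have e4 : η * ℓg1 ^ 2 / μ * ‖θ - z‖ ^ 2 = η * (ℓg1 ^ 2 / μ * ‖θ - z‖ ^ 2) := by ring
  rw [add_mul, add_mul, e4]
  nlinarith

end Standing

/-! ### Independence of the draws and the mean of the update -/

section sampling

variable {d q : ℕ} {Ξ Z Ω : Type*} [MeasurableSpace Ξ] [MeasurableSpace Z]
  {P : Problem d q Ξ Z} {N : ℕ} {D : ℕ → Ω → Draws Ξ Z}

/-- The σ-algebra generated by a set of draws. -/
@[reducible] def sig (D : ℕ → Ω → Draws Ξ Z) (S : Set DrawIdx) : MeasurableSpace Ω :=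
  ⨆ i ∈ S, drawSigma D i

lemma drawSigma_le_sig {S : Set DrawIdx} {i : DrawIdx} (hi : i ∈ S) :
    drawSigma D i ≤ sig D S := le_iSup₂ (f := fun i (_ : i ∈ S) => drawSigma D i) i hi

lemma sig_mono {S T : Set DrawIdx} (h : S ⊆ T) : sig D S ≤ sig D T :=
  biSup_mono fun _ hi => h hi

lemma measurable_xi_sig {S : Set DrawIdx} {k : ℕ} (hi : .xi k ∈ S) :
    Measurable[sig D S] fun ω => (D k ω).xi :=
  (comap_measurable _).mono (drawSigma_le_sig hi) le_rfl

lemma measurable_zeta_sig {S : Set DrawIdx} {k i : ℕ} (hi : .zeta k i ∈ S) :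
    Measurable[sig D S] fun ω => (D k ω).zeta i :=
  (comap_measurable _).mono (drawSigma_le_sig hi) le_rfl

lemma measurable_inner_sig {S : Set DrawIdx} {k t : ℕ} (hi : .inner k t ∈ S) :
    Measurable[sig D S] fun ω => (D k ω).inner t :=
  (comap_measurable _).mono (drawSigma_le_sig hi) le_rfl

lemma measurable_len_sig {S : Set DrawIdx} {k : ℕ} (hi : .len k ∈ S) :
    Measurable[sig D S] fun ω => (D k ω).len :=
  (comap_measurable _).mono (drawSigma_le_sig hi) le_rfl

/-- With the number `n` of factors fixed, the term does not involve the random length and is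
therefore independent of it. -/
lemma Problem.Regular.measurable_hypergradient_term (h : P.Regular) (ℓ : ℝ)
    (x : Joint d q) (k n : ℕ) :
    Measurable[sig D {i | i = .xi k ∨ ∃ j, i = .zeta k j}] fun ω =>
      hessThetaPhi (fun y => P.g y ((D k ω).zeta 0)) x
        (neumannProd P ℓ (D k ω).zeta x n (gradPhi (fun y => P.f y (D k ω).xi) x)) :=
  measurable_clm_apply
    (h.measurable_hessThetaPhi_g (X := fun _ => x) measurable_const
      (measurable_zeta_sig (Or.inr ⟨0, rfl⟩)))
    (measurable_clm_apply (h.measurable_neumannProd ℓ (X := fun _ => x)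
        measurable_const n fun i _ => measurable_zeta_sig (Or.inr ⟨i + 1, rfl⟩))
      (h.measurable_gradPhi_f (X := fun _ => x) measurable_const
        (measurable_xi_sig (Or.inl rfl))))

variable [mΩ : MeasurableSpace Ω] {Pr : Measure Ω}

namespace IsSampling

lemma drawSigma_le (hD : IsSampling Pr P N D) (i : DrawIdx) : drawSigma D i ≤ mΩ := by
  cases i with
  | xi k => exact (hD.measurable_xi k).comap_le
  | zeta k i => exact (hD.measurable_zeta k i).comap_le
  | inner k t => exact (hD.measurable_inner k t).comap_le
  | len k => exact (hD.measurable_len k).comap_le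

lemma sig_le (hD : IsSampling Pr P N D) (S : Set DrawIdx) : sig D S ≤ mΩ :=
  iSup₂_le fun i _ => hD.drawSigma_le i

lemma indep_sig (hD : IsSampling Pr P N D) {S T : Set DrawIdx} (h : Disjoint S T) :
    Indep (sig D S) (sig D T) Pr := indep_iSup_of_disjoint hD.drawSigma_le hD.indep h

lemma integral_comp_xi (hD : IsSampling Pr P N D) {E : Type*} [NormedAddCommGroup E]
    [NormedSpace ℝ E] {u : Ξ → E} {m : E} (hu : Integrable u P.lawXi ∧ ∫ ξ, u ξ ∂P.lawXi = m)
    (k : ℕ) :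
    Integrable (fun ω => u (D k ω).xi) Pr ∧ ∫ ω, u (D k ω).xi ∂Pr = m := by
  rw [← hD.law_xi k] at hu
  exact ⟨hu.1.comp_measurable (hD.measurable_xi k),
    (integral_map (hD.measurable_xi k).aemeasurable hu.1.aestronglyMeasurable).symm.trans hu.2⟩

lemma integral_comp_zeta (hD : IsSampling Pr P N D) {E : Type*} [NormedAddCommGroup E]
    [NormedSpace ℝ E] {u : Z → E} {m : E} (hu : Integrable u P.lawZeta ∧ ∫ ζ, u ζ ∂P.lawZeta = m)
    (k i : ℕ) :
    Integrable (fun ω => u ((D k ω).zeta i)) Pr ∧ ∫ ω, u ((D k ω).zeta i) ∂Pr = m := by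
  rw [← hD.law_zeta k i] at hu
  exact ⟨hu.1.comp_measurable (hD.measurable_zeta k i), (integral_map
    (hD.measurable_zeta k i).aemeasurable hu.1.aestronglyMeasurable).symm.trans hu.2⟩

variable [IsProbabilityMeasure Pr]

lemma len_lt_ae (hD : IsSampling Pr P N D) (hN : 1 ≤ N) (k : ℕ) :
    ∀ᵐ ω ∂Pr, (D k ω).len < N := by
  have hN0 : (N : ℝ≥0∞) ≠ 0 := by simp; omega
  have hm : ∀ j, MeasurableSet {ω | (D k ω).len = j} := fun j =>
    hD.measurable_len k (measurableSet_singleton j)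
  have hU : {ω | (D k ω).len < N} = ⋃ j ∈ Finset.range N, {ω | (D k ω).len = j} := by
    ext ω; simp
  have hP : Pr {ω | (D k ω).len < N} = 1 := by
    rw [hU, measure_biUnion_finset (fun i _ j _ hij => Set.disjoint_left.mpr fun ω h1 h2 =>
      hij (h1.symm.trans h2)) fun j _ => hm j]
    rw [Finset.sum_congr rfl fun j hj => hD.law_len k j (Finset.mem_range.mp hj)]
    simp [ENNReal.mul_inv_cancel hN0 (ENNReal.natCast_ne_top N)]
  exact (prob_compl_eq_zero_iff (hD.measurable_len k measurableSet_Iio)).mpr hP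

/-- The random length is independent of the other draws. -/
lemma integral_indicator_len_smul (hD : IsSampling Pr P N D) {E : Type*} [NormedAddCommGroup E]
    [NormedSpace ℝ E] [CompleteSpace E] [MeasurableSpace E] [BorelSpace E] {k n : ℕ} (hn : n < N)
    {T : Set DrawIdx} (hT : .len k ∉ T) {R : Ω → E} {m : E} (hRm : Measurable[sig D T] R)
    (hR : Integrable R Pr ∧ ∫ ω, R ω ∂Pr = m) :
    Integrable (fun ω => Set.indicator {ω | (D k ω).len = n} (1 : Ω → ℝ) ω • R ω) Pr ∧
      ∫ ω, Set.indicator {ω | (D k ω).len = n} (1 : Ω → ℝ) ω • R ω ∂Pr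
        = (1 / (N : ℝ)) • m := by
  have hset : MeasurableSet {ω | (D k ω).len = n} := hD.measurable_len k (measurableSet_singleton n)
  have h1 : Measurable (Set.indicator {n} (1 : ℕ → ℝ)) := measurable_from_nat
  have h2 : Measurable[sig D {.len k}] fun ω => (D k ω).len :=
    measurable_len_sig (Set.mem_singleton _)
  have h3 := h1.comp h2
  have hIm : Measurable[sig D {.len k}] (Set.indicator {ω | (D k ω).len = n} (1 : Ω → ℝ)) := h3
  have hIi : Integrable (Set.indicator {ω | (D k ω).len = n} (1 : Ω → ℝ)) Pr :=
    (integrable_const (1 : ℝ)).indicator hset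
  have hI2 : ∫ ω, Set.indicator {ω | (D k ω).len = n} (1 : Ω → ℝ) ω ∂Pr = 1 / (N : ℝ) := by
    rw [integral_indicator_one hset, measureReal_def, hD.law_len k n hn]
    simp
  exact integral_smul_of_indep (hD.indep_sig (Set.disjoint_singleton_left.mpr hT)) hIm hRm
    ⟨hIi, hI2⟩ hR

end IsSampling

namespace Standing

variable {μ : ℝ} {ℓf0 ℓf1 ℓg1 ℓg2 σf σg1 σg2 : ℝ≥0} [IsProbabilityMeasure Pr]

/-- The factors use distinct samples, so the mean of the product is the product of the means; the
last factor is split off at each step of the induction. -/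
lemma integral_neumannProd (h : Standing P μ ℓf0 ℓf1 ℓg1 ℓg2 σf σg1 σg2)
    (hD : IsSampling Pr P N D) (ℓ : ℝ) (x : Joint d q) (k n : ℕ) :
    Integrable (fun ω => neumannProd P ℓ (D k ω).zeta x n) Pr ∧
      ∫ ω, neumannProd P ℓ (D k ω).zeta x n ∂Pr = (1 - (1 / ℓ) • hessPhi P.meanG x) ^ n := by
  induction n with
  | zero => simp [neumannProd]
  | succ n ih =>
    have h3 := integral_const_sub_smul (1 : EuclideanSpace ℝ (Fin q) →L[ℝ] EuclideanSpace ℝ (Fin q))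
      (1 / ℓ) (hD.integral_comp_zeta (h.integral_hessPhi_g x) k (n + 1))
    let S : Set DrawIdx := {i | ∃ j < n, i = .zeta k (j + 1)}
    let T : Set DrawIdx := {.zeta k (n + 1)}
    have hdisj : Disjoint S T := by
      rw [Set.disjoint_singleton_right]
      rintro ⟨j, hj, hij⟩
      simp only [DrawIdx.zeta.injEq, true_and] at hij
      omega
    have hSm : Measurable[sig D S] fun ω => neumannProd P ℓ (D k ω).zeta x n :=
      h.reg.measurable_neumannProd ℓ (X := fun _ => x) measurable_const n
        fun i hi => measurable_zeta_sig ⟨i, hi, rfl⟩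
    have hTm : Measurable[sig D T] fun ω =>
        (1 : EuclideanSpace ℝ (Fin q) →L[ℝ] EuclideanSpace ℝ (Fin q))
          - (1 / ℓ) • hessPhi (fun y => P.g y ((D k ω).zeta (n + 1))) x :=
      measurable_const.sub ((h.reg.measurable_hessPhi_g (X := fun _ => x) measurable_const
        (measurable_zeta_sig (D := D) (S := T) rfl)).const_smul (1 / ℓ))
    have key := integral_clm_mul_of_indep (hD.indep_sig hdisj) hSm hTm ih h3
    rw [← pow_succ] at key
    simp only [neumannProd_succ]
    exact key

/-- The mean of the term of the update with a fixed number of factors. -/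
lemma integral_hypergradient_term (h : Standing P μ ℓf0 ℓf1 ℓg1 ℓg2 σf σg1 σg2)
    (hD : IsSampling Pr P N D) (ℓ : ℝ) (x : Joint d q) (k n : ℕ) :
    Integrable (fun ω => hessThetaPhi (fun y => P.g y ((D k ω).zeta 0)) x
        (neumannProd P ℓ (D k ω).zeta x n (gradPhi (fun y => P.f y (D k ω).xi) x))) Pr ∧
      ∫ ω, hessThetaPhi (fun y => P.g y ((D k ω).zeta 0)) x
        (neumannProd P ℓ (D k ω).zeta x n (gradPhi (fun y => P.f y (D k ω).xi) x)) ∂Pr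
        = hessThetaPhi P.meanG x
          (((1 - (1 / ℓ) • hessPhi P.meanG x) ^ n) (gradPhi P.meanF x)) := by
  -- Three disjoint groups of draws: `ζ^(0)` for the mixed block, `ζ^(1), …, ζ^(n)` for the factors,
  -- and `ξ`. The shift `j + 1` keeps the first two apart.
  let S0 : Set DrawIdx := {.zeta k 0}
  let S1 : Set DrawIdx := {i | ∃ j < n, i = .zeta k (j + 1)}
  let S2 : Set DrawIdx := {.xi k}
  have hmB : Measurable[sig D S0] fun ω => hessThetaPhi (fun y => P.g y ((D k ω).zeta 0)) x :=
    h.reg.measurable_hessThetaPhi_g (X := fun _ => x) measurable_const (measurable_zeta_sig rfl)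
  have hmP : Measurable[sig D S1] fun ω => neumannProd P ℓ (D k ω).zeta x n :=
    h.reg.measurable_neumannProd ℓ (X := fun _ => x) measurable_const n
      fun i hi => measurable_zeta_sig ⟨i, hi, rfl⟩
  have hma : Measurable[sig D S2] fun ω => gradPhi (fun y => P.f y (D k ω).xi) x :=
    h.reg.measurable_gradPhi_f (X := fun _ => x) measurable_const (measurable_xi_sig rfl)
  have hd1 : Disjoint S1 S2 := by
    rw [Set.disjoint_singleton_right]
    rintro ⟨j, hj, hij⟩
    simp at hij
  have hd2 : Disjoint S0 (S1 ∪ S2) := by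
    rw [Set.disjoint_singleton_left]
    rintro (⟨j, hj, hij⟩ | hij)
    · simp at hij
    · cases Set.mem_singleton_iff.mp hij
  have k1 := integral_clm_apply_of_indep (hD.indep_sig hd1) hmP hma
    (h.integral_neumannProd hD ℓ x k n) (hD.integral_comp_xi (h.integral_gradPhi_f x) k)
  have hmPa : Measurable[sig D (S1 ∪ S2)] fun ω =>
      neumannProd P ℓ (D k ω).zeta x n (gradPhi (fun y => P.f y (D k ω).xi) x) :=
    measurable_clm_apply (hmP.mono (sig_mono Set.subset_union_left) le_rfl)
      (hma.mono (sig_mono Set.subset_union_right) le_rfl)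
  exact integral_clm_apply_of_indep (hD.indep_sig hd2) hmB hmPa
    (hD.integral_comp_zeta (h.integral_hessThetaPhi_g x) k 0) k1

/-- The stochastic update at a fixed point estimates the truncated surrogate without bias. -/
lemma integral_update (h : Standing P μ ℓf0 ℓf1 ℓg1 ℓg2 σf σg1 σg2) (p : Params d q)
    (hD : IsSampling Pr P p.N D) (hN : 1 ≤ p.N) (x : Joint d q) (k : ℕ) :
    Integrable (fun ω => update P p (D k ω) x) Pr ∧
      ∫ ω, update P p (D k ω) x ∂Pr = truncSurrogate P p.ℓ p.N x := by
  have hN0 : (p.N : ℝ) ≠ 0 := by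
    have : p.N ≠ 0 := by omega
    exact_mod_cast this
  set R : ℕ → Ω → EuclideanSpace ℝ (Fin d) := fun n ω =>
    hessThetaPhi (fun y => P.g y ((D k ω).zeta 0)) x
      (neumannProd P p.ℓ (D k ω).zeta x n (gradPhi (fun y => P.f y (D k ω).xi) x)) with hR
  set I : ℕ → Ω → ℝ := fun n => Set.indicator {ω | (D k ω).len = n} 1 with hI
  have hterm : ∀ n < p.N, Integrable (fun ω => I n ω • R n ω) Pr ∧
      ∫ ω, I n ω • R n ω ∂Pr = (1 / (p.N : ℝ)) • hessThetaPhi P.meanG x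
        (((1 - (1 / p.ℓ) • hessPhi P.meanG x) ^ n) (gradPhi P.meanF x)) := fun n hn =>
    hD.integral_indicator_len_smul hn (T := {i | i = .xi k ∨ ∃ j, i = .zeta k j}) (by simp)
      (h.reg.measurable_hypergradient_term p.ℓ x k n)
      (h.integral_hypergradient_term hD p.ℓ x k n)
  -- The update is decomposed according to the value of the random length; almost surely exactly one
  -- indicator is nonzero.
  have hae : (fun ω => gradTheta (fun y => P.f y (D k ω).xi) x
      - ((p.N : ℝ) / p.ℓ) • ∑ n ∈ Finset.range p.N, I n ω • R n ω)
      =ᵐ[Pr] fun ω => update P p (D k ω) x := by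
    filter_upwards [hD.len_lt_ae hN k] with ω hω
    rw [update_eq, Finset.sum_eq_single_of_mem (D k ω).len (Finset.mem_range.mpr hω)]
    · simp [hI, hR]
    · intro n _ hn
      simp [hI, Set.indicator_of_notMem, Ne.symm hn]
  have key := integral_sub_smul_sum ((p.N : ℝ) / p.ℓ) (Finset.range p.N)
    (hD.integral_comp_xi (h.integral_gradTheta_f x) k) fun n hn => hterm n (Finset.mem_range.mp hn)
  refine ⟨key.1.congr hae, (integral_congr_ae hae).symm.trans (key.2.trans ?_)⟩
  -- The prefactor `N / ℓ` cancels the probability `1 / N` of each length, leaving the Neumann sum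
  -- with weight `1 / ℓ`.
  have e3 : (p.N : ℝ) / p.ℓ * (1 / (p.N : ℝ)) = 1 / p.ℓ := by field_simp
  rw [truncSurrogate, ← Finset.smul_sum, smul_smul, e3, smul_apply, sum_apply, map_smul, map_sum]

end Standing

end sampling

end Bilevel

namespace Bilevel

/-! ### Step sizes -/

section stepsizes

variable {d q : ℕ} (p : Params d q)

/-- The upper-level step size of iteration `k`. -/
noncomputable def Params.gam {d q : ℕ} (p : Params d q) (k : ℕ) : ℝ := p.stepUp (k + 1)

lemma Params.gam_eq (k : ℕ) : p.gam k = p.cUp / Real.sqrt (k + 1) := by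
  rw [gam, stepUp, Real.rpow_neg (by positivity), ← Real.sqrt_eq_rpow]
  push_cast
  rfl

variable {p}

lemma Params.gam_pos (hc : 0 < p.cUp) (k : ℕ) : 0 < p.gam k := by
  rw [p.gam_eq]; positivity

lemma Params.gam_antitone (hc : 0 < p.cUp) : Antitone p.gam := fun i j hij => by
  rw [p.gam_eq, p.gam_eq]
  have : (i : ℝ) ≤ j := by exact_mod_cast hij
  gcongr

lemma Params.gam_sq (k : ℕ) : p.gam k ^ 2 = p.cUp ^ 2 * ((k : ℝ) + 1)⁻¹ := by
  rw [p.gam_eq, div_pow, Real.sq_sqrt (by positivity), div_eq_mul_inv]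

/-- The quotient is `√((k + 1) / k) ≤ 2` for `k ≥ 1`; at `k = 0` truncated subtraction gives the
same step size on both sides. -/
lemma Params.gam_pred_le (hc : 0 < p.cUp) (k : ℕ) : p.gam (k - 1) ≤ 2 * p.gam k := by
  rw [p.gam_eq, p.gam_eq, ← mul_div_assoc, mul_comm (2 : ℝ), mul_div_assoc, div_eq_mul_one_div]
  refine mul_le_mul_of_nonneg_left ?_ hc.le
  rw [div_le_div_iff₀ (by positivity) (by positivity), one_mul,
    show (2 : ℝ) = Real.sqrt 4 by rw [show (4 : ℝ) = 2 ^ 2 by norm_num]; simp,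
    ← Real.sqrt_mul (by norm_num)]
  refine Real.sqrt_le_sqrt ?_
  cases k with
  | zero => norm_num
  | succ k => rw [Nat.add_sub_cancel]; push_cast; linarith [k.cast_nonneg (α := ℝ)]

lemma Params.gam_tendsto : Filter.Tendsto p.gam Filter.atTop (nhds 0) := by
  have h : Filter.Tendsto (fun k : ℕ => p.cUp / Real.sqrt ((k : ℝ) + 1)) Filter.atTop (nhds 0) :=
    Filter.Tendsto.const_div_atTop (Real.tendsto_sqrt_atTop.comp
      (Filter.tendsto_atTop_add_const_right _ _ tendsto_natCast_atTop_atTop)) _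
  exact h.congr fun k => (p.gam_eq k).symm

/-- Both step sizes decay like `n^(-1/2)`. The time scales are separated by a constant only, and the
whole proof depends on the size of this constant. -/
lemma Params.stepLow_eq (hc : 0 < p.cUp) (k : ℕ) :
    p.stepLow (k + 1) = p.cLow / (p.T * p.cUp) * p.gam k := by
  rw [stepLow, gam, stepUp]
  field_simp

lemma logBdd_gam_sq : LogBdd fun k => p.gam k ^ 2 :=
  (LogBdd.inv_succ.const_mul (sq_nonneg p.cUp)).mono fun k => (Params.gam_sq k).le

end stepsizes

/-! ### Diagonal preconditioners -/

section diagonal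

variable {d : ℕ}

/-- Multiplication by a diagonal matrix. -/
noncomputable def diagMul (a : Fin d → ℝ) (v : EuclideanSpace ℝ (Fin d)) :
    EuclideanSpace ℝ (Fin d) := WithLp.toLp 2 fun i => a i * v i

@[simp] lemma diagMul_apply (a : Fin d → ℝ) (v : EuclideanSpace ℝ (Fin d)) (i : Fin d) :
    diagMul a v i = a i * v i := rfl

lemma norm_diagMul_le {a : Fin d → ℝ} {c : ℝ} (hc : 0 ≤ c) (ha : ∀ i, |a i| ≤ c)
    (v : EuclideanSpace ℝ (Fin d)) : ‖diagMul a v‖ ≤ c * ‖v‖ := by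
  refine le_of_sq_le_sq ?_ (by positivity)
  rw [mul_pow, EuclideanSpace.norm_sq_eq, EuclideanSpace.norm_sq_eq, Finset.mul_sum]
  refine Finset.sum_le_sum fun i _ => ?_
  rw [diagMul_apply, norm_mul, mul_pow]
  exact mul_le_mul_of_nonneg_right (pow_le_pow_left₀ (norm_nonneg _) (ha i) 2) (sq_nonneg _)

/-- The trace is a wasteful bound for the operator norm, but unlike the maximum it is additive and
therefore telescopes. -/
lemma norm_diagMul_le_sum {a : Fin d → ℝ} (ha : ∀ i, 0 ≤ a i) (v : EuclideanSpace ℝ (Fin d)) :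
    ‖diagMul a v‖ ≤ (∑ i, a i) * ‖v‖ :=
  norm_diagMul_le (Finset.sum_nonneg fun i _ => ha i) (fun i => by
    rw [abs_of_nonneg (ha i)]
    exact Finset.single_le_sum (fun j _ => ha j) (Finset.mem_univ i)) v

lemma inner_diagMul (a : Fin d → ℝ) (v w : EuclideanSpace ℝ (Fin d)) :
    inner ℝ (diagMul a v) w = inner ℝ v (diagMul a w) := by
  simp only [PiLp.inner_apply, diagMul_apply, RCLike.inner_apply, conj_trivial]
  exact Finset.sum_congr rfl fun i _ => by ring

lemma measurable_diagMul {α : Type*} {mα : MeasurableSpace α} {a : α → Fin d → ℝ}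
    {v : α → EuclideanSpace ℝ (Fin d)} (ha : ∀ i, Measurable fun ω => a ω i) (hv : Measurable v) :
    Measurable fun ω => diagMul (a ω) (v ω) := by
  have h : Measurable fun ω => fun i => a ω i * v ω i := measurable_pi_lambda _ fun i =>
    (ha i).mul ((measurable_pi_apply i).comp ((WithLp.measurable_ofLp 2 _).comp hv))
  exact (WithLp.measurable_toLp 2 _).comp h

end diagonal

/-! ### Removal of the momentum along trajectories -/

section pathwise

variable {d q : ℕ} {Ξ Z : Type*} [MeasurableSpace Ξ] [MeasurableSpace Z]

/-- The diagonal of the preconditioner `(δ + V̂)^(-1/2)` stored in a state. -/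
noncomputable def precond (p : Params d q) (S : State d q) : Fin d → ℝ :=
  fun i => (p.δ + S.Vhat i) ^ (-(1 / 2) : ℝ)

/-- The auxiliary iterate `z_k = θ_k - ρ₁ / (1 - ρ₁) γ A m` that removes the momentum. -/
noncomputable def auxPoint (p : Params d q) (k : ℕ) (S : State d q) :
    EuclideanSpace ℝ (Fin d) :=
  S.θ - (p.ρ₁ / (1 - p.ρ₁) * p.gam (k - 1)) • diagMul (precond p S) S.m

/-- The decrease of `γ A` over one iteration, summed over the coordinates. -/
noncomputable def decrease (p : Params d q) (k : ℕ) (S S' : State d q) : ℝ :=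
  ∑ i, (p.gam (k - 1) * precond p S i - p.gam k * precond p S' i)

lemma step_θ (P : Problem d q Ξ Z) (p : Params d q) (D : Draws Ξ Z) (k : ℕ) (S : State d q) :
    (step P p D k S).θ
      = S.θ - p.gam k • diagMul (precond p (step P p D k S)) (step P p D k S).m := by
  have : WithLp.toLp 2 ((adaptiveMatrix p (stateUpdate P p D k S) S).mulVec
      (nextM p (stateUpdate P p D k S) S).ofLp)
      = diagMul (precond p (step P p D k S)) (step P p D k S).m := by
    ext i
    simp only [adaptiveMatrix, Matrix.mulVec_diagonal]
    rfl
  rw [← this]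
  rfl

/-- As `1 + ρ₁ / (1 - ρ₁) = 1 / (1 - ρ₁)`, the recursion for `m` turns the movement of the auxiliary
point into a step along `A_k H_k` plus `m_{k-1}` multiplied by the difference of consecutive `γ A`.
Trading `A_k` for the earlier `A_{k-1}`, which does not depend on the current draws, costs the first
term on the right. -/
lemma auxPoint_step (P : Problem d q Ξ Z) (p : Params d q) (hρ : p.ρ₁ < 1) (D : Draws Ξ Z) (k : ℕ)
    (S : State d q) :
    auxPoint p (k + 1) (step P p D k S) - auxPoint p k S
        + p.gam k • diagMul (precond p S) (stateUpdate P p D k S)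
      = p.gam k • diagMul (fun i => precond p S i - precond p (step P p D k S) i)
          (stateUpdate P p D k S)
        + (p.ρ₁ / (1 - p.ρ₁)) • diagMul (fun i => p.gam (k - 1) * precond p S i
          - p.gam k * precond p (step P p D k S) i) S.m := by
  have h1 : 1 - p.ρ₁ ≠ 0 := by linarith
  have hm : ∀ i, (step P p D k S).m i = p.ρ₁ * S.m i + (1 - p.ρ₁) * stateUpdate P p D k S i :=
    fun i => by simp [step, nextM]
  ext i
  simp only [auxPoint, step_θ, Nat.add_sub_cancel, PiLp.add_apply, PiLp.sub_apply,
    PiLp.smul_apply, diagMul_apply, smul_eq_mul, hm]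
  field_simp
  ring

/-- Pathwise invariants of the moments when all updates are bounded by `M`. -/
lemma state_invariants {P : Problem d q Ξ Z} {p : Params d q} (hρ₁ : p.ρ₁ ∈ Set.Ico (0 : ℝ) 1)
    (hρ₂ : p.ρ₂ ∈ Set.Ico (0 : ℝ) 1) {M : ℝ} {D : ℕ → Draws Ξ Z}
    (hH : ∀ k, ‖stateUpdate P p (D k) k (state P p D k)‖ ≤ M) (k : ℕ) :
    ‖(state P p D k).m‖ ≤ M ∧ ∀ i, (state P p D k).V i i ≤ M ^ 2 ∧
      0 ≤ (state P p D k).Vhat i ∧ (state P p D k).Vhat i ≤ M ^ 2 := by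
  have hM : 0 ≤ M := (norm_nonneg _).trans (hH 0)
  induction k with
  | zero => exact ⟨by simpa [state] using hM, fun i => ⟨by simpa [state] using sq_nonneg M,
      by simp [state], by simpa [state] using sq_nonneg M⟩⟩
  | succ k ih =>
    obtain ⟨ihm, ihV⟩ := ih
    set S := state P p D k
    set H := stateUpdate P p (D k) k S with hHdef
    have hS : state P p D (k + 1) = step P p (D k) k S := rfl
    rw [hS]
    have hV : ∀ i, (step P p (D k) k S).V i i ≤ M ^ 2 := fun i => by
      have e : (step P p (D k) k S).V i i = p.ρ₂ * S.V i i + (1 - p.ρ₂) * (H i * H i) := by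
        simp [step, nextV, Matrix.vecMulVec_apply, hHdef]
      have hHi : H i * H i ≤ M ^ 2 := by
        have h1 : |H i| ≤ M := (PiLp.norm_apply_le H i).trans (hH k)
        rw [← sq, ← sq_abs]
        exact pow_le_pow_left₀ (abs_nonneg _) h1 2
      rw [e]
      have h1 := mul_le_mul_of_nonneg_left (ihV i).1 hρ₂.1
      have h2 := mul_le_mul_of_nonneg_left hHi (sub_nonneg.mpr hρ₂.2.le)
      linarith
    refine ⟨?_, fun i => ⟨hV i, (ihV i).2.1.trans (le_max_left _ _), max_le (ihV i).2.2 (hV i)⟩⟩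
    have e : (step P p (D k) k S).m = p.ρ₁ • S.m + (1 - p.ρ₁) • H := rfl
    rw [e]
    refine (norm_add_le _ _).trans ?_
    rw [norm_smul, norm_smul, Real.norm_of_nonneg hρ₁.1,
      Real.norm_of_nonneg (sub_nonneg.mpr hρ₁.2.le)]
    have h1 := mul_le_mul_of_nonneg_left ihm hρ₁.1
    have h2 := mul_le_mul_of_nonneg_left (hH k) (sub_nonneg.mpr hρ₁.2.le)
    linarith

lemma precond_le {p : Params d q} (hδ : 0 < p.δ) {S : State d q} (hS : ∀ i, 0 ≤ S.Vhat i)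
    (i : Fin d) : precond p S i ≤ p.δ ^ (-(1 / 2) : ℝ) :=
  Real.rpow_le_rpow_of_nonpos hδ (by linarith [hS i]) (by norm_num)

lemma le_precond {p : Params d q} (hδ : 0 < p.δ) {S : State d q} (hS : ∀ i, 0 ≤ S.Vhat i) {M : ℝ}
    (hM : ∀ i, S.Vhat i ≤ M ^ 2) (i : Fin d) :
    (p.δ + M ^ 2) ^ (-(1 / 2) : ℝ) ≤ precond p S i :=
  Real.rpow_le_rpow_of_nonpos (by linarith [hS i]) (by linarith [hM i]) (by norm_num)

lemma precond_step_le {P : Problem d q Ξ Z} {p : Params d q} (hδ : 0 < p.δ) (D : Draws Ξ Z) (k : ℕ)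
    {S : State d q} (hS : ∀ i, 0 ≤ S.Vhat i) (i : Fin d) :
    precond p (step P p D k S) i ≤ precond p S i := by
  have h : S.Vhat i ≤ (step P p D k S).Vhat i := le_max_left _ _
  exact Real.rpow_le_rpow_of_nonpos (by linarith [hS i]) (by linarith) (by norm_num)

/-- Pathwise estimates for the auxiliary iterates. -/
lemma exists_pathwise_bound {p : Params d q} (hρ₁ : p.ρ₁ ∈ Set.Ico (0 : ℝ) 1)
    (hρ₂ : p.ρ₂ ∈ Set.Ico (0 : ℝ) 1) (hδ : 0 < p.δ) (hc : 0 < p.cUp) (M : ℝ) :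
    ∃ C : ℝ, 0 ≤ C ∧ ∀ (P : Problem d q Ξ Z) (D : ℕ → Draws Ξ Z),
      (∀ k, ‖stateUpdate P p (D k) k (state P p D k)‖ ≤ M) →
      (∀ k, ‖(state P p D k).θ - auxPoint p k (state P p D k)‖ ≤ C * p.gam k ∧
        ‖auxPoint p (k + 1) (state P p D (k + 1)) - auxPoint p k (state P p D k)
          + p.gam k • diagMul (precond p (state P p D k))
            (stateUpdate P p (D k) k (state P p D k))‖
          ≤ C * decrease p k (state P p D k) (state P p D (k + 1)) ∧
        0 ≤ decrease p k (state P p D k) (state P p D (k + 1)) ∧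
        decrease p k (state P p D k) (state P p D (k + 1)) ≤ C * p.gam k ∧
        ‖auxPoint p (k + 1) (state P p D (k + 1)) - auxPoint p k (state P p D k)‖
          ≤ C * p.gam k) ∧
      ∀ n, ∑ k ∈ Finset.range n, decrease p k (state P p D k) (state P p D (k + 1)) ≤ C := by
  set s := p.δ ^ (-(1 / 2) : ℝ) with hs
  have hs0 : 0 < s := Real.rpow_pos_of_pos hδ _
  set c := p.ρ₁ / (1 - p.ρ₁) with hcdef
  have hc0 : 0 ≤ c := div_nonneg hρ₁.1 (sub_nonneg.mpr hρ₁.2.le)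
  -- The absolute value of `M` keeps the constants nonnegative before a trajectory is given that
  -- forces `0 ≤ M`.
  set C1 := c * (2 * (s * |M|)) with hC1
  set C2 := (1 + c) * |M| with hC2
  set C3 := (d : ℝ) * (2 * s) with hC3
  set C4 := (d : ℝ) * (p.gam 0 * s) with hC4
  have hg := Params.gam_pos (p := p) hc
  have h1 : 0 ≤ C1 := by positivity
  have h2 : 0 ≤ C2 := by positivity
  have h3 : 0 ≤ C3 := by positivity
  have h4 : 0 ≤ C4 := mul_nonneg (by positivity) (mul_nonneg (hg 0).le hs0.le)
  have h5 : 0 ≤ C2 * C3 + s * |M| := by positivity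
  refine ⟨C1 + C2 + C3 + C4 + (C2 * C3 + s * |M|), by positivity, fun P D hH => ?_⟩
  have hM : 0 ≤ M := (norm_nonneg _).trans (hH 0)
  rw [abs_of_nonneg hM] at *
  have inv := state_invariants hρ₁ hρ₂ hH
  have hpos : ∀ k i, 0 < precond p (state P p D k) i := fun k i =>
    Real.rpow_pos_of_pos (by linarith [((inv k).2 i).2.1]) _
  have hle : ∀ k i, precond p (state P p D k) i ≤ s := fun k i =>
    precond_le hδ (fun i => ((inv k).2 i).2.1) i
  have hmono : ∀ k i, precond p (state P p D (k + 1)) i ≤ precond p (state P p D k) i :=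
    fun k i => precond_step_le hδ _ _ (fun i => ((inv k).2 i).2.1) i
  -- Both `γ` and `A` decrease, so the decrease of the product dominates `γ (A_{k-1} - A_k)`. One
  -- quantity thus controls both error terms of `auxPoint_step`.
  have hterm : ∀ k i, p.gam k * (precond p (state P p D k) i - precond p (state P p D (k + 1)) i)
      ≤ p.gam (k - 1) * precond p (state P p D k) i
        - p.gam k * precond p (state P p D (k + 1)) i := fun k i => by
    have := mul_le_mul_of_nonneg_right (Params.gam_antitone hc (Nat.sub_le k 1)) (hpos k i).le
    linarith
  have hterm0 : ∀ k i, 0 ≤ p.gam (k - 1) * precond p (state P p D k) i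
        - p.gam k * precond p (state P p D (k + 1)) i := fun k i =>
    (mul_nonneg (hg k).le (sub_nonneg.mpr (hmono k i))).trans (hterm k i)
  have hdec0 : ∀ k, 0 ≤ decrease p k (state P p D k) (state P p D (k + 1)) := fun k =>
    Finset.sum_nonneg fun i _ => hterm0 k i
  have hdec : ∀ k, decrease p k (state P p D k) (state P p D (k + 1)) ≤ C3 * p.gam k := fun k => by
    have : ∀ i ∈ (Finset.univ : Finset (Fin d)), p.gam (k - 1) * precond p (state P p D k) i
        - p.gam k * precond p (state P p D (k + 1)) i ≤ 2 * s * p.gam k := fun i _ => by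
      have e1 := mul_nonneg (hg k).le (hpos (k + 1) i).le
      have e2 := mul_le_mul (Params.gam_pred_le hc k) (hle k i) (hpos k i).le
        (mul_nonneg zero_le_two (hg k).le)
      linarith
    refine (Finset.sum_le_card_nsmul _ _ _ this).trans (le_of_eq ?_)
    simp [hC3]; ring
  have hrem : ∀ k, ‖auxPoint p (k + 1) (state P p D (k + 1)) - auxPoint p k (state P p D k)
      + p.gam k • diagMul (precond p (state P p D k)) (stateUpdate P p (D k) k (state P p D k))‖
      ≤ C2 * decrease p k (state P p D k) (state P p D (k + 1)) := fun k => by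
    have e := auxPoint_step P p hρ₁.2 (D k) k (state P p D k)
    change ‖auxPoint p (k + 1) (step P p (D k) k (state P p D k)) - _ + _‖ ≤ _
    rw [e]
    set τ := decrease p k (state P p D k) (state P p D (k + 1)) with hτ
    refine (norm_add_le _ _).trans ?_
    have e1 : ‖p.gam k • diagMul (fun i => precond p (state P p D k) i
        - precond p (step P p (D k) k (state P p D k)) i)
        (stateUpdate P p (D k) k (state P p D k))‖ ≤ τ * M := by
      rw [norm_smul, Real.norm_of_nonneg (hg k).le]
      refine (mul_le_mul_of_nonneg_left (norm_diagMul_le_sum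
        (fun i => sub_nonneg.mpr (hmono k i)) _) (hg k).le).trans ?_
      rw [← mul_assoc, Finset.mul_sum]
      exact mul_le_mul (Finset.sum_le_sum fun i _ => hterm k i) (hH k) (norm_nonneg _) (hdec0 k)
    have e2 : ‖c • diagMul (fun i => p.gam (k - 1) * precond p (state P p D k) i
        - p.gam k * precond p (step P p (D k) k (state P p D k)) i) (state P p D k).m‖
        ≤ c * (τ * M) := by
      rw [norm_smul, Real.norm_of_nonneg hc0]
      refine mul_le_mul_of_nonneg_left ?_ hc0
      refine (norm_diagMul_le_sum (hterm0 k) _).trans ?_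
      exact mul_le_mul_of_nonneg_left (inv k).1 (hdec0 k)
    refine (add_le_add e1 e2).trans (le_of_eq ?_)
    rw [hC2]; ring
  have hup : ∀ k, ‖p.gam k • diagMul (precond p (state P p D k))
      (stateUpdate P p (D k) k (state P p D k))‖ ≤ s * M * p.gam k := fun k => by
    rw [norm_smul, Real.norm_of_nonneg (hg k).le, mul_comm]
    refine mul_le_mul_of_nonneg_right ?_ (hg k).le
    refine (norm_diagMul_le hs0.le (fun i => ?_) _).trans
      (mul_le_mul_of_nonneg_left (hH k) hs0.le)
    rw [abs_of_pos (hpos k i)]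
    exact hle k i
  refine ⟨fun k => ⟨?_, ?_, hdec0 k, ?_, ?_⟩, fun n => ?_⟩
  · have e : (state P p D k).θ - auxPoint p k (state P p D k)
        = (c * p.gam (k - 1)) • diagMul (precond p (state P p D k)) (state P p D k).m := by
      rw [auxPoint, sub_sub_cancel]
    rw [e, norm_smul, Real.norm_of_nonneg (mul_nonneg hc0 (hg _).le)]
    have e1 : ‖diagMul (precond p (state P p D k)) (state P p D k).m‖ ≤ s * M := by
      refine (norm_diagMul_le hs0.le (fun i => ?_) _).trans
        (mul_le_mul_of_nonneg_left (inv k).1 hs0.le)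
      rw [abs_of_pos (hpos k i)]
      exact hle k i
    have e2 : c * p.gam (k - 1) ≤ c * (2 * p.gam k) :=
      mul_le_mul_of_nonneg_left (Params.gam_pred_le hc k) hc0
    refine (mul_le_mul e2 e1 (norm_nonneg _)
      (mul_nonneg hc0 (mul_nonneg zero_le_two (hg k).le))).trans ?_
    have e3 : c * (2 * p.gam k) * (s * M) = C1 * p.gam k := by rw [hC1]; ring
    rw [e3]
    exact mul_le_mul_of_nonneg_right (by linarith) (hg k).le
  · exact (hrem k).trans (mul_le_mul_of_nonneg_right (by linarith) (hdec0 k))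
  · exact (hdec k).trans (mul_le_mul_of_nonneg_right (by linarith) (hg k).le)
  · have e1 := norm_sub_le (auxPoint p (k + 1) (state P p D (k + 1))
      - auxPoint p k (state P p D k) + p.gam k • diagMul (precond p (state P p D k))
        (stateUpdate P p (D k) k (state P p D k)))
      (p.gam k • diagMul (precond p (state P p D k)) (stateUpdate P p (D k) k (state P p D k)))
    rw [add_sub_cancel_right] at e1
    have e2 := mul_le_mul_of_nonneg_left (hdec k) h2
    have e3 : 0 ≤ (C1 + C2 + C3 + C4) * p.gam k := mul_nonneg (by positivity) (hg k).le
    have e4 := hrem k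
    have e5 := hup k
    nlinarith
  -- Written with `k + 1 - 1`, the decrease is a difference of consecutive values of one sequence,
  -- the trace of `γ A`; its sum is at most the initial value.
  · have e1 : ∀ k, decrease p k (state P p D k) (state P p D (k + 1))
        = ∑ i, p.gam (k - 1) * precond p (state P p D k) i
          - ∑ i, p.gam (k + 1 - 1) * precond p (state P p D (k + 1)) i := fun k => by
      rw [decrease, Finset.sum_sub_distrib, Nat.add_sub_cancel]
    simp only [e1]
    rw [Finset.sum_range_sub' (fun k => ∑ i, p.gam (k - 1) * precond p (state P p D k) i)]
    have e2 : 0 ≤ ∑ i, p.gam (n - 1) * precond p (state P p D n) i :=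
      Finset.sum_nonneg fun i _ => mul_nonneg (hg _).le (hpos n i).le
    have e3 : ∑ i, p.gam (0 - 1) * precond p (state P p D 0) i ≤ C4 := by
      have : ∀ i ∈ (Finset.univ : Finset (Fin d)), p.gam (0 - 1) * precond p (state P p D 0) i
          ≤ p.gam 0 * s := fun i _ => mul_le_mul_of_nonneg_left (hle 0 i) (hg 0).le
      refine (Finset.sum_le_card_nsmul _ _ _ this).trans (le_of_eq ?_)
      simp [hC4]
    linarith

end pathwise

end Bilevel

namespace Bilevel

/-! ### Dependence on the past and the conditional mean of the update -/

/-- The iteration to which a draw belongs. -/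
def DrawIdx.iter : DrawIdx → ℕ
  | .xi k => k
  | .zeta k _ => k
  | .inner k _ => k
  | .len k => k

/-- The draws of the iterations before `k`. -/
def pastDraws (k : ℕ) : Set DrawIdx := {i | i.iter < k}

/-- The draws of the iterations before `k` and of the first `t` inner steps of iteration `k`. -/
def innerDraws (k t : ℕ) : Set DrawIdx := {i | i.iter < k ∨ ∃ s < t, i = .inner k s}

/-- Conditional means may be inserted in an inner product with a vector that is known. -/
lemma integral_inner_freeze {Ω α β E : Type*} {m₁ m₂ mΩ : MeasurableSpace Ω} {ν : Measure Ω}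
    [IsProbabilityMeasure ν] [MeasurableSpace α] [MeasurableSpace β] [NormedAddCommGroup E]
    [InnerProductSpace ℝ E] [CompleteSpace E] [MeasurableSpace E] [BorelSpace E]
    [SecondCountableTopology E] (h : Indep m₁ m₂ ν) (h₁ : m₁ ≤ mΩ) (h₂ : m₂ ≤ mΩ) {w : Ω → E}
    {X : Ω → α} {Y : Ω → β} (hw : Measurable[m₁] w) (hX : Measurable[m₁] X)
    (hY : Measurable[m₂] Y) {U : α → β → E} (hU : Measurable (Function.uncurry U)) {m : α → E}
    (hm : ∀ x, Integrable (fun ω => U x (Y ω)) ν ∧ ∫ ω, U x (Y ω) ∂ν = m x)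
    (hi : Integrable (fun ω => inner ℝ (w ω) (U (X ω) (Y ω))) ν) :
    ∫ ω, inner ℝ (w ω) (U (X ω) (Y ω)) ∂ν = ∫ ω, inner ℝ (w ω) (m (X ω)) ∂ν := by
  have hF : Measurable (Function.uncurry fun (a : E × α) (y : β) =>
      (inner ℝ a.1 (U a.2 y) : ℝ)) := by
    have e1 : Measurable fun b : (E × α) × β => b.1.1 := measurable_fst.comp measurable_fst
    have e2 : Measurable fun b : (E × α) × β => U b.1.2 b.2 :=
      hU.comp ((measurable_snd.comp measurable_fst).prodMk measurable_snd)
    exact Measurable.inner (𝕜 := ℝ) e1 e2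
  have key := integral_freeze h h₁ h₂ (hw.prodMk hX) hY hF.stronglyMeasurable hi
  refine key.trans (integral_congr_ae (Filter.Eventually.of_forall fun ω' => ?_))
  have h3 := integral_inner (𝕜 := ℝ) (hm (X ω')).1 (w ω')
  rw [(hm (X ω')).2] at h3
  exact h3

section measurability

variable {d q : ℕ} {Ξ Z : Type*} [MeasurableSpace Ξ] [MeasurableSpace Z] {P : Problem d q Ξ Z}
  {α : Type*}

/-- Measurability of a random state, componentwise. -/
structure StateMeasurable (mα : MeasurableSpace α) (S : α → State d q) : Prop where
  θ : Measurable fun a => (S a).θ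
  φ : Measurable fun a => (S a).φ
  m : Measurable fun a => (S a).m
  V : ∀ i j, Measurable fun a => (S a).V i j
  Vhat : ∀ i, Measurable fun a => (S a).Vhat i

variable {mα : MeasurableSpace α}

lemma measurable_pt {θ : α → EuclideanSpace ℝ (Fin d)} {φ : α → EuclideanSpace ℝ (Fin q)}
    (hθ : Measurable θ) (hφ : Measurable φ) : Measurable fun a => pt (θ a) (φ a) :=
  continuous_pt.measurable.comp (hθ.prodMk hφ)

lemma Problem.Regular.measurable_innerSGD (h : P.Regular) (η : ℝ)
    {θ : α → EuclideanSpace ℝ (Fin d)} {φ : α → EuclideanSpace ℝ (Fin q)} {ζ : α → ℕ → Z}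
    (hθ : Measurable θ) (hφ : Measurable φ) (t : ℕ) (hζ : ∀ s < t, Measurable fun a => ζ a s) :
    Measurable fun a => innerSGD P η (θ a) (ζ a) (φ a) t := by
  induction t with
  | zero => exact hφ
  | succ t ih =>
    have h1 := ih fun s hs => hζ s (hs.trans (Nat.lt_succ_self t))
    have h2 := (h.measurable_gradPhi_g (measurable_pt hθ h1)
      (hζ t (Nat.lt_succ_self t))).const_smul η
    exact h1.sub h2

lemma StateMeasurable.step (h : P.Regular) (p : Params d q) (k : ℕ) {S : α → State d q}
    (hS : StateMeasurable mα S) {D : α → Draws Ξ Z} (hξ : Measurable fun a => (D a).xi)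
    (hζ : ∀ i, Measurable fun a => (D a).zeta i) (hi : ∀ i, Measurable fun a => (D a).inner i)
    (hn : Measurable fun a => (D a).len) :
    StateMeasurable mα fun a => Bilevel.step P p (D a) k (S a) := by
  have hφ : Measurable fun a => nextPhi P p (D a) k (S a) :=
    h.measurable_innerSGD _ hS.θ hS.φ p.T fun s _ => hi s
  have hH : Measurable fun a => stateUpdate P p (D a) k (S a) :=
    h.measurable_update p (measurable_pt hS.θ hφ) hξ hζ hn
  have hHi : ∀ i, Measurable fun a => stateUpdate P p (D a) k (S a) i := fun i =>
    (measurable_pi_apply i).comp ((WithLp.measurable_ofLp 2 _).comp hH)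
  have hm : Measurable fun a => (Bilevel.step P p (D a) k (S a)).m :=
    (hS.m.const_smul p.ρ₁).add (hH.const_smul (1 - p.ρ₁))
  have hV : ∀ i j, Measurable fun a => (Bilevel.step P p (D a) k (S a)).V i j := fun i j => by
    have e : ∀ a, (Bilevel.step P p (D a) k (S a)).V i j = p.ρ₂ * (S a).V i j
        + (1 - p.ρ₂) * (stateUpdate P p (D a) k (S a) i * stateUpdate P p (D a) k (S a) j) :=
      fun a => by simp [Bilevel.step, nextV, Matrix.vecMulVec_apply]
    simp only [e]
    exact ((hS.V i j).const_mul _).add (((hHi i).mul (hHi j)).const_mul _)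
  have hVh : ∀ i, Measurable fun a => (Bilevel.step P p (D a) k (S a)).Vhat i := fun i =>
    (hS.Vhat i).max (hV i i)
  refine ⟨?_, hφ, hm, hV, hVh⟩
  simp only [step_θ]
  exact hS.θ.sub ((measurable_diagMul (fun i => ((hVh i).const_add p.δ).pow_const _) hm).const_smul
    (p.gam k))

variable {Ω : Type*} {D : ℕ → Ω → Draws Ξ Z}

/-- Iteration `k` is a measurable function of the previous state and of the draws with index `k`, so
the induction adds one generation of draws at a time. -/
lemma Problem.Regular.stateMeasurable (h : P.Regular) (p : Params d q) (k : ℕ) :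
    StateMeasurable (sig D (pastDraws k)) fun ω => state P p (fun j => D j ω) k := by
  induction k with
  | zero =>
    exact ⟨measurable_const, measurable_const, measurable_const, fun _ _ => measurable_const,
      fun _ => measurable_const⟩
  | succ k ih =>
    have hle : sig D (pastDraws k) ≤ sig D (pastDraws (k + 1)) :=
      sig_mono fun i hi => Nat.lt_succ_of_lt hi
    have ih' : StateMeasurable (sig D (pastDraws (k + 1)))
        fun ω => state P p (fun j => D j ω) k :=
      ⟨ih.θ.mono hle le_rfl, ih.φ.mono hle le_rfl, ih.m.mono hle le_rfl,
        fun i j => (ih.V i j).mono hle le_rfl, fun i => (ih.Vhat i).mono hle le_rfl⟩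
    exact ih'.step h p k (measurable_xi_sig (Nat.lt_succ_self k))
      (fun i => measurable_zeta_sig (Nat.lt_succ_self k))
      (fun i => measurable_inner_sig (Nat.lt_succ_self k))
      (measurable_len_sig (Nat.lt_succ_self k))

end measurability

section process

variable {d q : ℕ} {Ξ Z Ω : Type*} [MeasurableSpace Ξ] [MeasurableSpace Z]

/-- The auxiliary iterate `z_k` as a random vector. -/
noncomputable def auxAt (P : Problem d q Ξ Z) (p : Params d q) (D : ℕ → Ω → Draws Ξ Z) (k : ℕ)
    (ω : Ω) : EuclideanSpace ℝ (Fin d) := auxPoint p k (state P p (fun j => D j ω) k)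

/-- The lower-level error `φ_k - φ*(z_k)` at the start of iteration `k`. -/
noncomputable def startErr (P : Problem d q Ξ Z) (p : Params d q) (D : ℕ → Ω → Draws Ξ Z) (k : ℕ)
    (ω : Ω) : EuclideanSpace ℝ (Fin q) :=
  (state P p (fun j => D j ω) k).φ - P.lowerSol (auxAt P p D k ω)

/-- The lower-level error `φ_{k+1} - φ*(z_k)` after the inner loop of iteration `k`. -/
noncomputable def endErr (P : Problem d q Ξ Z) (p : Params d q) (D : ℕ → Ω → Draws Ξ Z) (k : ℕ)
    (ω : Ω) : EuclideanSpace ℝ (Fin q) :=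
  (state P p (fun j => D j ω) (k + 1)).φ - P.lowerSol (auxAt P p D k ω)

/-- The point `(θ_k, φ_{k+1})`. -/
noncomputable def evalPt (P : Problem d q Ξ Z) (p : Params d q) (D : ℕ → Ω → Draws Ξ Z) (k : ℕ)
    (ω : Ω) : Joint d q :=
  pt (state P p (fun j => D j ω) k).θ (state P p (fun j => D j ω) (k + 1)).φ

/-- The preconditioner `A_{k-1}` as a random vector. -/
noncomputable def precondAt (P : Problem d q Ξ Z) (p : Params d q) (D : ℕ → Ω → Draws Ξ Z) (k : ℕ)
    (ω : Ω) : Fin d → ℝ := precond p (state P p (fun j => D j ω) k)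

/-- The decrease of `γ A` in iteration `k` as a random variable. -/
noncomputable def decreaseAt (P : Problem d q Ξ Z) (p : Params d q) (D : ℕ → Ω → Draws Ξ Z) (k : ℕ)
    (ω : Ω) : ℝ :=
  decrease p k (state P p (fun j => D j ω) k) (state P p (fun j => D j ω) (k + 1))

/-- The setting of the convergence theorem. -/
structure Setup [MeasurableSpace Ω] (Pr : Measure Ω) (P : Problem d q Ξ Z) (p : Params d q)
    (D : ℕ → Ω → Draws Ξ Z) (μ : ℝ) (ℓf0 ℓf1 ℓg1 ℓg2 σf σg1 σg2 : ℝ≥0) (M : ℝ) : Prop where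
  standing : Standing P μ ℓf0 ℓf1 ℓg1 ℓg2 σf σg1 σg2
  sampling : IsSampling Pr P p.N D
  ell : p.ℓ = ℓg1
  one_le_N : 1 ≤ p.N
  one_le_T : 1 ≤ p.T
  rho₁ : p.ρ₁ ∈ Set.Ico (0 : ℝ) 1
  rho₂ : p.ρ₂ ∈ Set.Ico (0 : ℝ) 1
  delta_pos : 0 < p.δ
  cUp_pos : 0 < p.cUp
  cLow_pos : 0 < p.cLow
  bound : ∀ k, ∀ᵐ ω ∂Pr, ‖updateAt P p D k ω‖ ≤ M

namespace Setup

lemma past_le_inner (D : ℕ → Ω → Draws Ξ Z) (k t : ℕ) :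
    sig D (pastDraws k) ≤ sig D (innerDraws k t) :=
  sig_mono fun _ hi => Or.inl hi

variable [mΩ : MeasurableSpace Ω] {Pr : Measure Ω} {P : Problem d q Ξ Z} {p : Params d q}
  {D : ℕ → Ω → Draws Ξ Z} {μ : ℝ} {ℓf0 ℓf1 ℓg1 ℓg2 σf σg1 σg2 : ℝ≥0} {M : ℝ}

/-- Only the momentum and the preconditioner stored before iteration `k` enter, hence the point is
independent of every draw of that iteration, the inner loop included. -/
lemma measurable_auxAt_past (s : Setup Pr P p D μ ℓf0 ℓf1 ℓg1 ℓg2 σf σg1 σg2 M) (k : ℕ) :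
    Measurable[sig D (pastDraws k)] (auxAt P p D k) := by
  have h := s.standing.reg.stateMeasurable (D := D) p k
  have h1 : ∀ i, Measurable[sig D (pastDraws k)] fun ω =>
      precond p (state P p (fun j => D j ω) k) i :=
    fun i => ((h.Vhat i).const_add p.δ).pow_const _
  have h2 := (measurable_diagMul h1 h.m).const_smul (p.ρ₁ / (1 - p.ρ₁) * p.gam (k - 1))
  exact h.θ.sub h2

lemma measurable_lowerSol (s : Setup Pr P p D μ ℓf0 ℓf1 ℓg1 ℓg2 σf σg1 σg2 M) :
    Measurable P.lowerSol := s.standing.continuous_lowerSol.measurable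

lemma measurable_innerSGD_draws (s : Setup Pr P p D μ ℓf0 ℓf1 ℓg1 ℓg2 σf σg1 σg2 M) (η : ℝ)
    (k t : ℕ) :
    Measurable[sig D (innerDraws k t)] fun ω =>
      innerSGD P η (state P p (fun j => D j ω) k).θ (D k ω).inner
        (state P p (fun j => D j ω) k).φ t := by
  have h := s.standing.reg.stateMeasurable (D := D) p k
  exact s.standing.reg.measurable_innerSGD η (h.θ.mono (past_le_inner D k t) le_rfl)
    (h.φ.mono (past_le_inner D k t) le_rfl) t fun i hi => measurable_inner_sig (Or.inr ⟨i, hi, rfl⟩)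

lemma measurable_evalPt_draws (s : Setup Pr P p D μ ℓf0 ℓf1 ℓg1 ℓg2 σf σg1 σg2 M) (k : ℕ) :
    Measurable[sig D (innerDraws k p.T)] (evalPt P p D k) :=
  measurable_pt ((s.standing.reg.stateMeasurable (D := D) p k).θ.mono (past_le_inner D k _) le_rfl)
    (s.measurable_innerSGD_draws (p.stepLow (k + 1)) k p.T)

lemma measurable_endErr_draws (s : Setup Pr P p D μ ℓf0 ℓf1 ℓg1 ℓg2 σf σg1 σg2 M) (k : ℕ) :
    Measurable[sig D (innerDraws k p.T)] (endErr P p D k) :=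
  (s.measurable_innerSGD_draws (p.stepLow (k + 1)) k p.T).sub (s.measurable_lowerSol.comp
    ((s.measurable_auxAt_past k).mono (past_le_inner D k _) le_rfl))

lemma measurable_auxAt (s : Setup Pr P p D μ ℓf0 ℓf1 ℓg1 ℓg2 σf σg1 σg2 M) (k : ℕ) :
    Measurable (auxAt P p D k) :=
  (s.measurable_auxAt_past k).mono (s.sampling.sig_le _) le_rfl

lemma stateMeasurable (s : Setup Pr P p D μ ℓf0 ℓf1 ℓg1 ℓg2 σf σg1 σg2 M) (k : ℕ) :
    StateMeasurable mΩ fun ω => state P p (fun j => D j ω) k := by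
  have h := s.standing.reg.stateMeasurable (D := D) p k
  have hle := s.sampling.sig_le (pastDraws k)
  exact ⟨h.θ.mono hle le_rfl, h.φ.mono hle le_rfl, h.m.mono hle le_rfl,
    fun i j => (h.V i j).mono hle le_rfl, fun i => (h.Vhat i).mono hle le_rfl⟩

lemma measurable_precondAt_past (s : Setup Pr P p D μ ℓf0 ℓf1 ℓg1 ℓg2 σf σg1 σg2 M) (k : ℕ)
    (i : Fin d) : Measurable[sig D (pastDraws k)] fun ω => precondAt P p D k ω i :=
  (((s.standing.reg.stateMeasurable (D := D) p k).Vhat i).const_add p.δ).pow_const _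

lemma measurable_decreaseAt (s : Setup Pr P p D μ ℓf0 ℓf1 ℓg1 ℓg2 σf σg1 σg2 M) (k : ℕ) :
    Measurable (decreaseAt P p D k) := by
  have h : ∀ k i, Measurable fun ω => precond p (state P p (fun j => D j ω) k) i := fun k i =>
    (s.measurable_precondAt_past k i).mono (s.sampling.sig_le _) le_rfl
  have h2 : ∀ i, Measurable fun ω => p.gam (k - 1) * precond p (state P p (fun j => D j ω) k) i
      - p.gam k * precond p (state P p (fun j => D j ω) (k + 1)) i := fun i =>
    ((h k i).const_mul (p.gam (k - 1))).sub ((h (k + 1) i).const_mul (p.gam k))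
  exact Finset.measurable_fun_sum Finset.univ fun i _ => h2 i

lemma measurable_updateAt (s : Setup Pr P p D μ ℓf0 ℓf1 ℓg1 ℓg2 σf σg1 σg2 M) (k : ℕ) :
    Measurable (updateAt P p D k) :=
  s.standing.reg.measurable_update p
    ((s.measurable_evalPt_draws k).mono (s.sampling.sig_le _) le_rfl)
    (s.sampling.measurable_xi k) (s.sampling.measurable_zeta k) (s.sampling.measurable_len k)

variable [IsProbabilityMeasure Pr]

/-- Conditionally on the past, the stochastic update has mean `truncSurrogate`. -/
lemma integral_inner_updateAt (s : Setup Pr P p D μ ℓf0 ℓf1 ℓg1 ℓg2 σf σg1 σg2 M) (k : ℕ)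
    {w : Ω → EuclideanSpace ℝ (Fin d)} (hw : Measurable[sig D (innerDraws k p.T)] w)
    (hi : Integrable (fun ω => inner ℝ (w ω) (updateAt P p D k ω)) Pr) :
    ∫ ω, inner ℝ (w ω) (updateAt P p D k ω) ∂Pr
      = ∫ ω, inner ℝ (w ω) (truncSurrogate P p.ℓ p.N (evalPt P p D k ω)) ∂Pr := by
  let T : Set DrawIdx := {i | i = .xi k ∨ (∃ j, i = .zeta k j) ∨ i = .len k}
  have hdisj : Disjoint (innerDraws k p.T) T := by
    rw [Set.disjoint_left]
    rintro i (hi | ⟨t, _, rfl⟩) h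
    · rcases h with rfl | ⟨j, rfl⟩ | rfl <;> exact lt_irrefl k hi
    · rcases h with h | ⟨j, h⟩ | h <;> cases h
  -- The inner samples do not enter `update`, so any sequence may fill their slot; the Hessian
  -- samples are reused for this.
  let U : Joint d q → Ξ × (ℕ → Z) × ℕ → EuclideanSpace ℝ (Fin d) := fun x y =>
    update P p ⟨y.1, y.2.1, y.2.1, y.2.2⟩ x
  have hU : Measurable (Function.uncurry U) := by
    have e1 : Measurable fun b : Joint d q × Ξ × (ℕ → Z) × ℕ => b.2.1 :=
      measurable_fst.comp measurable_snd
    have e2 : Measurable fun b : Joint d q × Ξ × (ℕ → Z) × ℕ => b.2.2.1 :=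
      measurable_fst.comp (measurable_snd.comp measurable_snd)
    have e3 : Measurable fun b : Joint d q × Ξ × (ℕ → Z) × ℕ => b.2.2.2 :=
      measurable_snd.comp (measurable_snd.comp measurable_snd)
    exact s.standing.reg.measurable_update p measurable_fst e1
      (fun i => (measurable_pi_apply i).comp e2) e3
  have hm1 : Measurable[sig D T] fun ω => (D k ω).xi := measurable_xi_sig (Or.inl rfl)
  have hm2 : Measurable[sig D T] fun ω => (D k ω).zeta :=
    @measurable_pi_lambda _ _ _ (sig D T) _ _ fun i =>
      measurable_zeta_sig (Or.inr (Or.inl ⟨i, rfl⟩))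
  have hm3 : Measurable[sig D T] fun ω => (D k ω).len := measurable_len_sig (Or.inr (Or.inr rfl))
  have hY : Measurable[sig D T] fun ω => ((D k ω).xi, (D k ω).zeta, (D k ω).len) :=
    hm1.prodMk (hm2.prodMk hm3)
  exact integral_inner_freeze (s.sampling.indep_sig hdisj) (s.sampling.sig_le _)
    (s.sampling.sig_le _) hw (s.measurable_evalPt_draws k) hY hU
    (fun x => s.standing.integral_update p s.sampling s.one_le_N x k) hi

end Setup

end process

end Bilevel

namespace Bilevel

/-! ### Contraction of the lower-level error -/

section probability

variable {Ω : Type*} {m₁ m₂ mΩ : MeasurableSpace Ω} {ν : Measure Ω}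

lemma lintegral_freeze_le [IsProbabilityMeasure ν] {α β : Type*}
    [MeasurableSpace α] [MeasurableSpace β]
    (h : Indep m₁ m₂ ν) (h₁ : m₁ ≤ mΩ) (h₂ : m₂ ≤ mΩ) {X : Ω → α} {Y : Ω → β}
    (hX : Measurable[m₁] X) (hY : Measurable[m₂] Y) {F : α → β → ℝ≥0∞}
    (hF : Measurable (Function.uncurry F)) {κ : Measure β} (hκ : ν.map Y = κ) {B : α → ℝ≥0∞}
    (hB : ∀ x, ∫⁻ y, F x y ∂κ ≤ B x) :
    ∫⁻ ω, F (X ω) (Y ω) ∂ν ≤ ∫⁻ ω, B (X ω) ∂ν := by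
  refine (lintegral_freeze h h₁ h₂ hX hY hF).trans_le (lintegral_mono fun ω => ?_)
  have hFa : Measurable (F (X ω)) := hF.comp measurable_prodMk_left
  have e := lintegral_map hFa (hY.mono h₂ le_rfl) (μ := ν)
  rw [hκ] at e
  exact e.symm.trans_le (hB (X ω))

/-- Square integrability of the next error is not known in advance, so the recursion is proved for
extended nonnegative integrals and converted here, giving integrability and the real inequality
together. -/
lemma memLp_two_of_lintegral_le {E : Type*} [NormedAddCommGroup E] {X : Ω → E}
    (hX : AEStronglyMeasurable X ν) {f : Ω → ℝ} (hf : Integrable f ν) (hf0 : 0 ≤ᵐ[ν] f)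
    (h : ∫⁻ ω, ‖X ω‖ₑ ^ 2 ∂ν ≤ ∫⁻ ω, ENNReal.ofReal (f ω) ∂ν) :
    MemLp X 2 ν ∧ ∫ ω, ‖X ω‖ ^ 2 ∂ν ≤ ∫ ω, f ω ∂ν := by
  rw [← ofReal_integral_eq_lintegral_ofReal hf hf0] at h
  refine ⟨memLp_two_of_lintegral_lt_top hX (h.trans_lt ENNReal.ofReal_lt_top), ?_⟩
  have e : ∀ ω, ‖X ω‖ₑ ^ 2 = ENNReal.ofReal (‖X ω‖ ^ 2) := fun ω => by
    rw [ENNReal.ofReal_pow (norm_nonneg _), ofReal_norm]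
  simp only [e] at h
  rw [integral_eq_lintegral_of_nonneg_ae (Filter.Eventually.of_forall fun ω => sq_nonneg _)
    (hX.norm.pow 2)]
  exact ENNReal.toReal_le_of_le_ofReal (integral_nonneg_of_ae hf0) h

end probability

/-- The ratio of the two step sizes. -/
noncomputable def Params.ratio {d q : ℕ} (p : Params d q) : ℝ := p.cLow / (p.T * p.cUp)

namespace Setup

variable {d q : ℕ} {Ξ Z Ω : Type*} [MeasurableSpace Ξ] [MeasurableSpace Z]
  [mΩ : MeasurableSpace Ω] {Pr : Measure Ω} {P : Problem d q Ξ Z} {p : Params d q}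
  {D : ℕ → Ω → Draws Ξ Z} {μ : ℝ} {ℓf0 ℓf1 ℓg1 ℓg2 σf σg1 σg2 : ℝ≥0} {M : ℝ}

/-- The almost sure bounds along a trajectory, with a constant `C`. -/
structure PathBound (P : Problem d q Ξ Z) (p : Params d q) (D : ℕ → Ω → Draws Ξ Z) (M C : ℝ)
    (k : ℕ) (ω : Ω) : Prop where
  dist : ‖(state P p (fun j => D j ω) k).θ - auxAt P p D k ω‖ ≤ C * p.gam k
  rem : ‖auxAt P p D (k + 1) ω - auxAt P p D k ω
    + p.gam k • diagMul (precondAt P p D k ω) (updateAt P p D k ω)‖ ≤ C * decreaseAt P p D k ω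
  decrease_nonneg : 0 ≤ decreaseAt P p D k ω
  decrease_le : decreaseAt P p D k ω ≤ C * p.gam k
  move : ‖auxAt P p D (k + 1) ω - auxAt P p D k ω‖ ≤ C * p.gam k
  le_precond : ∀ i, (p.δ + M ^ 2) ^ (-(1 / 2) : ℝ) ≤ precondAt P p D k ω i
  precond_le : ∀ i, precondAt P p D k ω i ≤ p.δ ^ (-(1 / 2) : ℝ)
  precond_nonneg : ∀ i, 0 ≤ precondAt P p D k ω i

lemma exists_pathBound (s : Setup Pr P p D μ ℓf0 ℓf1 ℓg1 ℓg2 σf σg1 σg2 M) :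
    ∃ C : ℝ, 0 ≤ C ∧ (∀ k, ∀ᵐ ω ∂Pr, PathBound P p D M C k ω) ∧
      ∀ᵐ ω ∂Pr, ∀ n, ∑ k ∈ Finset.range n, decreaseAt P p D k ω ≤ C := by
  obtain ⟨C, hC, h⟩ := exists_pathwise_bound (Ξ := Ξ) (Z := Z) s.rho₁ s.rho₂ s.delta_pos s.cUp_pos M
  have hall := ae_all_iff.mpr s.bound
  refine ⟨C, hC, fun k => ?_, ?_⟩
  · filter_upwards [hall] with ω hω
    obtain ⟨h1, h2, h3, h4, h5⟩ := (h P (fun j => D j ω) hω).1 k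
    have inv := (state_invariants s.rho₁ s.rho₂ hω k).2
    exact ⟨h1, h2, h3, h4, h5,
      le_precond s.delta_pos (fun i => (inv i).2.1) fun i => (inv i).2.2,
      precond_le s.delta_pos fun i => (inv i).2.1,
      fun i => Real.rpow_nonneg (by linarith [(inv i).2.1, s.delta_pos]) _⟩
  · filter_upwards [hall] with ω hω
    exact (h P (fun j => D j ω) hω).2

lemma gam_pos (s : Setup Pr P p D μ ℓf0 ℓf1 ℓg1 ℓg2 σf σg1 σg2 M) (k : ℕ) : 0 < p.gam k :=
  Params.gam_pos s.cUp_pos k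

lemma gam_le_zero (s : Setup Pr P p D μ ℓf0 ℓf1 ℓg1 ℓg2 σf σg1 σg2 M) (k : ℕ) :
    p.gam k ≤ p.gam 0 := Params.gam_antitone s.cUp_pos (Nat.zero_le k)

lemma ratio_pos (s : Setup Pr P p D μ ℓf0 ℓf1 ℓg1 ℓg2 σf σg1 σg2 M) : 0 < p.ratio := by
  have := s.one_le_T
  have : (0 : ℝ) < p.T := by exact_mod_cast this
  exact div_pos s.cLow_pos (mul_pos this s.cUp_pos)

/-- The lower-level error after `t` inner steps of iteration `k`. -/
noncomputable def innerErr (P : Problem d q Ξ Z) (p : Params d q) (D : ℕ → Ω → Draws Ξ Z)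
    (k t : ℕ) (ω : Ω) : EuclideanSpace ℝ (Fin q) :=
  innerSGD P (p.stepLow (k + 1)) (state P p (fun j => D j ω) k).θ (D k ω).inner
    (state P p (fun j => D j ω) k).φ t - P.lowerSol (auxAt P p D k ω)

lemma measurable_innerErr_draws (s : Setup Pr P p D μ ℓf0 ℓf1 ℓg1 ℓg2 σf σg1 σg2 M) (k t : ℕ) :
    Measurable[sig D (innerDraws k t)] (innerErr P p D k t) :=
  (s.measurable_innerSGD_draws (p.stepLow (k + 1)) k t).sub (s.measurable_lowerSol.comp
    ((s.measurable_auxAt_past k).mono (past_le_inner D k _) le_rfl))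

variable [IsProbabilityMeasure Pr]

/-- The sample of inner step `t` is independent of everything before it. Freezing the past reduces
the estimate to a noisy gradient step at a fixed point, to which the deterministic contraction
towards `φ*(z_k)` applies. -/
lemma lintegral_innerErr_succ_le (s : Setup Pr P p D μ ℓf0 ℓf1 ℓg1 ℓg2 σf σg1 σg2 M) (k t : ℕ) :
    ∫⁻ ω, ‖innerErr P p D k (t + 1) ω‖ₑ ^ 2 ∂Pr ≤ ∫⁻ ω, ENNReal.ofReal
      ((1 - p.ratio * p.gam k * μ + 2 * (p.ratio * p.gam k) ^ 2 * ℓg1 ^ 2)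
          * ‖innerErr P p D k t ω‖ ^ 2
        + (p.ratio * p.gam k * ℓg1 ^ 2 / μ + 2 * (p.ratio * p.gam k) ^ 2 * ℓg1 ^ 2)
          * ‖(state P p (fun j => D j ω) k).θ - auxAt P p D k ω‖ ^ 2
        + (p.ratio * p.gam k) ^ 2 * σg1 ^ 2) ∂Pr := by
  set η := p.ratio * p.gam k with hη
  have hηe : p.stepLow (k + 1) = η := Params.stepLow_eq s.cUp_pos k
  have hη0 : 0 ≤ η := (mul_pos s.ratio_pos (s.gam_pos k)).le
  have hdisj : Disjoint (innerDraws k t) {DrawIdx.inner k t} := by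
    rw [Set.disjoint_singleton_right]
    rintro (h | ⟨j, hj, h⟩)
    · exact lt_irrefl k h
    · cases h
      exact lt_irrefl t hj
  let F : EuclideanSpace ℝ (Fin q) × Joint d q → Z → ℝ≥0∞ := fun a ζ =>
    ‖a.1 - η • gradPhi (fun y => P.g y ζ) a.2‖ₑ ^ 2
  have hF : Measurable (Function.uncurry F) := by
    have e1 : Measurable fun b : (EuclideanSpace ℝ (Fin q) × Joint d q) × Z => b.1.1 :=
      measurable_fst.comp measurable_fst
    have e2 : Measurable fun b : (EuclideanSpace ℝ (Fin q) × Joint d q) × Z =>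
        gradPhi (fun y => P.g y b.2) b.1.2 :=
      s.standing.reg.measurable_gradPhi_g (measurable_snd.comp measurable_fst) measurable_snd
    exact (e1.sub (e2.const_smul η)).enorm.pow_const 2
  have hx : Measurable[sig D (innerDraws k t)] fun ω => pt (state P p (fun j => D j ω) k).θ
      (innerSGD P (p.stepLow (k + 1)) (state P p (fun j => D j ω) k).θ (D k ω).inner
        (state P p (fun j => D j ω) k).φ t) :=
    measurable_pt ((s.standing.reg.stateMeasurable (D := D) p k).θ.mono (past_le_inner D k t)
      le_rfl) (s.measurable_innerSGD_draws (p.stepLow (k + 1)) k t)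
  have hY : Measurable[sig D {DrawIdx.inner k t}] fun ω => (D k ω).inner t :=
    measurable_inner_sig rfl
  have key := lintegral_freeze_le (s.sampling.indep_sig hdisj) (s.sampling.sig_le _)
    (s.sampling.sig_le _) ((s.measurable_innerErr_draws k t).prodMk hx) hY hF
    (s.sampling.law_inner k t)
    (B := fun a => ENNReal.ofReal (‖a.1 - η • gradPhi P.meanG a.2‖ ^ 2 + η ^ 2 * σg1 ^ 2))
    fun a => s.standing.lintegral_sq_step_le a.2 a.1 η
  have hL : ∀ ω, innerErr P p D k (t + 1) ω = innerErr P p D k t ω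
      - η • gradPhi (fun y => P.g y ((D k ω).inner t)) (pt (state P p (fun j => D j ω) k).θ
      (innerSGD P (p.stepLow (k + 1)) (state P p (fun j => D j ω) k).θ (D k ω).inner
        (state P p (fun j => D j ω) k).φ t)) := fun ω => by
    rw [innerErr, innerErr, innerSGD, hηe]
    abel
  simp only [hL]
  refine key.trans (lintegral_mono fun ω => ENNReal.ofReal_le_ofReal ?_)
  have := s.standing.norm_sq_gradient_step_le (state P p (fun j => D j ω) k).θ (auxAt P p D k ω)
    (innerSGD P (p.stepLow (k + 1)) (state P p (fun j => D j ω) k).θ (D k ω).inner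
        (state P p (fun j => D j ω) k).φ t) hη0
  exact add_le_add this le_rfl

/-- One inner step: a contraction up to an error of the order of `γ²`. -/
lemma exists_innerErr_succ_le (s : Setup Pr P p D μ ℓf0 ℓf1 ℓg1 ℓg2 σf σg1 σg2 M) :
    ∃ C : ℝ, 0 ≤ C ∧ ∀ (k t : ℕ) (α : ℝ), 0 ≤ α →
      1 - p.ratio * p.gam k * μ + 2 * (p.ratio * p.gam k) ^ 2 * ℓg1 ^ 2 ≤ α →
      MemLp (innerErr P p D k t) 2 Pr → MemLp (innerErr P p D k (t + 1)) 2 Pr ∧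
        ∫ ω, ‖innerErr P p D k (t + 1) ω‖ ^ 2 ∂Pr
          ≤ α * ∫ ω, ‖innerErr P p D k t ω‖ ^ 2 ∂Pr + C * p.gam k ^ 2 := by
  obtain ⟨C, hC, hpath, -⟩ := s.exists_pathBound
  have hr := s.ratio_pos
  have hμ := s.standing.mu_pos
  -- The coefficient of `‖θ_k - z_k‖²` is bounded by its value at the largest step size, and the
  -- squared distance itself supplies the factor `γ²`.
  set B := (p.ratio * p.gam 0 * ℓg1 ^ 2 / μ + 2 * (p.ratio * p.gam 0) ^ 2 * ℓg1 ^ 2) * C ^ 2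
    + p.ratio ^ 2 * σg1 ^ 2 with hB
  have hg0 := s.gam_pos 0
  have hB0 : 0 ≤ B := by positivity
  refine ⟨B, hB0, fun k t α hα hle hmem => ?_⟩
  have hg := s.gam_pos k
  have hgle := s.gam_le_zero k
  have hint : Integrable (fun ω => α * ‖innerErr P p D k t ω‖ ^ 2 + B * p.gam k ^ 2) Pr :=
    ((hmem.integrable_norm_pow (by norm_num)).const_mul α).add (integrable_const _)
  have hbound := (s.lintegral_innerErr_succ_le k t).trans (lintegral_mono_ae (g := fun ω =>
      ENNReal.ofReal (α * ‖innerErr P p D k t ω‖ ^ 2 + B * p.gam k ^ 2)) (by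
    filter_upwards [hpath k] with ω hω
    refine ENNReal.ofReal_le_ofReal ?_
    have e1 := mul_le_mul_of_nonneg_right hle (sq_nonneg ‖innerErr P p D k t ω‖)
    have e2 : ‖(state P p (fun j => D j ω) k).θ - auxAt P p D k ω‖ ^ 2 ≤ C ^ 2 * p.gam k ^ 2 := by
      rw [← mul_pow]
      exact pow_le_pow_left₀ (norm_nonneg _) hω.dist 2
    have e3 : p.ratio * p.gam k * ℓg1 ^ 2 / μ + 2 * (p.ratio * p.gam k) ^ 2 * ℓg1 ^ 2
        ≤ p.ratio * p.gam 0 * ℓg1 ^ 2 / μ + 2 * (p.ratio * p.gam 0) ^ 2 * ℓg1 ^ 2 := by gcongr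
    have e4 := mul_le_mul e3 e2 (sq_nonneg _) (by positivity)
    rw [hB]
    linarith))
  obtain ⟨h1, h2⟩ := memLp_two_of_lintegral_le
    ((s.measurable_innerErr_draws k (t + 1)).mono (s.sampling.sig_le _)
      le_rfl).aestronglyMeasurable hint (Filter.Eventually.of_forall fun ω => by
        change 0 ≤ α * ‖innerErr P p D k t ω‖ ^ 2 + B * p.gam k ^ 2
        positivity) hbound
  refine ⟨h1, h2.trans (le_of_eq ?_)⟩
  rw [integral_add ((hmem.integrable_norm_pow (by norm_num)).const_mul α) (integrable_const _),
    integral_const_mul]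
  simp

lemma memLp_innerErr (s : Setup Pr P p D μ ℓf0 ℓf1 ℓg1 ℓg2 σf σg1 σg2 M) (k : ℕ)
    (h : MemLp (startErr P p D k) 2 Pr) (t : ℕ) : MemLp (innerErr P p D k t) 2 Pr := by
  obtain ⟨C, -, hC⟩ := s.exists_innerErr_succ_le
  induction t with
  | zero => exact h
  | succ t ih =>
    have e : 0 ≤ p.ratio * p.gam k * μ :=
      (mul_pos (mul_pos s.ratio_pos (s.gam_pos k)) s.standing.mu_pos).le
    -- This crude factor is valid for every `k`; a contraction is not needed for integrability.
    exact (hC k t (1 + 2 * (p.ratio * p.gam k) ^ 2 * ℓg1 ^ 2) (by positivity) (by linarith) ih).1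

/-- From one iteration to the next the error changes by the inner loop, which preserves square
integrability, and by the motion of `φ*(z_k)`, which is almost surely bounded. -/
lemma memLp_startErr (s : Setup Pr P p D μ ℓf0 ℓf1 ℓg1 ℓg2 σf σg1 σg2 M) (k : ℕ) :
    MemLp (startErr P p D k) 2 Pr := by
  obtain ⟨C, hC, hpath, -⟩ := s.exists_pathBound
  have hμ := s.standing.mu_pos
  induction k with
  | zero => exact memLp_const (p.φ₀ - P.lowerSol (auxPoint p 0 ⟨p.θ₀, p.φ₀, 0, 0, 0⟩))
  | succ k ih =>
    have h1 : MemLp (innerErr P p D k p.T) 2 Pr := s.memLp_innerErr k ih p.T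
    have hm : ∀ k, Measurable fun ω => P.lowerSol (auxAt P p D k ω) := fun k =>
      s.measurable_lowerSol.comp (s.measurable_auxAt k)
    have h2 : MemLp (fun ω => P.lowerSol (auxAt P p D (k + 1) ω) - P.lowerSol (auxAt P p D k ω))
        2 Pr := by
      refine MemLp.of_bound ((hm (k + 1)).sub (hm k)).aestronglyMeasurable
        (ℓg1 * (1 / μ) * (C * p.gam k)) ?_
      filter_upwards [hpath k] with ω hω
      exact (s.standing.norm_lowerSol_sub_le _ _).trans
        (mul_le_mul_of_nonneg_left hω.move (by positivity))
    have h3 : startErr P p D (k + 1) = fun ω => innerErr P p D k p.T ω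
        - (P.lowerSol (auxAt P p D (k + 1) ω) - P.lowerSol (auxAt P p D k ω)) := by
      ext1 ω
      exact (sub_sub_sub_cancel_right _ _ _).symm
    rw [h3]
    exact h1.sub h2

lemma memLp_endErr (s : Setup Pr P p D μ ℓf0 ℓf1 ℓg1 ℓg2 σf σg1 σg2 M) (k : ℕ) :
    MemLp (endErr P p D k) 2 Pr := s.memLp_innerErr k (s.memLp_startErr k) p.T

/-- The inner loop contracts the mean squared lower-level error. -/
lemma exists_inner_loop_le (s : Setup Pr P p D μ ℓf0 ℓf1 ℓg1 ℓg2 σf σg1 σg2 M) :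
    ∃ C : ℝ, 0 ≤ C ∧ ∀ᶠ k in Filter.atTop,
      p.ratio * μ / 2 * p.gam k * ∫ ω, ‖endErr P p D k ω‖ ^ 2 ∂Pr
        ≤ ∫ ω, ‖startErr P p D k ω‖ ^ 2 ∂Pr - ∫ ω, ‖endErr P p D k ω‖ ^ 2 ∂Pr
          + C * p.gam k ^ 2 := by
  obtain ⟨C, hC0, hC⟩ := s.exists_innerErr_succ_le
  have hμ := s.standing.mu_pos
  have hr := s.ratio_pos
  refine ⟨2 * (p.T * C), by positivity, ?_⟩
  have hlim : Filter.Tendsto (fun k => p.ratio * p.gam k) Filter.atTop (nhds 0) := by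
    simpa using (Params.gam_tendsto (p := p)).const_mul p.ratio
  -- With `η` the lower step size, this makes `2 η² ℓg1² ≤ η μ / 2`, so each inner step contracts by
  -- `1 - η μ / 2`.
  have h1 : ∀ᶠ k in Filter.atTop, p.ratio * p.gam k * (4 * ℓg1 ^ 2) < μ := by
    have := hlim.mul_const (4 * (ℓg1 : ℝ) ^ 2)
    rw [zero_mul] at this
    exact this.eventually_lt_const hμ
  have h2 : ∀ᶠ k in Filter.atTop, p.ratio * p.gam k * (μ / 2) < 1 := by
    have := hlim.mul_const (μ / 2)
    rw [zero_mul] at this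
    exact this.eventually_lt_const one_pos
  filter_upwards [h1, h2] with k hk1 hk2
  have hη : 0 < p.ratio * p.gam k := mul_pos hr (s.gam_pos k)
  set η := p.ratio * p.gam k
  set x := η * (μ / 2) with hx
  have hx0 : 0 < x := mul_pos hη (by positivity)
  have hstep : ∀ t, ∫ ω, ‖innerErr P p D k (t + 1) ω‖ ^ 2 ∂Pr
      ≤ (1 - x) * ∫ ω, ‖innerErr P p D k t ω‖ ^ 2 ∂Pr + C * p.gam k ^ 2 := fun t =>
    (hC k t (1 - x) (by linarith) (by nlinarith)
      (s.memLp_innerErr k (s.memLp_startErr k) t)).2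
  set b : ℕ → ℝ := fun t => ∫ ω, ‖innerErr P p D k t ω‖ ^ 2 ∂Pr
  have hb0 : 0 ≤ b 0 := integral_nonneg fun ω => sq_nonneg _
  have hg2 : 0 ≤ C * p.gam k ^ 2 := by positivity
  -- A single factor `1 - x` is kept out of the `t` available; the bound starts at `t = 1`, which is
  -- why at least one inner step is required.
  have hmain : ∀ t, 1 ≤ t → b t ≤ (1 - x) * b 0 + t * (C * p.gam k ^ 2) := fun t ht => by
    induction t, ht using Nat.le_induction with
    | base => simpa using hstep 0
    | succ t ht ih =>
      have e1 := mul_le_mul_of_nonneg_left ih (by linarith : 0 ≤ 1 - x)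
      have e2 : 0 ≤ x * (1 - x) * b 0 :=
        mul_nonneg (mul_nonneg hx0.le (by linarith)) hb0
      have e3 : 0 ≤ x * (t * (C * p.gam k ^ 2)) := by positivity
      have e4 := hstep t
      push_cast
      change b (t + 1) ≤ _ * b t + _ at e4
      linarith
  have hT := hmain p.T s.one_le_T
  -- Adding `x` times the bound to the bound itself and using `(1 + x)(1 - x) ≤ 1` expresses the
  -- gain through the error at the end of the loop.
  have e1 := mul_le_mul_of_nonneg_left hT hx0.le
  have e2 : 0 ≤ x * x * b 0 := mul_nonneg (mul_nonneg hx0.le hx0.le) hb0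
  have e3 : x * (p.T * (C * p.gam k ^ 2)) ≤ 1 * (p.T * (C * p.gam k ^ 2)) :=
    mul_le_mul_of_nonneg_right hk2.le (by positivity)
  have e4 : p.ratio * μ / 2 * p.gam k = x := by rw [hx]; ring
  rw [e4]
  change x * b p.T ≤ b 0 - b p.T + _
  linarith

end Setup

end Bilevel

namespace Bilevel

/-! ### Regularity and integrability for the drift estimates -/

namespace Standing

variable {d q : ℕ} {Ξ Z : Type*} [MeasurableSpace Ξ] [MeasurableSpace Z] {P : Problem d q Ξ Z}
  {μ : ℝ} {ℓf0 ℓf1 ℓg1 ℓg2 σf σg1 σg2 : ℝ≥0}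

lemma continuous_truncSurrogate (h : Standing P μ ℓf0 ℓf1 ℓg1 ℓg2 σf σg1 σg2) (ℓ : ℝ) (N : ℕ) :
    Continuous (truncSurrogate P ℓ N) := by
  have hf := h.lip.grad_f.continuous
  have hg := h.lip.hess_g.continuous
  have h1 : Continuous fun x => gradTheta P.meanF x := (WithLp.fstL 2 ℝ _ _).continuous.comp hf
  have h2 : Continuous fun x => gradPhi P.meanF x := (WithLp.sndL 2 ℝ _ _).continuous.comp hf
  have h3 : Continuous fun x => hessPhi P.meanG x := (phiBlock d q).continuous.comp hg
  have h4 : Continuous fun x => hessThetaPhi P.meanG x := (mixedBlock d q).continuous.comp hg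
  have h5 : Continuous fun x => (1 / ℓ) • ∑ j ∈ Finset.range N,
      ((1 : EuclideanSpace ℝ (Fin q) →L[ℝ] EuclideanSpace ℝ (Fin q))
        - (1 / ℓ) • hessPhi P.meanG x) ^ j :=
    (continuous_finsetSum _ fun j _ =>
      (continuous_const.sub (h3.const_smul (1 / ℓ))).pow j).const_smul (1 / ℓ)
  exact h1.sub (h4.clm_apply (h5.clm_apply h2))

lemma continuous_coupling_apply (h : Standing P μ ℓf0 ℓf1 ℓg1 ℓg2 σf σg1 σg2) :
    Continuous fun a : Joint d q × EuclideanSpace ℝ (Fin q) => coupling P a.1 a.2 := by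
  have hμ := h.mu_pos
  have : LipschitzWith (Real.toNNReal (ℓg2 * (1 / μ) + ℓg1 * (1 / μ * (ℓg2 * (1 / μ)))))
      (coupling P) := LipschitzWith.of_dist_le_mul fun x y => by
    rw [dist_eq_norm, dist_eq_norm, Real.coe_toNNReal _ (by positivity)]
    exact ContinuousLinearMap.opNorm_le_bound _ (by positivity) fun v =>
      h.norm_coupling_sub_apply_le x y v
  exact (this.continuous.comp continuous_fst).clm_apply continuous_snd

lemma continuous_gradient_V (h : Standing P μ ℓf0 ℓf1 ℓg1 ℓg2 σf σg1 σg2) :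
    Continuous (gradient P.V) := by
  obtain ⟨L, hL, hLip⟩ := h.exists_surrogate_lipschitz
  have h1 : Continuous (surrogate P) := (LipschitzWith.of_dist_le_mul (K := Real.toNNReal L)
    fun x y => by
      rw [dist_eq_norm, dist_eq_norm, Real.coe_toNNReal _ hL]
      exact hLip x y).continuous
  have h2 : gradient P.V = fun θ => surrogate P (pt θ (P.lowerSol θ)) := funext h.gradient_V
  rw [h2]
  exact h1.comp (continuous_pt.comp (continuous_id.prodMk h.continuous_lowerSol))

lemma norm_gradient_V_le (h : Standing P μ ℓf0 ℓf1 ℓg1 ℓg2 σf σg1 σg2)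
    (θ : EuclideanSpace ℝ (Fin d)) : ‖gradient P.V θ‖ ≤ ℓf0 + ℓg1 * (1 / μ) * ℓf0 := by
  rw [h.gradient_V]
  exact h.norm_surrogate_le _

end Standing

/-- In each coordinate `a v t = a/2 (v² + t² - (t - v)²)`, and the term with `t²` is dropped. -/
lemma half_sub_le_inner_diagMul {d : ℕ} {a : Fin d → ℝ} {c s : ℝ} (hc : ∀ i, c ≤ a i)
    (hs : ∀ i, a i ≤ s) (h0 : ∀ i, 0 ≤ a i) (v t : EuclideanSpace ℝ (Fin d)) :
    c / 2 * ‖v‖ ^ 2 - s / 2 * ‖t - v‖ ^ 2 ≤ inner ℝ (diagMul a v) t := by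
  rw [EuclideanSpace.norm_sq_eq, EuclideanSpace.norm_sq_eq, Finset.mul_sum, Finset.mul_sum,
    ← Finset.sum_sub_distrib, PiLp.inner_apply]
  refine Finset.sum_le_sum fun i _ => ?_
  simp only [diagMul_apply, RCLike.inner_apply, conj_trivial, Real.norm_eq_abs, sq_abs,
    PiLp.sub_apply]
  have e1 := mul_le_mul_of_nonneg_right (hc i) (sq_nonneg (v i))
  have e2 := mul_le_mul_of_nonneg_right (hs i) (sq_nonneg (t i - v i))
  have e3 := mul_nonneg (h0 i) (sq_nonneg (t i))
  nlinarith

/-- Young's inequality with a weight. -/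
lemma two_mul_le_young {ε g n x y z : ℝ} (hε : 0 < ε) (hg : 0 < g) (h : y ^ 2 ≤ g * z) :
    2 * x * n * y ≤ ε / 2 * g * n ^ 2 + 2 * x ^ 2 / ε * z := by
  have e1 : y ^ 2 / g ≤ z := by rwa [div_le_iff₀' hg]
  have e2 : 2 * x ^ 2 / ε * (y ^ 2 / g) ≤ 2 * x ^ 2 / ε * z :=
    mul_le_mul_of_nonneg_left e1 (by positivity)
  have e3 : 0 ≤ ε * g / 2 * (n - 2 * x * y / (ε * g)) ^ 2 := by positivity
  have e4 : ε * g / 2 * (n - 2 * x * y / (ε * g)) ^ 2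
      = ε / 2 * g * n ^ 2 - 2 * x * n * y + 2 * x ^ 2 / ε * (y ^ 2 / g) := by
    field_simp
    ring
  linarith

lemma integrable_inner_of_memLp {Ω E : Type*} [MeasurableSpace Ω] {ν : Measure Ω}
    [NormedAddCommGroup E] [InnerProductSpace ℝ E] {u v : Ω → E} (hu : MemLp u 2 ν)
    (hv : MemLp v 2 ν) : Integrable (fun ω => (inner ℝ (u ω) (v ω) : ℝ)) ν :=
  (hu.norm.integrable_mul hv.norm).mono' (hu.1.inner hv.1)
    (Filter.Eventually.of_forall fun ω => norm_inner_le_norm (u ω) (v ω))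

namespace Setup

variable {d q : ℕ} {Ξ Z Ω : Type*} [MeasurableSpace Ξ] [MeasurableSpace Z]
  [mΩ : MeasurableSpace Ω] {Pr : Measure Ω} {P : Problem d q Ξ Z} {p : Params d q}
  {D : ℕ → Ω → Draws Ξ Z} {μ : ℝ} {ℓf0 ℓf1 ℓg1 ℓg2 σf σg1 σg2 : ℝ≥0} {M : ℝ}

/-- Three errors separate the mean update from `∇V(z_k)`: the Neumann bias, the lag `θ_k - z_k` due
to momentum, and the lower-level error. The last two come from the Lipschitz surrogate, as `∇V(z_k)`
is its value at `(z_k, φ*(z_k))`. -/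
lemma norm_truncSurrogate_sub_gradient_le
    (s : Setup Pr P p D μ ℓf0 ℓf1 ℓg1 ℓg2 σf σg1 σg2 M) {L : ℝ} (hL0 : 0 ≤ L)
    (hL : ∀ x y, ‖surrogate P x - surrogate P y‖ ≤ L * ‖x - y‖) (k : ℕ) (ω : Ω) :
    ‖truncSurrogate P p.ℓ p.N (evalPt P p D k ω) - gradient P.V (auxAt P p D k ω)‖
      ≤ |neumannBias μ ℓf0 ℓg1 p.N| + L * (‖(state P p (fun j => D j ω) k).θ - auxAt P p D k ω‖
        + ‖endErr P p D k ω‖) := by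
  rw [s.ell, s.standing.gradient_V]
  have e1 := s.standing.norm_truncSurrogate_sub_le p.N (evalPt P p D k ω)
  have e2 := hL (evalPt P p D k ω) (pt (auxAt P p D k ω) (P.lowerSol (auxAt P p D k ω)))
  have e3 := norm_pt_sub_le (state P p (fun j => D j ω) k).θ (auxAt P p D k ω)
    (state P p (fun j => D j ω) (k + 1)).φ (P.lowerSol (auxAt P p D k ω))
  have e4 := mul_le_mul_of_nonneg_left e3 hL0
  refine (norm_sub_le_norm_sub_add_norm_sub _ (surrogate P (evalPt P p D k ω)) _).trans ?_
  exact add_le_add e1 (e2.trans e4)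

lemma measurable_gradient_V_auxAt (s : Setup Pr P p D μ ℓf0 ℓf1 ℓg1 ℓg2 σf σg1 σg2 M) (k : ℕ) :
    Measurable fun ω => gradient P.V (auxAt P p D k ω) :=
  s.standing.continuous_gradient_V.measurable.comp (s.measurable_auxAt k)

lemma measurable_truncSurrogate (s : Setup Pr P p D μ ℓf0 ℓf1 ℓg1 ℓg2 σf σg1 σg2 M) (k : ℕ) :
    Measurable fun ω => truncSurrogate P p.ℓ p.N (evalPt P p D k ω) :=
  (s.standing.continuous_truncSurrogate p.ℓ p.N).measurable.comp
    ((s.measurable_evalPt_draws k).mono (s.sampling.sig_le _) le_rfl)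

variable [IsProbabilityMeasure Pr]

lemma integrable_gradient_V_auxAt (s : Setup Pr P p D μ ℓf0 ℓf1 ℓg1 ℓg2 σf σg1 σg2 M) (k : ℕ) :
    Integrable (fun ω => ‖gradient P.V (auxAt P p D k ω)‖ ^ 2) Pr :=
  (MemLp.of_bound (p := 2) (s.measurable_gradient_V_auxAt k).aestronglyMeasurable _
    (Filter.Eventually.of_forall fun ω => s.standing.norm_gradient_V_le _)).integrable_norm_pow
      (by norm_num)

lemma integrable_endErr (s : Setup Pr P p D μ ℓf0 ℓf1 ℓg1 ℓg2 σf σg1 σg2 M) (k : ℕ) :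
    Integrable (fun ω => ‖endErr P p D k ω‖ ^ 2) Pr :=
  (s.memLp_endErr k).integrable_norm_pow (by norm_num)

lemma integrable_decreaseAt (s : Setup Pr P p D μ ℓf0 ℓf1 ℓg1 ℓg2 σf σg1 σg2 M) (k : ℕ) :
    Integrable (decreaseAt P p D k) Pr := by
  obtain ⟨C, -, hpath, -⟩ := s.exists_pathBound
  refine Integrable.of_bound (s.measurable_decreaseAt k).aestronglyMeasurable (C * p.gam k) ?_
  filter_upwards [hpath k] with ω hω
  rw [Real.norm_of_nonneg hω.decrease_nonneg]
  exact hω.decrease_le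

/-- The inner product of a square integrable vector with the update is integrable. -/
lemma integrable_inner_updateAt (s : Setup Pr P p D μ ℓf0 ℓf1 ℓg1 ℓg2 σf σg1 σg2 M) (k : ℕ)
    {w : Ω → EuclideanSpace ℝ (Fin d)} (hw : MemLp w 2 Pr) :
    Integrable (fun ω => inner ℝ (w ω) (updateAt P p D k ω)) Pr := by
  have h1 : MemLp (updateAt P p D k) 2 Pr :=
    MemLp.of_bound (s.measurable_updateAt k).aestronglyMeasurable M (s.bound k)
  exact integrable_inner_of_memLp hw h1

lemma integrable_inner_truncSurrogate (s : Setup Pr P p D μ ℓf0 ℓf1 ℓg1 ℓg2 σf σg1 σg2 M) (k : ℕ)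
    {w : Ω → EuclideanSpace ℝ (Fin d)} (hw : MemLp w 2 Pr) :
    Integrable (fun ω => inner ℝ (w ω) (truncSurrogate P p.ℓ p.N (evalPt P p D k ω))) Pr := by
  refine integrable_inner_of_memLp hw (MemLp.of_bound
    (s.measurable_truncSurrogate k).aestronglyMeasurable
    (|neumannBias μ ℓf0 ℓg1 p.N| + (ℓf0 + ℓg1 * (1 / μ) * ℓf0))
    (Filter.Eventually.of_forall fun ω => ?_))
  rw [s.ell]
  have e1 := s.standing.norm_truncSurrogate_sub_le p.N (evalPt P p D k ω)
  have e2 := s.standing.norm_surrogate_le (evalPt P p D k ω)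
  have e3 := norm_add_le (truncSurrogate P ℓg1 p.N (evalPt P p D k ω)
    - surrogate P (evalPt P p D k ω)) (surrogate P (evalPt P p D k ω))
  rw [sub_add_cancel] at e3
  linarith

/-- `V` need not be bounded, but the start is deterministic and each increment is almost surely
bounded, by the Taylor estimate and the bounded moves. -/
lemma integrable_V_auxAt (s : Setup Pr P p D μ ℓf0 ℓf1 ℓg1 ℓg2 σf σg1 σg2 M) (k : ℕ) :
    Integrable (fun ω => P.V (auxAt P p D k ω)) Pr := by
  obtain ⟨C, hC, hpath, -⟩ := s.exists_pathBound
  obtain ⟨CV, hCV, hV⟩ := s.standing.exists_V_taylor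
  have hm : ∀ k, Measurable fun ω => P.V (auxAt P p D k ω) := fun k =>
    s.standing.differentiable_V.continuous.measurable.comp (s.measurable_auxAt k)
  set G := ℓf0 + ℓg1 * (1 / μ) * ℓf0
  induction k with
  | zero => exact integrable_const (P.V (auxPoint p 0 ⟨p.θ₀, p.φ₀, 0, 0, 0⟩))
  | succ k ih =>
    have h2 : Integrable (fun ω => P.V (auxAt P p D (k + 1) ω) - P.V (auxAt P p D k ω)) Pr := by
      refine Integrable.of_bound ((hm (k + 1)).sub (hm k)).aestronglyMeasurable
        (G * (C * p.gam k) + CV * (C * p.gam k) ^ 2) ?_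
      filter_upwards [hpath k] with ω hω
      have hG := s.standing.norm_surrogate_le (pt (auxAt P p D k ω) (P.lowerSol (auxAt P p D k ω)))
      have e1 := hV (auxAt P p D k ω) (auxAt P p D (k + 1) ω)
      have e2 := abs_real_inner_le_norm (surrogate P (pt (auxAt P p D k ω)
        (P.lowerSol (auxAt P p D k ω)))) (auxAt P p D (k + 1) ω - auxAt P p D k ω)
      have e3 := mul_le_mul hG hω.move (norm_nonneg _) ((norm_nonneg _).trans hG)
      have e4 := mul_le_mul_of_nonneg_left (pow_le_pow_left₀ (norm_nonneg _) hω.move 2) hCV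
      have e5 := abs_sub_le_iff.mp e1
      have e6 := abs_le.mp e2
      rw [Real.norm_eq_abs, abs_le]
      constructor <;> linarith
    have h3 := ih.add h2
    refine h3.congr (Filter.Eventually.of_forall fun ω => ?_)
    simp

end Setup

end Bilevel

namespace Bilevel

/-! ### Descent of the objective and drift of the lower-level error -/

/-- Expectation of a weighted sum of three integrable functions. -/
lemma integral_lin_comb {Ω : Type*} [MeasurableSpace Ω] {ν : Measure Ω} [IsProbabilityMeasure ν]
    {f g h : Ω → ℝ} (hf : Integrable f ν) (hg : Integrable g ν) (hh : Integrable h ν)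
    (a b c e : ℝ) :
    Integrable (fun ω => a * f ω + b * g ω + c * h ω + e) ν ∧
      ∫ ω, (a * f ω + b * g ω + c * h ω + e) ∂ν
        = a * ∫ ω, f ω ∂ν + b * ∫ ω, g ω ∂ν + c * ∫ ω, h ω ∂ν + e := by
  have h1 := hf.const_mul a
  have h2 := hg.const_mul b
  have h3 := hh.const_mul c
  refine ⟨((h1.add h2).add h3).add (integrable_const e), ?_⟩
  rw [integral_add (by exact (h1.add h2).add h3) (integrable_const e),
    integral_add (by exact h1.add h2) h3, integral_add h1 h2, integral_const_mul,
    integral_const_mul, integral_const_mul]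
  simp

/-- The Lipschitz constant of `φ*` times a bound for the preconditioner. -/
noncomputable def couplingBound (δ μ ℓ : ℝ) : ℝ :=
  δ ^ (-(1 / 2) : ℝ) * (Real.sqrt (ℓ ^ 2 - μ ^ 2) * (1 / μ))

namespace Setup

variable {d q : ℕ} {Ξ Z Ω : Type*} [MeasurableSpace Ξ] [MeasurableSpace Z]
  [mΩ : MeasurableSpace Ω] {Pr : Measure Ω} {P : Problem d q Ξ Z} {p : Params d q}
  {D : ℕ → Ω → Draws Ξ Z} {μ : ℝ} {ℓf0 ℓf1 ℓg1 ℓg2 σf σg1 σg2 : ℝ≥0} {M : ℝ}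

/-- The preconditioned gradient `A_{k-1} ∇V(z_k)`. -/
noncomputable def precondGrad (P : Problem d q Ξ Z) (p : Params d q) (D : ℕ → Ω → Draws Ξ Z)
    (k : ℕ) (ω : Ω) : EuclideanSpace ℝ (Fin d) :=
  diagMul (precondAt P p D k ω) (gradient P.V (auxAt P p D k ω))

/-- The lower-level error `u`, mapped to the upper level as `A_{k-1} K u` by the coupling `K`. -/
noncomputable def precondErr (P : Problem d q Ξ Z) (p : Params d q) (D : ℕ → Ω → Draws Ξ Z)
    (k : ℕ) (ω : Ω) : EuclideanSpace ℝ (Fin d) :=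
  diagMul (precondAt P p D k ω) (coupling P (pt (auxAt P p D k ω)
    (P.lowerSol (auxAt P p D k ω))) (endErr P p D k ω))

lemma measurable_precondGrad (s : Setup Pr P p D μ ℓf0 ℓf1 ℓg1 ℓg2 σf σg1 σg2 M) (k : ℕ) :
    Measurable[sig D (innerDraws k p.T)] (precondGrad P p D k) := by
  have h1 := (s.standing.continuous_gradient_V.measurable.comp (s.measurable_auxAt_past k))
  have h2 := measurable_diagMul (s.measurable_precondAt_past k) h1
  exact h2.mono (past_le_inner D k p.T) le_rfl

lemma measurable_precondErr (s : Setup Pr P p D μ ℓf0 ℓf1 ℓg1 ℓg2 σf σg1 σg2 M) (k : ℕ) :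
    Measurable[sig D (innerDraws k p.T)] (precondErr P p D k) := by
  have hz := (s.measurable_auxAt_past k).mono (past_le_inner D k p.T) le_rfl
  have h1 := measurable_pt hz (s.measurable_lowerSol.comp hz)
  have h2 := s.standing.continuous_coupling_apply.measurable.comp
    (h1.prodMk (s.measurable_endErr_draws k))
  have h3 : ∀ i, Measurable[sig D (innerDraws k p.T)] fun ω => precondAt P p D k ω i := fun i =>
    (s.measurable_precondAt_past k i).mono (past_le_inner D k p.T) le_rfl
  exact measurable_diagMul h3 h2

lemma norm_precondErr_le (s : Setup Pr P p D μ ℓf0 ℓf1 ℓg1 ℓg2 σf σg1 σg2 M) {C : ℝ} {k : ℕ} {ω : Ω}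
    (h : PathBound P p D M C k ω) :
    ‖precondErr P p D k ω‖ ≤ couplingBound p.δ μ ℓg1 * ‖endErr P p D k ω‖ := by
  have h0 : 0 ≤ p.δ ^ (-(1 / 2) : ℝ) := Real.rpow_nonneg s.delta_pos.le _
  have e1 := norm_diagMul_le h0 (fun i => (abs_of_nonneg (h.precond_nonneg i)).trans_le
    (h.precond_le i)) (coupling P (pt (auxAt P p D k ω)
      (P.lowerSol (auxAt P p D k ω))) (endErr P p D k ω))
  have e2 := mul_le_mul_of_nonneg_left (s.standing.norm_coupling_apply_le
    (pt (auxAt P p D k ω) (P.lowerSol (auxAt P p D k ω))) (endErr P p D k ω)) h0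
  rw [← mul_assoc] at e2
  exact e1.trans e2

variable [IsProbabilityMeasure Pr]

lemma memLp_precondGrad (s : Setup Pr P p D μ ℓf0 ℓf1 ℓg1 ℓg2 σf σg1 σg2 M) (k : ℕ) :
    MemLp (precondGrad P p D k) 2 Pr := by
  obtain ⟨C, -, hpath, -⟩ := s.exists_pathBound
  have h0 : 0 ≤ p.δ ^ (-(1 / 2) : ℝ) := Real.rpow_nonneg s.delta_pos.le _
  refine MemLp.of_bound ((s.measurable_precondGrad k).mono (s.sampling.sig_le _)
    le_rfl).aestronglyMeasurable (p.δ ^ (-(1 / 2) : ℝ) * (ℓf0 + ℓg1 * (1 / μ) * ℓf0)) ?_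
  filter_upwards [hpath k] with ω hω
  exact (norm_diagMul_le h0 (fun i => (abs_of_nonneg (hω.precond_nonneg i)).trans_le
    (hω.precond_le i)) _).trans (mul_le_mul_of_nonneg_left (s.standing.norm_gradient_V_le _) h0)

lemma memLp_precondErr (s : Setup Pr P p D μ ℓf0 ℓf1 ℓg1 ℓg2 σf σg1 σg2 M) (k : ℕ) :
    MemLp (precondErr P p D k) 2 Pr := by
  obtain ⟨C, -, hpath, -⟩ := s.exists_pathBound
  refine (s.memLp_endErr k).of_le_mul (c := couplingBound p.δ μ ℓg1)
    ((s.measurable_precondErr k).mono (s.sampling.sig_le _) le_rfl).aestronglyMeasurable ?_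
  filter_upwards [hpath k] with ω hω
  exact s.norm_precondErr_le hω

/-- Mean decrease of the objective along the auxiliary iterates. -/
lemma exists_descent (s : Setup Pr P p D μ ℓf0 ℓf1 ℓg1 ℓg2 σf σg1 σg2 M) {L : ℝ} (hL0 : 0 ≤ L)
    (hL : ∀ x y, ‖surrogate P x - surrogate P y‖ ≤ L * ‖x - y‖) :
    ∃ C : ℝ, 0 ≤ C ∧ ∀ k,
      p.gam k * ((p.δ + M ^ 2) ^ (-(1 / 2) : ℝ) / 2
            * ∫ ω, ‖gradient P.V (auxAt P p D k ω)‖ ^ 2 ∂Pr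
          - 3 * p.δ ^ (-(1 / 2) : ℝ) / 2 * (neumannBias μ ℓf0 ℓg1 p.N ^ 2
            + L ^ 2 * ∫ ω, ‖endErr P p D k ω‖ ^ 2 ∂Pr))
        ≤ ∫ ω, P.V (auxAt P p D k ω) ∂Pr - ∫ ω, P.V (auxAt P p D (k + 1) ω) ∂Pr
          + C * ∫ ω, decreaseAt P p D k ω ∂Pr + C * p.gam k ^ 2 := by
  obtain ⟨C, hC, hpath, -⟩ := s.exists_pathBound
  obtain ⟨CV, hCV, hV⟩ := s.standing.exists_V_taylor
  have hμ := s.standing.mu_pos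
  set G : ℝ := ℓf0 + ℓg1 * (1 / μ) * ℓf0 with hG
  have hG0 : 0 ≤ G := by positivity
  set a := (p.δ + M ^ 2) ^ (-(1 / 2) : ℝ)
  set t := p.δ ^ (-(1 / 2) : ℝ)
  have ht : 0 ≤ t := Real.rpow_nonneg s.delta_pos.le _
  set b := neumannBias μ ℓf0 ℓg1 p.N
  have hg0 := s.gam_pos 0
  -- The first summand is the second-order term of `V`; the second collects the lag `θ_k - z_k`, of
  -- order `γ³`, with one factor bounded by its initial value.
  set B := CV * C ^ 2 + p.gam 0 * (3 * t / 2 * (L ^ 2 * C ^ 2)) with hB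
  have hB0 : 0 ≤ B := by positivity
  refine ⟨G * C + B, by positivity, fun k => ?_⟩
  have hg := s.gam_pos k
  have hgle := s.gam_le_zero k
  have hw := s.memLp_precondGrad k
  have hI1 := s.integrable_inner_updateAt k hw
  have hI2 := s.integrable_inner_truncSurrogate k hw
  -- The vector `A_{k-1} ∇V(z_k)` is known before the draws of iteration `k`, so only the
  -- conditional mean of the update matters.
  have hmean : ∫ ω, inner ℝ (precondGrad P p D k ω) (updateAt P p D k ω) ∂Pr
      = ∫ ω, inner ℝ (precondGrad P p D k ω)
        (truncSurrogate P p.ℓ p.N (evalPt P p D k ω)) ∂Pr :=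
    s.integral_inner_updateAt k (s.measurable_precondGrad k) hI1
  obtain ⟨hJ1, hJ2⟩ := integral_lin_comb (s.integrable_V_auxAt k) (s.integrable_V_auxAt (k + 1))
    (s.integrable_decreaseAt k) 1 (-1) (G * C) (CV * C ^ 2 * p.gam k ^ 2)
  obtain ⟨hJ3, hJ4⟩ := integral_lin_comb (s.integrable_gradient_V_auxAt k) (s.integrable_endErr k)
    (s.integrable_endErr k) (a / 2) (-(3 * t / 2 * L ^ 2)) 0
    (-(3 * t / 2 * (b ^ 2 + L ^ 2 * (C * p.gam k) ^ 2)))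
  have step1 : p.gam k * ∫ ω, inner ℝ (precondGrad P p D k ω) (updateAt P p D k ω) ∂Pr
      ≤ 1 * ∫ ω, P.V (auxAt P p D k ω) ∂Pr + -1 * ∫ ω, P.V (auxAt P p D (k + 1) ω) ∂Pr
        + G * C * ∫ ω, decreaseAt P p D k ω ∂Pr + CV * C ^ 2 * p.gam k ^ 2 := by
    rw [← hJ2, ← integral_const_mul]
    refine integral_mono_ae (hI1.const_mul _) hJ1 ?_
    filter_upwards [hpath k] with ω hω
    have e1 := (abs_le.mp (hV (auxAt P p D k ω) (auxAt P p D (k + 1) ω))).2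
    rw [← s.standing.gradient_V] at e1
    have e2 := mul_le_mul_of_nonneg_left (pow_le_pow_left₀ (norm_nonneg _) hω.move 2) hCV
    have e3 := real_inner_le_norm (gradient P.V (auxAt P p D k ω)) (auxAt P p D (k + 1) ω
      - auxAt P p D k ω + p.gam k • diagMul (precondAt P p D k ω) (updateAt P p D k ω))
    have e4 := mul_le_mul (s.standing.norm_gradient_V_le (auxAt P p D k ω)) hω.rem
      (norm_nonneg _) hG0
    rw [inner_add_right, inner_smul_right, ← inner_diagMul] at e3
    simp only [precondGrad]
    linarith
  have step2 : a / 2 * ∫ ω, ‖gradient P.V (auxAt P p D k ω)‖ ^ 2 ∂Pr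
      + -(3 * t / 2 * L ^ 2) * ∫ ω, ‖endErr P p D k ω‖ ^ 2 ∂Pr
      + 0 * ∫ ω, ‖endErr P p D k ω‖ ^ 2 ∂Pr
      + -(3 * t / 2 * (b ^ 2 + L ^ 2 * (C * p.gam k) ^ 2))
      ≤ ∫ ω, inner ℝ (precondGrad P p D k ω)
        (truncSurrogate P p.ℓ p.N (evalPt P p D k ω)) ∂Pr := by
    rw [← hJ4]
    refine integral_mono_ae hJ3 hI2 ?_
    filter_upwards [hpath k] with ω hω
    have e1 := half_sub_le_inner_diagMul hω.le_precond hω.precond_le hω.precond_nonneg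
      (gradient P.V (auxAt P p D k ω)) (truncSurrogate P p.ℓ p.N (evalPt P p D k ω))
    have e2 := s.norm_truncSurrogate_sub_gradient_le hL0 hL k ω
    have e3 := mul_le_mul_of_nonneg_left (add_le_add_left hω.dist ‖endErr P p D k ω‖) hL0
    have e4 : ‖truncSurrogate P p.ℓ p.N (evalPt P p D k ω)
        - gradient P.V (auxAt P p D k ω)‖ ^ 2
        ≤ 3 * (b ^ 2 + L ^ 2 * (C * p.gam k) ^ 2 + L ^ 2 * ‖endErr P p D k ω‖ ^ 2) := by
      refine (pow_le_pow_left₀ (norm_nonneg _)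
        (e2.trans (add_le_add_right e3 _)) 2).trans ?_
      rw [← sq_abs b]
      nlinarith [sq_nonneg (|b| - L * (C * p.gam k)), sq_nonneg (|b| - L * ‖endErr P p D k ω‖),
        sq_nonneg (L * (C * p.gam k) - L * ‖endErr P p D k ω‖)]
    have e5 := mul_le_mul_of_nonneg_left e4 (by positivity : 0 ≤ t / 2)
    simp only [precondGrad]
    linarith
  have step3 := mul_le_mul_of_nonneg_left step2 hg.le
  rw [← hmean] at step3
  have hτ : 0 ≤ ∫ ω, decreaseAt P p D k ω ∂Pr := integral_nonneg_of_ae (by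
    filter_upwards [hpath k] with ω hω using hω.decrease_nonneg)
  have e1 := mul_nonneg hB0 hτ
  have e2 : p.gam k * (3 * t / 2 * (L ^ 2 * (C * p.gam k) ^ 2))
      ≤ p.gam 0 * (3 * t / 2 * (L ^ 2 * C ^ 2)) * p.gam k ^ 2 := by
    have := mul_le_mul_of_nonneg_right hgle
      (by positivity : 0 ≤ 3 * t / 2 * (L ^ 2 * (C * p.gam k) ^ 2))
    linarith
  have e3 : 0 ≤ G * C * p.gam k ^ 2 := by positivity
  rw [hB] at *
  linarith

/-- Drift of the mean squared lower-level error when the auxiliary iterate moves. -/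
lemma exists_tracking (s : Setup Pr P p D μ ℓf0 ℓf1 ℓg1 ℓg2 σf σg1 σg2 M) {L : ℝ} (hL0 : 0 ≤ L)
    (hL : ∀ x y, ‖surrogate P x - surrogate P y‖ ≤ L * ‖x - y‖) {ε : ℝ} (hε : 0 < ε) :
    ∃ C : ℝ, 0 ≤ C ∧ ∀ k,
      ∫ ω, ‖startErr P p D (k + 1) ω‖ ^ 2 ∂Pr
        ≤ ∫ ω, ‖endErr P p D k ω‖ ^ 2 ∂Pr
          + p.gam k * (couplingBound p.δ μ ℓg1
            * ((2 + 3 * L) * ∫ ω, ‖endErr P p D k ω‖ ^ 2 ∂Pr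
              + ∫ ω, ‖gradient P.V (auxAt P p D k ω)‖ ^ 2 ∂Pr + neumannBias μ ℓf0 ℓg1 p.N ^ 2))
          + ε * p.gam k * ∫ ω, ‖endErr P p D k ω‖ ^ 2 ∂Pr
          + C * ∫ ω, decreaseAt P p D k ω ∂Pr + C * p.gam k ^ 2 := by
  obtain ⟨C, hC, hpath, -⟩ := s.exists_pathBound
  obtain ⟨CR, hCR, hR⟩ := s.standing.exists_lowerSol_taylor
  have hμ := s.standing.mu_pos
  set κ := Real.sqrt ((ℓg1 : ℝ) ^ 2 - μ ^ 2) * (1 / μ) with hκ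
  have hκ0 : 0 ≤ κ := by positivity
  set c := couplingBound p.δ μ ℓg1
  have hc0 : 0 ≤ c := mul_nonneg (Real.rpow_nonneg s.delta_pos.le _) hκ0
  set b := neumannBias μ ℓf0 ℓg1 p.N
  have hg0 := s.gam_pos 0
  set C1 := 2 * (κ * C) ^ 2 / ε * C with hC1
  set C2 := 2 * (CR * C ^ 2) ^ 2 / ε * p.gam 0 + (ℓg1 * (1 / μ) * C) ^ 2 with hC2
  set C3 := p.gam 0 * (c * (L * C ^ 2)) with hC3
  have h1 : 0 ≤ C1 := by positivity
  have h2 : 0 ≤ C2 := by positivity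
  have h3 : 0 ≤ C3 := by positivity
  refine ⟨C1 + C2 + C3, by positivity, fun k => ?_⟩
  have hg := s.gam_pos k
  have hgle := s.gam_le_zero k
  have hw := s.memLp_precondErr k
  have hI1 := s.integrable_inner_updateAt k hw
  have hI2 := s.integrable_inner_truncSurrogate k hw
  -- Here the known vector contains `φ_{k+1}`, hence the inner samples of iteration `k`; these are
  -- still independent of the draws that form the update.
  have hmean : ∫ ω, inner ℝ (precondErr P p D k ω) (updateAt P p D k ω) ∂Pr
      = ∫ ω, inner ℝ (precondErr P p D k ω)
        (truncSurrogate P p.ℓ p.N (evalPt P p D k ω)) ∂Pr :=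
    s.integral_inner_updateAt k (s.measurable_precondErr k) hI1
  obtain ⟨hJ1, hJ2⟩ := integral_lin_comb (s.integrable_endErr k) hI1
    (s.integrable_decreaseAt k) (1 + ε * p.gam k) (-(2 * p.gam k)) C1 (C2 * p.gam k ^ 2)
  obtain ⟨hJ3, hJ4⟩ := integral_lin_comb (s.integrable_endErr k) (s.integrable_gradient_V_auxAt k)
    (s.integrable_endErr k) (-(c * (2 + 3 * L))) (-c) 0
    (-(c * (b ^ 2 + L * (C * p.gam k) ^ 2)))
  have step1 : ∫ ω, ‖startErr P p D (k + 1) ω‖ ^ 2 ∂Pr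
      ≤ (1 + ε * p.gam k) * ∫ ω, ‖endErr P p D k ω‖ ^ 2 ∂Pr
        + -(2 * p.gam k) * ∫ ω, inner ℝ (precondErr P p D k ω) (updateAt P p D k ω) ∂Pr
        + C1 * ∫ ω, decreaseAt P p D k ω ∂Pr + C2 * p.gam k ^ 2 := by
    rw [← hJ2]
    refine integral_mono_ae ((s.memLp_startErr (k + 1)).integrable_norm_pow (by norm_num)) hJ1 ?_
    filter_upwards [hpath k] with ω hω
    set z := auxAt P p D k ω
    set z' := auxAt P p D (k + 1) ω
    set u := endErr P p D k ω
    set τ := decreaseAt P p D k ω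
    have hsub : startErr P p D (k + 1) ω = u - (P.lowerSol z' - P.lowerSol z) :=
      (sub_sub_sub_cancel_right _ _ _).symm
    have e1 := (abs_le.mp (hR z z' u)).1
    have e2 := real_inner_le_norm (coupling P (pt z (P.lowerSol z)) u) (z' - z
      + p.gam k • diagMul (precondAt P p D k ω) (updateAt P p D k ω))
    have e3 := mul_le_mul (s.standing.norm_coupling_apply_le (pt z (P.lowerSol z)) u) hω.rem
      (norm_nonneg _) (mul_nonneg hκ0 (norm_nonneg u))
    rw [inner_add_right, inner_smul_right, ← inner_diagMul] at e2
    have e4 : ‖P.lowerSol z' - P.lowerSol z‖ ^ 2 ≤ (ℓg1 * (1 / μ) * C) ^ 2 * p.gam k ^ 2 := by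
      rw [← mul_pow, mul_assoc _ C]
      exact pow_le_pow_left₀ (norm_nonneg _) ((s.standing.norm_lowerSol_sub_le z z').trans
        (mul_le_mul_of_nonneg_left hω.move (by positivity))) 2
    have e5 : CR * ‖u‖ * ‖z' - z‖ ^ 2 ≤ CR * ‖u‖ * (C * p.gam k) ^ 2 :=
      mul_le_mul_of_nonneg_left (pow_le_pow_left₀ (norm_nonneg _) hω.move 2) (by positivity)
    -- The bound `τ² ≤ C γ τ` lets the cross term be paid by `ε γ ‖u‖² / 2` and a multiple of the
    -- summable `τ`. The quadratic remainder in `y2` uses the other half of `ε`.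
    have y1 := two_mul_le_young (n := ‖u‖) (x := κ * C) (y := τ) (z := C * τ) hε hg (by
      have := mul_le_mul_of_nonneg_right hω.decrease_le hω.decrease_nonneg
      change τ * τ ≤ _ * τ at this
      linarith)
    have y2 := two_mul_le_young (n := ‖u‖) (x := CR * C ^ 2) (y := p.gam k ^ 2)
      (z := p.gam 0 * p.gam k ^ 2) hε hg (by
        have := mul_le_mul_of_nonneg_right hgle (by positivity : 0 ≤ p.gam k ^ 3)
        linarith)
    change ‖startErr P p D (k + 1) ω‖ ^ 2 ≤ (1 + ε * p.gam k) * ‖u‖ ^ 2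
      + -(2 * p.gam k) * inner ℝ (diagMul (precondAt P p D k ω)
        (coupling P (pt z (P.lowerSol z)) u)) (updateAt P p D k ω) + C1 * τ + C2 * p.gam k ^ 2
    rw [hsub, norm_sub_sq_real, hC1, hC2]
    linarith
  have step2 : -(c * (2 + 3 * L)) * ∫ ω, ‖endErr P p D k ω‖ ^ 2 ∂Pr
      + -c * ∫ ω, ‖gradient P.V (auxAt P p D k ω)‖ ^ 2 ∂Pr
      + 0 * ∫ ω, ‖endErr P p D k ω‖ ^ 2 ∂Pr + -(c * (b ^ 2 + L * (C * p.gam k) ^ 2))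
      ≤ 2 * ∫ ω, inner ℝ (precondErr P p D k ω)
        (truncSurrogate P p.ℓ p.N (evalPt P p D k ω)) ∂Pr := by
    rw [← hJ4, ← integral_const_mul]
    refine integral_mono_ae hJ3 (hI2.const_mul _) ?_
    filter_upwards [hpath k] with ω hω
    set n := ‖endErr P p D k ω‖ with hn
    set v := gradient P.V (auxAt P p D k ω)
    set T := truncSurrogate P p.ℓ p.N (evalPt P p D k ω)
    have e1 := neg_le_of_abs_le (abs_real_inner_le_norm (precondErr P p D k ω) T)
    have e2 := s.norm_truncSurrogate_sub_gradient_le hL0 hL k ω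
    have e3 := mul_le_mul_of_nonneg_left (add_le_add_left hω.dist n) hL0
    have e4 : ‖T‖ ≤ ‖v‖ + (|b| + L * (C * p.gam k + n)) := by
      have := norm_le_norm_add_norm_sub v T
      rw [norm_sub_rev] at this
      linarith
    have e5 := mul_le_mul (s.norm_precondErr_le hω) e4 (norm_nonneg _)
      (mul_nonneg hc0 (norm_nonneg _))
    -- Each cross product with `n` is split evenly; the three splittings account for the coefficient
    -- `2 + 3 L`.
    have e6 : 2 * (n * (‖v‖ + (|b| + L * (C * p.gam k + n))))
        ≤ (2 + 3 * L) * n ^ 2 + ‖v‖ ^ 2 + b ^ 2 + L * (C * p.gam k) ^ 2 := by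
      rw [← sq_abs b]
      have y1 := sq_nonneg (n - ‖v‖)
      have y2 := sq_nonneg (n - |b|)
      have y3 := mul_nonneg hL0 (sq_nonneg (n - C * p.gam k))
      linarith
    have e7 := mul_le_mul_of_nonneg_left e6 hc0
    linarith
  have step3 := mul_le_mul_of_nonneg_left step2 hg.le
  rw [← hmean] at step3
  have hτ : 0 ≤ ∫ ω, decreaseAt P p D k ω ∂Pr := integral_nonneg_of_ae (by
    filter_upwards [hpath k] with ω hω using hω.decrease_nonneg)
  have e1 := mul_nonneg h2 hτ
  have e2 := mul_nonneg h3 hτ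
  have e3 : p.gam k * (c * (L * (C * p.gam k) ^ 2)) ≤ C3 * p.gam k ^ 2 := by
    have := mul_le_mul_of_nonneg_right hgle (by positivity : 0 ≤ c * (L * (C * p.gam k) ^ 2))
    rw [hC3]
    linarith
  have e4 : 0 ≤ C1 * p.gam k ^ 2 := by positivity
  linarith

end Setup

end Bilevel

/-! ### Combination of the two drifts -/

namespace Bilevel

/-- `W + (12 t L² / x) u` acts as a Lyapunov function. Of the gain `x/2 · g e` of the inner loop,
`x/4` pays for the Young term and, by `h1`, `x/8` for the feedback of `e`. The remaining `x/8`,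
multiplied by `12 t L² / x`, cancels `3 t L² e / 2` in the descent. By `h2` the feedback of `v` uses
at most half of `a/2`, and rescaling by `4 / a` gives the coefficient of `b²`. -/
lemma LogBdd.of_descent_of_tracking {g v e u τ W : ℕ → ℝ} {a b c t x L B C₁ C₂ C₃ : ℝ}
    (ha : 0 < a) (hx : 0 < x) (ht : 0 ≤ t) (hC₁ : 0 ≤ C₁) (hC₂ : 0 ≤ C₂) (hC₃ : 0 ≤ C₃)
    (hg : ∀ k, 0 < g k) (he : ∀ k, 0 ≤ e k) (hv : ∀ k, 0 ≤ v k) (hu : ∀ k, 0 ≤ u k)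
    (hW : ∀ k, B ≤ W k)
    (hτ : LogBdd τ) (hg2 : LogBdd fun k => g k ^ 2)
    (hdesc : ∀ k, g k * (a / 2 * v k - 3 * t / 2 * (b ^ 2 + L ^ 2 * e k))
      ≤ W k - W (k + 1) + C₁ * τ k + C₁ * g k ^ 2)
    (htrack : ∀ k, u (k + 1) ≤ e k + g k * (c * ((2 + 3 * L) * e k + v k + b ^ 2))
      + x / 4 * g k * e k + C₂ * τ k + C₂ * g k ^ 2)
    (hloop : ∀ᶠ k in Filter.atTop, x / 2 * g k * e k ≤ u k - e k + C₃ * g k ^ 2)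
    (h1 : c * (2 + 3 * L) ≤ x / 8) (h2 : 12 * t * L ^ 2 / x * c ≤ a / 4) :
    LogBdd fun k => g k * (v k - (6 * t / a + 1) * b ^ 2) := by
  have hlow : LogBdd fun k => g k * (x / 8 * e k - c * (v k + b ^ 2)) := by
    refine (((LogBdd.telescope hu).add (hτ.const_mul hC₂)).add
      (hg2.const_mul (add_nonneg hC₂ hC₃))).mono_eventually ?_
    filter_upwards [hloop] with k hk
    have e1 := htrack k
    have e2 := mul_le_mul_of_nonneg_left (mul_le_mul_of_nonneg_right h1 (he k)) (hg k).le
    linarith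
  have hdesc' : LogBdd fun k => g k * (a / 2 * v k - 3 * t / 2 * (b ^ 2 + L ^ 2 * e k)) :=
    (((LogBdd.telescope hW).add (hτ.const_mul hC₁)).add (hg2.const_mul hC₁)).mono hdesc
  have hl0 : 0 ≤ 12 * t * L ^ 2 / x := by positivity
  refine ((hdesc'.add (hlow.const_mul hl0)).const_mul (by positivity : 0 ≤ 4 / a)).mono fun k => ?_
  have e1 : 12 * t * L ^ 2 / x * (g k * (x / 8 * e k - c * (v k + b ^ 2)))
      = g k * (3 * t / 2 * (L ^ 2 * e k) - 12 * t * L ^ 2 / x * c * (v k + b ^ 2)) := by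
    field_simp
    ring
  have e2 := mul_le_mul_of_nonneg_right h2 (add_nonneg (hv k) (sq_nonneg b))
  have e3 := mul_le_mul_of_nonneg_left e2 (hg k).le
  rw [e1]
  have e4 : g k * (v k - (6 * t / a + 1) * b ^ 2)
      = 4 / a * (g k * (a / 4 * v k - (3 * t / 2 + a / 4) * b ^ 2)) := by
    field_simp
    ring
  rw [e4]
  refine mul_le_mul_of_nonneg_left ?_ (by positivity)
  linarith

namespace Setup

variable {d q : ℕ} {Ξ Z Ω : Type*} [MeasurableSpace Ξ] [MeasurableSpace Z]
  [mΩ : MeasurableSpace Ω] {Pr : Measure Ω} {P : Problem d q Ξ Z} {p : Params d q}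
  {D : ℕ → Ω → Draws Ξ Z} {μ : ℝ} {ℓf0 ℓf1 ℓg1 ℓg2 σf σg1 σg2 : ℝ≥0} {M : ℝ}

variable [IsProbabilityMeasure Pr]

lemma logBdd_integral_decreaseAt (s : Setup Pr P p D μ ℓf0 ℓf1 ℓg1 ℓg2 σf σg1 σg2 M) :
    LogBdd fun k => ∫ ω, decreaseAt P p D k ω ∂Pr := by
  obtain ⟨C, -, -, hsum⟩ := s.exists_pathBound
  refine LogBdd.of_sum_le (C := C) fun n => ?_
  rw [← integral_finsetSum _ fun k _ => s.integrable_decreaseAt k]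
  refine (integral_mono_ae (integrable_finsetSum _ fun k _ => s.integrable_decreaseAt k)
    (integrable_const C) ?_).trans (by simp)
  filter_upwards [hsum] with ω hω using hω (n + 1)

/-- The weighted mean squared gradients along the iterates, up to the Neumann bias. -/
lemma logBdd_gradient (s : Setup Pr P p D μ ℓf0 ℓf1 ℓg1 ℓg2 σf σg1 σg2 M)
    (hbdd : BddBelow (Set.range P.V)) {L : ℝ} (hL0 : 0 ≤ L)
    (hL : ∀ x y, ‖surrogate P x - surrogate P y‖ ≤ L * ‖x - y‖)
    (h1 : couplingBound p.δ μ ℓg1 * (2 + 3 * L) ≤ p.ratio * μ / 8)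
    (h2 : 12 * p.δ ^ (-(1 / 2) : ℝ) * L ^ 2 / (p.ratio * μ) * couplingBound p.δ μ ℓg1
      ≤ (p.δ + M ^ 2) ^ (-(1 / 2) : ℝ) / 4) :
    LogBdd fun k => p.gam k * (∫ ω, ‖gradient P.V (iterate P p D k ω)‖ ^ 2 ∂Pr
      - 2 * (6 * p.δ ^ (-(1 / 2) : ℝ) / (p.δ + M ^ 2) ^ (-(1 / 2) : ℝ) + 1)
        * neumannBias μ ℓf0 ℓg1 p.N ^ 2) := by
  obtain ⟨C, hC, hpath, -⟩ := s.exists_pathBound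
  obtain ⟨C₁, hC₁, hdesc⟩ := s.exists_descent hL0 hL
  have hx : 0 < p.ratio * μ := mul_pos s.ratio_pos s.standing.mu_pos
  obtain ⟨C₂, hC₂, htrack⟩ := s.exists_tracking hL0 hL (ε := p.ratio * μ / 4) (by positivity)
  obtain ⟨C₃, hC₃, hloop⟩ := s.exists_inner_loop_le
  obtain ⟨B, hB⟩ := hbdd
  have ha : 0 < (p.δ + M ^ 2) ^ (-(1 / 2) : ℝ) :=
    Real.rpow_pos_of_pos (by linarith [s.delta_pos, sq_nonneg M]) _
  have ht : 0 ≤ p.δ ^ (-(1 / 2) : ℝ) := Real.rpow_nonneg s.delta_pos.le _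
  have hW : ∀ k, B ≤ ∫ ω, P.V (auxAt P p D k ω) ∂Pr := fun k => by
    have := integral_mono (integrable_const B) (s.integrable_V_auxAt k)
      fun ω => hB (Set.mem_range_self (auxAt P p D k ω))
    simpa using this
  have key := LogBdd.of_descent_of_tracking ha hx ht hC₁ hC₂ hC₃ s.gam_pos
    (fun k => integral_nonneg fun ω => sq_nonneg _) (fun k => integral_nonneg fun ω => sq_nonneg _)
    (fun k => integral_nonneg fun ω => sq_nonneg _) hW s.logBdd_integral_decreaseAt logBdd_gam_sq
    hdesc htrack hloop h1 h2
  -- Transfer from `z_k` back to `θ_k`: the gradients differ by at most `L' γ`, so squaring doubles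
  -- the coefficient of the bias and adds a term of order `γ³`.
  set L' := L * (1 + ℓg1 * (1 / μ)) * C
  have hg0 := s.gam_pos 0
  refine ((key.const_mul zero_le_two).add ((logBdd_gam_sq (p := p)).const_mul
    (by positivity : 0 ≤ p.gam 0 * (2 * L' ^ 2)))).mono fun k => ?_
  have hg := s.gam_pos k
  have hgle := s.gam_le_zero k
  have hint := integral_lin_comb (s.integrable_gradient_V_auxAt k)
    (s.integrable_gradient_V_auxAt k) (s.integrable_gradient_V_auxAt k) 2 0 0
    (2 * (L' * p.gam k) ^ 2)
  have hle : ∫ ω, ‖gradient P.V (iterate P p D k ω)‖ ^ 2 ∂Pr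
      ≤ 2 * ∫ ω, ‖gradient P.V (auxAt P p D k ω)‖ ^ 2 ∂Pr + 2 * (L' * p.gam k) ^ 2 := by
    have e0 := hint.2
    rw [zero_mul, add_zero, add_zero] at e0
    rw [← e0]
    refine integral_mono_of_nonneg (Filter.Eventually.of_forall fun ω => sq_nonneg _) hint.1 ?_
    filter_upwards [hpath k] with ω hω
    have e1 := hL (pt (iterate P p D k ω) (P.lowerSol (iterate P p D k ω)))
      (pt (auxAt P p D k ω) (P.lowerSol (auxAt P p D k ω)))
    have e2 := mul_le_mul_of_nonneg_left
      (s.standing.norm_pt_lowerSol_sub_le (auxAt P p D k ω) (iterate P p D k ω)) hL0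
    have hμ := s.standing.mu_pos
    have e3 := mul_le_mul_of_nonneg_left hω.dist
      (by positivity : 0 ≤ L * (1 + ℓg1 * (1 / μ)))
    rw [← s.standing.gradient_V, ← s.standing.gradient_V] at e1
    have e4 : ‖gradient P.V (iterate P p D k ω) - gradient P.V (auxAt P p D k ω)‖
        ≤ L' * p.gam k := by
      change L * (1 + ℓg1 * (1 / μ)) * ‖iterate P p D k ω - auxAt P p D k ω‖
        ≤ L * (1 + ℓg1 * (1 / μ)) * (C * p.gam k) at e3
      refine e1.trans (e2.trans ?_)
      rw [← mul_assoc]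
      refine e3.trans (le_of_eq ?_)
      ring
    have e5 := norm_le_norm_add_norm_sub (gradient P.V (auxAt P p D k ω))
      (gradient P.V (iterate P p D k ω))
    rw [norm_sub_rev] at e5
    have e6 := pow_le_pow_left₀ (norm_nonneg _) (e5.trans (add_le_add_right e4 _)) 2
    have e7 := sq_nonneg (‖gradient P.V (auxAt P p D k ω)‖ - L' * p.gam k)
    change ‖gradient P.V (iterate P p D k ω)‖ ^ 2
      ≤ 2 * ‖gradient P.V (auxAt P p D k ω)‖ ^ 2 + 0 * _ + 0 * _ + 2 * (L' * p.gam k) ^ 2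
    linarith
  have e1 := mul_le_mul_of_nonneg_left hle hg.le
  have e2 : p.gam k * (2 * (L' * p.gam k) ^ 2) ≤ p.gam 0 * (2 * L' ^ 2) * p.gam k ^ 2 := by
    have := mul_le_mul_of_nonneg_right hgle (by positivity : 0 ≤ 2 * (L' * p.gam k) ^ 2)
    linarith
  linarith

end Setup

/-! ### Averaging over a uniform random index -/

section uniformIndex

variable {d : ℕ} {Ω : Type*} [MeasurableSpace Ω] {Pr : Measure Ω} [IsProbabilityMeasure Pr]
  {θ : ℕ → Ω → EuclideanSpace ℝ (Fin d)} {n : ℕ} {R : Ω → ℕ}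

lemma IsUniformIndex.le_ae (h : IsUniformIndex Pr θ n R) : ∀ᵐ ω ∂Pr, R ω ≤ n := by
  have hm : ∀ j, MeasurableSet {ω | R ω = j} := fun j => h.measurable (measurableSet_singleton j)
  have hU : {ω | R ω ≤ n} = ⋃ j ∈ Finset.range (n + 1), {ω | R ω = j} := by
    ext ω; simp
  have hP : Pr {ω | R ω ≤ n} = 1 := by
    rw [hU, measure_biUnion_finset (fun i _ j _ hij => Set.disjoint_left.mpr fun ω h1 h2 =>
      hij (h1.symm.trans h2)) fun j _ => hm j]
    rw [Finset.sum_congr rfl fun j hj => h.law j (Nat.lt_succ_iff.mp (Finset.mem_range.mp hj))]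
    have h0 : (n : ℝ≥0∞) + 1 ≠ 0 := by simp
    simp [ENNReal.mul_inv_cancel h0]
  exact (prob_compl_eq_zero_iff (h.measurable measurableSet_Iic)).mpr hP

/-- The integrand is split by the value of `R`. Independence from the whole sequence factors each
piece, and every index carries the mass `1 / (n + 1)`. -/
lemma IsUniformIndex.integral_comp (h : IsUniformIndex Pr θ n R) (hθ : ∀ k, Measurable (θ k))
    {F : EuclideanSpace ℝ (Fin d) → ℝ} (hF : Measurable F) {G : ℝ} (hG : ∀ x, ‖F x‖ ≤ G) :
    Integrable (fun ω => F (θ (R ω) ω)) Pr ∧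
      ∫ ω, F (θ (R ω) ω) ∂Pr
        = ((n : ℝ) + 1)⁻¹ * ∑ k ∈ Finset.range (n + 1), ∫ ω, F (θ k ω) ∂Pr := by
  have hm : Measurable fun ω => F (θ (R ω) ω) :=
    hF.comp (measurable_comp_nat hθ h.measurable)
  have hFm : ∀ k, Measurable fun ω => F (θ k ω) := fun k => hF.comp (hθ k)
  have hFi : ∀ k, Integrable (fun ω => F (θ k ω)) Pr := fun k =>
    Integrable.of_bound (hFm k).aestronglyMeasurable G (Filter.Eventually.of_forall fun ω => hG _)
  refine ⟨Integrable.of_bound hm.aestronglyMeasurable G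
    (Filter.Eventually.of_forall fun ω => hG _), ?_⟩
  let I : ℕ → ℕ → ℝ := fun k => Set.indicator {k} 1
  have hIm : ∀ k, Measurable fun ω => I k (R ω) := fun k =>
    (measurable_from_nat (f := I k)).comp h.measurable
  have hIb : ∀ k, ∀ᵐ ω ∂Pr, ‖I k (R ω)‖ ≤ 1 := fun k =>
    Filter.Eventually.of_forall fun ω => by
      by_cases hk : R ω = k <;> simp [I, hk]
  have hsum : (fun ω => F (θ (R ω) ω))
      =ᵐ[Pr] fun ω => ∑ k ∈ Finset.range (n + 1), I k (R ω) * F (θ k ω) := by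
    filter_upwards [h.le_ae] with ω hω
    rw [Finset.sum_eq_single_of_mem (R ω) (Finset.mem_range.mpr (Nat.lt_succ_iff.mpr hω))]
    · simp [I]
    · intro k _ hk
      simp [I, Ne.symm hk]
  rw [integral_congr_ae hsum, integral_finsetSum _ fun k _ =>
    (hFi k).bdd_mul (hIm k).aestronglyMeasurable (hIb k), Finset.mul_sum]
  refine Finset.sum_congr rfl fun k hk => ?_
  have hind : IndepFun (fun ω => I k (R ω)) (fun ω => F (θ k ω)) Pr :=
    h.indep.comp (φ := I k) (ψ := fun x : ℕ → EuclideanSpace ℝ (Fin d) => F (x k))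
      measurable_from_nat (hF.comp (measurable_pi_apply k))
  rw [hind.integral_fun_mul_eq_mul_integral (hIm k).aestronglyMeasurable
    (hFm k).aestronglyMeasurable]
  congr 1
  have e : (fun ω => I k (R ω)) = Set.indicator {ω | R ω = k} 1 := by
    ext ω
    by_cases hk' : R ω = k <;> simp [I, hk']
  rw [e]
  refine (integral_indicator_one (h.measurable (measurableSet_singleton k))).trans ?_
  rw [measureReal_def]
  change (Pr {ω | R ω = k}).toReal = _
  rw [h.law k (Nat.lt_succ_iff.mp (Finset.mem_range.mp hk))]
  simp [ENNReal.toReal_inv, ENNReal.toReal_add]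

end uniformIndex

/-! ### Bounds at the random iterate -/

namespace Setup

variable {d q : ℕ} {Ξ Z Ω : Type*} [MeasurableSpace Ξ] [MeasurableSpace Z]
  [mΩ : MeasurableSpace Ω] {Pr : Measure Ω} {P : Problem d q Ξ Z} {p : Params d q}
  {D : ℕ → Ω → Draws Ξ Z} {μ : ℝ} {ℓf0 ℓf1 ℓg1 ℓg2 σf σg1 σg2 : ℝ≥0} {M : ℝ}
  [IsProbabilityMeasure Pr]

lemma integral_random_iterate (s : Setup Pr P p D μ ℓf0 ℓf1 ℓg1 ℓg2 σf σg1 σg2 M) {n : ℕ}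
    {R : Ω → ℕ} (hR : IsUniformIndex Pr (iterate P p D) n R) :
    Integrable (fun ω => ‖gradient P.V (iterate P p D (R ω) ω)‖ ^ 2) Pr ∧
      ∫ ω, ‖gradient P.V (iterate P p D (R ω) ω)‖ ^ 2 ∂Pr = ((n : ℝ) + 1)⁻¹
        * ∑ k ∈ Finset.range (n + 1), ∫ ω, ‖gradient P.V (iterate P p D k ω)‖ ^ 2 ∂Pr :=
  hR.integral_comp (fun k => (s.stateMeasurable k).θ)
    (F := fun θ => ‖gradient P.V θ‖ ^ 2) (s.standing.continuous_gradient_V.norm.pow 2).measurable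
    (G := (ℓf0 + ℓg1 * (1 / μ) * ℓf0) ^ 2) fun θ => by
      rw [norm_pow, norm_norm]
      exact pow_le_pow_left₀ (norm_nonneg _) (s.standing.norm_gradient_V_le θ) 2

/-- As `γ` decreases, the plain average is at most the `γ`-weighted sum divided by `(n + 1) γ_{n+1}
= c_γ √(n + 1)`, and this is at least `c_γ √n`. -/
lemma exists_randomIterateBound_of_logBdd
    (s : Setup Pr P p D μ ℓf0 ℓf1 ℓg1 ℓg2 σf σg1 σg2 M) {K b : ℝ}
    (h : LogBdd fun k => p.gam k
      * (∫ ω, ‖gradient P.V (iterate P p D k ω)‖ ^ 2 ∂Pr - K * b ^ 2)) :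
    ∃ C : ℝ, RandomIterateBound Pr P (iterate P p D) fun n =>
      C * (Real.log n / Real.sqrt n + 1 / Real.sqrt n) + K / p.cUp * weightedBias p b n := by
  obtain ⟨C, hC⟩ := h
  refine ⟨2 * |C| / p.cUp, fun n hn R hR => ?_⟩
  obtain ⟨h1, h2⟩ := s.integral_random_iterate hR
  refine ⟨h1, ?_⟩
  rw [h2]
  set v : ℕ → ℝ := fun k => ∫ ω, ‖gradient P.V (iterate P p D k ω)‖ ^ 2 ∂Pr with hv
  have hv0 : ∀ k, 0 ≤ v k := fun k => integral_nonneg fun ω => sq_nonneg _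
  have hc := s.cUp_pos
  have hn1 : (1 : ℝ) ≤ n := by exact_mod_cast hn
  have hlog0 : 0 ≤ Real.log n := Real.log_nonneg hn1
  have hlog : Real.log ((n : ℝ) + 1) ≤ 1 + Real.log n := by
    have e1 : Real.log ((n : ℝ) + 1) ≤ Real.log (2 * n) :=
      Real.log_le_log (by linarith) (by linarith)
    rw [Real.log_mul two_ne_zero (by linarith)] at e1
    linarith [Real.log_two_lt_d9]
  have hS : ∑ k ∈ Finset.range (n + 1), p.gam k * v k
      ≤ 2 * |C| * (Real.log n + 1) + K * ∑ k ∈ Finset.range (n + 1), p.gam k * b ^ 2 := by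
    have e1 := hC n
    simp only [mul_sub, Finset.sum_sub_distrib] at e1
    have e2 : ∑ k ∈ Finset.range (n + 1), p.gam k * (K * b ^ 2)
        = K * ∑ k ∈ Finset.range (n + 1), p.gam k * b ^ 2 := by
      rw [Finset.mul_sum]
      exact Finset.sum_congr rfl fun k _ => by ring
    have e3 : C * (1 + Real.log (n + 1)) ≤ |C| * (2 * (Real.log n + 1)) := by
      refine (mul_le_mul_of_nonneg_right (le_abs_self C)
        (by linarith [LogBdd.one_le_weight n])).trans
        (mul_le_mul_of_nonneg_left (by linarith) (abs_nonneg C))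
    rw [e2] at e1
    linarith
  have hn0 : 0 < Real.sqrt n := Real.sqrt_pos.mpr (by linarith)
  have hn2 : 0 < Real.sqrt ((n : ℝ) + 1) := Real.sqrt_pos.mpr (by linarith)
  have hmean : ((n : ℝ) + 1)⁻¹ * ∑ k ∈ Finset.range (n + 1), v k
      ≤ (∑ k ∈ Finset.range (n + 1), p.gam k * v k) / (p.cUp * Real.sqrt n) := by
    have e1 : p.gam n * ∑ k ∈ Finset.range (n + 1), v k
        ≤ ∑ k ∈ Finset.range (n + 1), p.gam k * v k := by
      rw [Finset.mul_sum]
      exact Finset.sum_le_sum fun k hk => mul_le_mul_of_nonneg_right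
        (Params.gam_antitone hc (Nat.lt_succ_iff.mp (Finset.mem_range.mp hk))) (hv0 k)
    have e2 : ((n : ℝ) + 1)⁻¹ = p.gam n / (p.cUp * Real.sqrt (n + 1)) := by
      rw [p.gam_eq, div_div, mul_comm p.cUp (Real.sqrt _), ← mul_assoc,
        Real.mul_self_sqrt (by linarith)]
      field_simp
    rw [e2, div_mul_eq_mul_div]
    refine div_le_div₀ (Finset.sum_nonneg fun k _ => mul_nonneg (s.gam_pos k).le (hv0 k)) e1
      (mul_pos hc hn0) (mul_le_mul_of_nonneg_left (Real.sqrt_le_sqrt (by linarith)) hc.le)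
  refine hmean.trans ((div_le_div_of_nonneg_right hS (mul_pos hc hn0).le).trans (le_of_eq ?_))
  change _ = _ + K / p.cUp * ((∑ k ∈ Finset.range (n + 1), p.gam k * b ^ 2) / Real.sqrt n)
  generalize ∑ k ∈ Finset.range (n + 1), p.gam k * b ^ 2 = S
  field_simp

/-- All `n + 1` weights are at least the last one, so their sum exceeds `c_γ √n`. A nonzero Neumann
bias therefore keeps the bound of the first statement away from zero. -/
lemma le_weightedBias (hc : 0 < p.cUp) (b : ℝ) {n : ℕ} (hn : 1 ≤ n) :
    p.cUp * b ^ 2 ≤ weightedBias p b n := by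
  have hn1 : (1 : ℝ) ≤ n := by exact_mod_cast hn
  have hn0 : 0 < Real.sqrt n := Real.sqrt_pos.mpr (by linarith)
  rw [weightedBias, le_div_iff₀ hn0]
  have e1 : ∀ k ∈ Finset.range (n + 1), p.gam n * b ^ 2 ≤ p.stepUp (k + 1) * b ^ 2 := fun k hk =>
    mul_le_mul_of_nonneg_right
      (Params.gam_antitone hc (Nat.lt_succ_iff.mp (Finset.mem_range.mp hk))) (sq_nonneg b)
  have e2 := Finset.card_nsmul_le_sum _ _ _ e1
  refine le_trans ?_ e2
  have e3 : Real.sqrt n ≤ Real.sqrt ((n : ℝ) + 1) := Real.sqrt_le_sqrt (by linarith)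
  have e4 : ((n : ℝ) + 1) * p.gam n = p.cUp * Real.sqrt (n + 1) := by
    rw [p.gam_eq]
    have : Real.sqrt ((n : ℝ) + 1) * Real.sqrt (n + 1) = n + 1 :=
      Real.mul_self_sqrt (by linarith)
    field_simp
    rw [sq, this]
  rw [Finset.card_range, nsmul_eq_mul, ← mul_assoc]
  push_cast
  rw [e4]
  have := mul_le_mul_of_nonneg_left e3 (mul_nonneg hc.le (sq_nonneg b))
  linarith

/-- If the Neumann bias vanishes, so does the gradient or the coupling. -/
lemma couplingBound_eq_zero_or_of_neumannBias_eq_zero (hμ : 0 < μ) {N : ℕ}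
    (h : neumannBias μ ℓf0 ℓg1 N = 0) (δ : ℝ) : (ℓf0 : ℝ) = 0 ∨ couplingBound δ μ ℓg1 = 0 := by
  have key : (ℓf0 : ℝ) = 0 ∨ (ℓg1 : ℝ) ^ 2 ≤ μ ^ 2 := by
    rw [neumannBias, mul_eq_zero, mul_eq_zero, mul_eq_zero] at h
    rcases h with ((h | h) | h) | h
    · right
      rw [h, zero_pow two_ne_zero]
      exact sq_nonneg μ
    · exact Or.inl h
    · exact absurd h (by positivity)
    · right
      have h1 : 1 - μ / (ℓg1 : ℝ) = 0 := eq_zero_of_pow_eq_zero h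
      have h2 : (ℓg1 : ℝ) ≠ 0 := fun h0 => by simp [h0] at h1
      have h3 : μ = ℓg1 := by
        field_simp at h1
        linarith
      rw [h3]
  refine key.imp id fun h => ?_
  -- The real square root is zero on nonpositive numbers, which covers `ℓg1 = 0` along with `ℓg1 =
  -- μ`.
  rw [couplingBound, Real.sqrt_eq_zero_of_nonpos (by linarith)]
  simp

/-- No condition on the step constants is needed. With a nonzero bias the uniform bound on `∇V`
suffices. With zero bias either `∇V = 0`, or the coupling bound is zero and both conditions of
`logBdd_gradient` hold for every ratio of step sizes. -/
lemma exists_randomIterateBound (s : Setup Pr P p D μ ℓf0 ℓf1 ℓg1 ℓg2 σf σg1 σg2 M)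
    (hbdd : BddBelow (Set.range P.V)) :
    ∃ C : ℝ, RandomIterateBound Pr P (iterate P p D) fun n =>
      C * (Real.log n / Real.sqrt n
        + (weightedBias p (neumannBias μ ℓf0 ℓg1 p.N) n + 1 / Real.sqrt n)) := by
  have hc := s.cUp_pos
  set b := neumannBias μ ℓf0 ℓg1 p.N with hb
  set G : ℝ := ℓf0 + ℓg1 * (1 / μ) * ℓf0 with hG
  have hμ := s.standing.mu_pos
  have hsup : ∀ {n : ℕ} {R : Ω → ℕ}, IsUniformIndex Pr (iterate P p D) n R →
      Integrable (fun ω => ‖gradient P.V (iterate P p D (R ω) ω)‖ ^ 2) Pr ∧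
        ∫ ω, ‖gradient P.V (iterate P p D (R ω) ω)‖ ^ 2 ∂Pr ≤ G ^ 2 := fun {n R} hR => by
    have h1 := (s.integral_random_iterate hR).1
    refine ⟨h1, (integral_mono h1 (integrable_const (G ^ 2)) fun ω =>
      pow_le_pow_left₀ (norm_nonneg _) (s.standing.norm_gradient_V_le _) 2).trans (by simp)⟩
  by_cases hb0 : b = 0
  · rcases couplingBound_eq_zero_or_of_neumannBias_eq_zero hμ hb0 p.δ with h0 | h0
    · refine ⟨0, fun n _ R hR => ⟨(hsup hR).1, (hsup hR).2.trans (le_of_eq ?_)⟩⟩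
      rw [hG, h0]
      simp
    · obtain ⟨L, hL0, hL⟩ := s.standing.exists_surrogate_lipschitz
      have hr := mul_pos s.ratio_pos hμ
      have h := s.logBdd_gradient hbdd hL0 hL (by rw [h0]; linarith) (by
        rw [h0, mul_zero]
        exact div_nonneg (Real.rpow_nonneg (by linarith [s.delta_pos, sq_nonneg M]) _)
          zero_le_four)
      obtain ⟨C, hC⟩ := s.exists_randomIterateBound_of_logBdd h
      refine ⟨C, fun n hn R hR => ⟨(hC n hn R hR).1, (hC n hn R hR).2.trans (le_of_eq ?_)⟩⟩
      have hw : weightedBias p b n = 0 := by simp [weightedBias, hb0]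
      simp only [← hb, hw]
      ring
  · have hden : 0 < p.cUp * b ^ 2 :=
      mul_pos hc (lt_of_le_of_ne (sq_nonneg b) (Ne.symm (pow_ne_zero 2 hb0)))
    refine ⟨G ^ 2 / (p.cUp * b ^ 2), fun n hn R hR =>
      ⟨(hsup hR).1, (hsup hR).2.trans ?_⟩⟩
    have hn1 : (1 : ℝ) ≤ n := by exact_mod_cast hn
    have e1 : 0 ≤ Real.log n / Real.sqrt n := div_nonneg (Real.log_nonneg hn1) (Real.sqrt_nonneg _)
    have e2 : 0 ≤ 1 / Real.sqrt n := by positivity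
    have e3 := le_weightedBias (p := p) hc b hn
    calc G ^ 2 = G ^ 2 / (p.cUp * b ^ 2) * (p.cUp * b ^ 2) := by field_simp
      _ ≤ _ := mul_le_mul_of_nonneg_left (by linarith) (div_nonneg (sq_nonneg G) hden.le)

end Setup

/-- The left side is `√(1 + M² / δ)`, at most `1 + M² / δ`. It compares the extreme eigenvalues of
the preconditioner and is the source of the factor `1 + M²` beside `K`. -/
lemma rpow_neg_half_div_le {δ M : ℝ} (hδ : 0 < δ) :
    δ ^ (-(1 / 2) : ℝ) / (δ + M ^ 2) ^ (-(1 / 2) : ℝ) ≤ (1 + 1 / δ) * (1 + M ^ 2) := by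
  have h1 : 0 < δ + M ^ 2 := by positivity
  rw [Real.rpow_neg hδ.le, Real.rpow_neg h1.le, ← Real.sqrt_eq_rpow, ← Real.sqrt_eq_rpow,
    inv_div_inv, ← Real.sqrt_div h1.le]
  have h2 : (δ + M ^ 2) / δ = 1 + M ^ 2 / δ := by field_simp
  have h3 : 0 ≤ M ^ 2 / δ := by positivity
  have h4 : (1 + 1 / δ) * (1 + M ^ 2) = 1 + M ^ 2 / δ + (M ^ 2 + 1 / δ) := by field_simp; ring
  have h5 : 0 ≤ M ^ 2 + 1 / δ := by positivity
  rw [h2, h4]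
  exact (Real.sqrt_le_iff.mpr ⟨by linarith, by nlinarith⟩).trans (le_add_of_nonneg_right h5)

end Bilevel
-- The convergence theorem
theorem mainTheorem8 {d q : ℕ} {Ξ Z Ω : Type*}
    [MeasurableSpace Ξ] [MeasurableSpace Z] [MeasurableSpace Ω]
    (Pr : Measure Ω) [IsProbabilityMeasure Pr]
    (P : Bilevel.Problem d q Ξ Z) (hP : P.Regular)
    (μg : ℝ) (hconv : P.StronglyConvexLower μg)
    (ℓf0 ℓf1 ℓg1 ℓg2 : ℝ≥0) (hLip : P.LipschitzReg ℓf0 ℓf1 ℓg1 ℓg2)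
    (σf σg1 σg2 : ℝ≥0) (hvar : P.BoundedVariance σf σg1 σg2)
    (hbdd : BddBelow (Set.range P.V))
    (θ₀ : EuclideanSpace ℝ (Fin d)) (φ₀ : EuclideanSpace ℝ (Fin q))
    (ρ₁ ρ₂ δ : ℝ) (hρ₁ : ρ₁ ∈ Set.Ico (0 : ℝ) 1) (hρ₂ : ρ₂ ∈ Set.Ico (0 : ℝ) 1) (hδ : 0 < δ) :
    (∀ θ, P.IsLowerSol θ (P.lowerSol θ)) ∧ Differentiable ℝ P.V ∧
    ∃ K : ℝ, ∀ N T : ℕ, 1 ≤ N → 1 ≤ T → ∀ M : ℝ, ∃ κ : ℝ, ∀ cUp cLow : ℝ, 0 < cUp → 0 < cLow →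
      ∀ (p : Bilevel.Params d q), p = ⟨T, N, ℓg1, ρ₁, ρ₂, δ, θ₀, φ₀, cUp, cLow⟩ →
      ∀ D : ℕ → Ω → Bilevel.Draws Ξ Z, Bilevel.IsSampling Pr P N D →
        (∀ k, ∀ᵐ ω ∂Pr, ‖Bilevel.updateAt P p D k ω‖ ≤ M) →
        (∃ C : ℝ, Bilevel.RandomIterateBound Pr P (Bilevel.iterate P p D) fun n =>
          C * (Real.log n / Real.sqrt n
            + (Bilevel.weightedBias p (Bilevel.neumannBias μg ℓf0 ℓg1 N) n
                + 1 / Real.sqrt n))) ∧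
        (κ * cUp ≤ cLow →
          ∃ C : ℝ, Bilevel.RandomIterateBound Pr P (Bilevel.iterate P p D) fun n =>
            C * (Real.log n / Real.sqrt n + 1 / Real.sqrt n)
              + K * (1 + M ^ 2) / cUp
                * Bilevel.weightedBias p (Bilevel.neumannBias μg ℓf0 ℓg1 N) n) := by
  have hst : Bilevel.Standing P μg ℓf0 ℓf1 ℓg1 ℓg2 σf σg1 σg2 := ⟨hP, hconv, hLip, hvar⟩
  -- The constant is `2 (6 (1 + 1/δ) + 1)`: the coefficient in `logBdd_gradient` with the eigenvalue
  -- ratio bounded by `rpow_neg_half_div_le`.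
  refine ⟨hst.isLowerSol_lowerSol, hst.differentiable_V, 14 + 12 / δ, fun N T hN hT M => ?_⟩
  obtain ⟨L, hL0, hL⟩ := hst.exists_surrogate_lipschitz
  have hμ := hst.mu_pos
  set t := δ ^ (-(1 / 2) : ℝ) with ht
  set a := (δ + M ^ 2) ^ (-(1 / 2) : ℝ) with ha
  have ha0 : 0 < a := Real.rpow_pos_of_pos (by positivity) _
  set c := Bilevel.couplingBound δ μg ℓg1
  -- The two entries are the conditions of `logBdd_gradient` solved for the ratio of step sizes; the
  -- factor `T` appears because that ratio is `cLow / (T cUp)`.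
  refine ⟨T * max (8 * (c * (2 + 3 * L)) / μg) (48 * (t * L ^ 2 * c) / (μg * a)),
    fun cUp cLow hcU hcL p hp D hD hM => ?_⟩
  subst hp
  have s : Bilevel.Setup Pr P ⟨T, N, ℓg1, ρ₁, ρ₂, δ, θ₀, φ₀, cUp, cLow⟩ D μg ℓf0 ℓf1 ℓg1 ℓg2
      σf σg1 σg2 M := ⟨hst, hD, rfl, hN, hT, hρ₁, hρ₂, hδ, hcU, hcL, hM⟩
  refine ⟨s.exists_randomIterateBound hbdd, fun hκ => ?_⟩
  have hr0 := s.ratio_pos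
  set r := Bilevel.Params.ratio (⟨T, N, ℓg1, ρ₁, ρ₂, δ, θ₀, φ₀, cUp, cLow⟩ : Bilevel.Params d q)
    with hr
  have hT0 : (0 : ℝ) < T := by exact_mod_cast hT
  have hle : max (8 * (c * (2 + 3 * L)) / μg) (48 * (t * L ^ 2 * c) / (μg * a)) ≤ r := by
    change _ ≤ cLow / (T * cUp)
    rw [le_div_iff₀ (mul_pos hT0 hcU)]
    linarith
  have h1 : c * (2 + 3 * L) ≤ r * μg / 8 := by
    have := (le_max_left _ _).trans hle
    rw [div_le_iff₀ hμ] at this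
    linarith
  have h2 : 12 * t * L ^ 2 / (r * μg) * c ≤ a / 4 := by
    have := (le_max_right _ _).trans hle
    rw [div_le_iff₀ (mul_pos hμ ha0)] at this
    rw [div_mul_eq_mul_div, div_le_iff₀ (mul_pos hr0 hμ)]
    linarith
  obtain ⟨C, hC⟩ := s.exists_randomIterateBound_of_logBdd (s.logBdd_gradient hbdd hL0 hL h1 h2)
  refine ⟨C, fun n hn R hR => ⟨(hC n hn R hR).1, (hC n hn R hR).2.trans ?_⟩⟩
  -- Enlarging the coefficient requires the weighted bias to be nonnegative, which its lower bound
  -- provides.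
  refine add_le_add le_rfl (mul_le_mul_of_nonneg_right (div_le_div_of_nonneg_right ?_ hcU.le)
    (le_trans ?_ (Bilevel.Setup.le_weightedBias hcU _ hn)))
  · have e1 := Bilevel.rpow_neg_half_div_le (M := M) hδ
    have e2 : 6 * t / a = 6 * (t / a) := by ring
    have e3 : (14 + 12 / δ) * (1 + M ^ 2)
        = 2 * (6 * ((1 + 1 / δ) * (1 + M ^ 2)) + 1) + 2 * M ^ 2 := by field_simp; ring
    change 2 * (6 * t / a + 1) ≤ _
    rw [e2, e3]
    linarith [sq_nonneg M]
  · exact mul_nonneg hcU.le (sq_nonneg _)
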